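/- **The calculus.** Let there be countably infinitely many variables $x$ and prompts $p$. Expressions, values and evaluation contexts are $$e ::= v \mid e\,e \mid \mathcal P x.e \mid \#_v e \mid \mathcal G_v x.e \mid v \triangleleft e,\qquad v ::= x \mid \lambda x.e \mid p \mid \ulcorner E\urcorner,\qquad E ::= \square \mid E\,e \mid v\,E \mid \#_p E,$$ where $\lambda x.e$, $\mathcal P x.e$ (generate a prompt) and $\mathcal G_v x.e$ (capture a continuation) bind $x$, $\#_v e$ is a control delimiter, $v\triangleleft e$ throws $e$ to a continuation, and terms are taken up to $\alpha$-equivalence. $E[e]$ is $E$ with its hole filled by $e$; $\mathrm{pr}(m)$ is the set of prompts occurring in $m$; $\mathrm{sp}(E)=\{p \mid \exists E_1,E_2,\ E=E_1[\#_pE_2]\}$. Write $\mathrm{fresh}(m_1,m_2,m_3)$ for $(\mathrm{pr}(m_1)\setminus\mathrm{pr}(m_2))\cap\mathrm{pr}(m_3)=\emptyset$. Reduction is generated by $$(\lambda x.e)\,v\to e\{v/x\},\quad \#_p v\to v,\quad \#_pE[\mathcal G_px.e]\to e\{\ulcorner E\urcorner/x\}\ (p\notin \mathrm{sp}(E)),\quad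 \ulcorner E\urcorner\triangleleft e\to E[e],\quad \mathcal Px.e\to e\{p/x\}\ (p\notin\mathrm{pr}(e)),$$ and: if $e_1\to e_2$ and $\mathrm{fresh}(e_2,e_1,E)$ then $E[e_1]\to E[e_2]$. A normal form is an expression that does not reduce. A control-stuck term is one of the form $E[\mathcal G_px.e]$ with $p\notin \mathrm{sp}(E)$; an error is a closed normal form that is neither a value nor control-stuck. **Contextual equivalence.** For closed $e_1,e_2$ write $e_1\equiv e_2$ if (1) $e_1$ reduces in zero or more steps to a value iff $e_2$ does; (2) $e_1$ reduces in zero or more steps to a control-stuck term iff $e_2$ does; (3) $e_1$ diverges (has an infinite reduction sequence) or reduces in zero or more steps to an error iff $e_2$ does. Closed $e_1,e_2$ are contextually equivalent, $e_1\doteq e_2$, if $E[e_1]\equiv E[e_2]$ for every closed evaluation context $E$ with $\mathrm{pr}(E)=\emptyset$. **Bisimilarity.** Multi-hole contexts $C$, value contexts $V$ and evaluation contexts $F$ are $$C ::= V\mid C\,C\mid \mathcal Px.C\mid \#_VC\mid\mathcal G_Vx.C\mid V\triangleleft C,\qquad V::=x\mid\lambda x.C\mid\ulcorner F\urcorner\mid\square_i,\qquad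 F::=\square\mid F\,C\mid V\,F\mid\#_{\square_i}F .$$ For a finite sequence $\Gamma$ of closed values, $C[\Gamma]$ (likewise $V[\Gamma]$, $F[\Gamma]$) replaces each $\square_i$ by $\Gamma_i$; this requires every hole index to be within $\Gamma$, and $\Gamma_i$ to be a prompt for each $\#_{\square_i}F$. States are pairs $(\Gamma,e)$ with $e$ closed; a state $(\Gamma,v)$ with $v$ a value is identified with the sequence $\Gamma,v$. With closed $C,V,F$, and writing $e\rightsquigarrow e'$ if $e\to e'$, or $e$ is a normal form and $e'=e$, the labelled transitions are: - $(\Gamma,e_1)\xrightarrow{\tau}(\Gamma,e_2)$ if $e_1\to e_2$ and $\mathrm{fresh}(e_2,e_1,\Gamma)$; - $\Gamma\xrightarrow{\lambda,i,V}(\Gamma,e\{V[\Gamma]/x\})$ if $\Gamma_i=\lambda x.e$; - $\Gamma\xrightarrow{\mathrm{val}}\Gamma$; - $\Gamma\xrightarrow{\ulcorner\cdot\urcorner,i,C}(\Gamma,E[C[\Gamma]])$ if $\Gamma_i=\ulcorner E\urcorner$; - $\Gamma\xrightarrow{\#,i,j}\Gamma$ if $\Gamma_i=\Gamma_j=p$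 for some prompt $p$; - $\Gamma\xrightarrow{\mathcal P}(\Gamma,p)$ if $p\notin\mathrm{pr}(\Gamma)$; - $(\Gamma,E[\mathcal G_px.e])\xrightarrow{F}(\Gamma,e')$ if $p\notin\mathrm{sp}(E)$ and $F[\Gamma][E[\mathcal G_px.e]]\rightsquigarrow e'$. Let $\Rightarrow$ be $(\xrightarrow{\tau})^*$, and let $\overset{\alpha}{\Rightarrow}$ be $\Rightarrow$ if $\alpha=\tau$ and $\Rightarrow\xrightarrow{\alpha}\Rightarrow$ otherwise. A bisimulation is a relation $R$ on states such that whenever $s\,R\,t$: if $s\xrightarrow{\alpha}s'$ then $t\overset{\alpha}{\Rightarrow}t'$ for some $t'$ with $s'\,R\,t'$, and conversely, if $t\xrightarrow{\alpha}t'$ then $s\overset{\alpha}{\Rightarrow}s'$ for some $s'$ with $s'\,R\,t'$. Bisimilarity $\sim$ is the union of all bisimulations. **Theorem.** For all closed expressions $e_1,e_2$: $\;e_1\doteq e_2$ if and only if $(\emptyset,e_1)\sim(\emptyset,e_2)$. -/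

import Mathlib

/-! # The call-by-value lambda-calculus with delimited control and dynamic prompt generation

Terms are taken up to renaming of bound variables; they are represented by well-scoped
de Bruijn terms: `Exp A n` is the type of expressions with free variables in `Fin n`, so that
closed expressions are the elements of `Exp A 0`.

The syntax is parameterized by the type `A` of the constants that may name control delimiters:

* `A = Prompt` gives the expressions, values and evaluation contexts of the calculus;
* `A = Hole` gives the (promptless) multi-hole contexts, value contexts and evaluation contexts
  built over numbered holes: their grammars are those of expressions, values and
  evaluation contexts in which each prompt constant is replaced by a numbered hole. -/

namespace LamPrompt

mutual

/-- Expressions `e ::= v | e e | new x. e | reset v e | grab v x. e | throw v e`.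
`fresh e` generates a prompt, locally bound to variable `0` of `e`; `reset v e` delimits `e`;
`grab v e` captures the continuation up to the delimiter `v` and binds it to variable `0` of `e`;
`push v e` throws `e` to the captured continuation `v`. -/
inductive Exp (A : Type) : ℕ → Type
  | val {n : ℕ} (v : Val A n) : Exp A n
  | app {n : ℕ} (e₁ e₂ : Exp A n) : Exp A n
  | fresh {n : ℕ} (e : Exp A (n + 1)) : Exp A n
  | reset {n : ℕ} (v : Val A n) (e : Exp A n) : Exp A n
  | grab {n : ℕ} (v : Val A n) (e : Exp A (n + 1)) : Exp A n
  | push {n : ℕ} (v : Val A n) (e : Exp A n) : Exp A n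

/-- Values `v ::= x | λ x. e | p | ⌜E⌝`. -/
inductive Val (A : Type) : ℕ → Type
  | var {n : ℕ} (x : Fin n) : Val A n
  | lam {n : ℕ} (e : Exp A (n + 1)) : Val A n
  | const {n : ℕ} (a : A) : Val A n
  | cont {n : ℕ} (E : Ectx A n) : Val A n

/-- Evaluation contexts, read outside-in: `E ::= □ | E e | v E | reset p E`. -/
inductive Ectx (A : Type) : ℕ → Type
  | hole {n : ℕ} : Ectx A n
  | appL {n : ℕ} (E : Ectx A n) (e : Exp A n) : Ectx A n
  | appR {n : ℕ} (v : Val A n) (E : Ectx A n) : Ectx A n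
  | reset {n : ℕ} (a : A) (E : Ectx A n) : Ectx A n

end

/-- The countably infinite set of prompts. -/
structure Prompt where
  id : ℕ

/-- The numbered holes of multi-hole contexts (numbered from `0`). -/
structure Hole where
  idx : ℕ

/-! ## Renaming and capture-avoiding substitution of values for variables -/

/-- Extension of a renaming under a binder. -/
def liftRen {n m : ℕ} (r : Fin n → Fin m) : Fin (n + 1) → Fin (m + 1) :=
  Fin.cases 0 (fun i => (r i).succ)

mutual

/-- Renaming of the free variables of an expression. -/
def Exp.rename {A : Type} : {n : ℕ} → Exp A n → {m : ℕ} → (Fin n → Fin m) → Exp A m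
  | _, .val v, _, r => .val (v.rename r)
  | _, .app e₁ e₂, _, r => .app (e₁.rename r) (e₂.rename r)
  | _, .fresh e, _, r => .fresh (e.rename (liftRen r))
  | _, .reset v e, _, r => .reset (v.rename r) (e.rename r)
  | _, .grab v e, _, r => .grab (v.rename r) (e.rename (liftRen r))
  | _, .push v e, _, r => .push (v.rename r) (e.rename r)

/-- Renaming of the free variables of a value. -/
def Val.rename {A : Type} : {n : ℕ} → Val A n → {m : ℕ} → (Fin n → Fin m) → Val A m
  | _, .var x, _, r => .var (r x)
  | _, .lam e, _, r => .lam (e.rename (liftRen r))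
  | _, .const a, _, _ => .const a
  | _, .cont E, _, r => .cont (E.rename r)

/-- Renaming of the free variables of an evaluation context. -/
def Ectx.rename {A : Type} : {n : ℕ} → Ectx A n → {m : ℕ} → (Fin n → Fin m) → Ectx A m
  | _, .hole, _, _ => .hole
  | _, .appL E e, _, r => .appL (E.rename r) (e.rename r)
  | _, .appR v E, _, r => .appR (v.rename r) (E.rename r)
  | _, .reset a E, _, r => .reset a (E.rename r)

end

/-- A closed value, seen as a value in any scope. -/
def Val.weaken {A : Type} (v : Val A 0) (n : ℕ) : Val A n :=
  v.rename (fun i => i.elim0)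

/-- Extension of a substitution under a binder. -/
def liftSub {A : Type} {n m : ℕ} (s : Fin n → Val A m) : Fin (n + 1) → Val A (m + 1) :=
  Fin.cases (.var 0) (fun i => (s i).rename Fin.succ)

mutual

/-- Simultaneous substitution of values for the free variables of an expression. -/
def Exp.subst {A : Type} : {n : ℕ} → Exp A n → {m : ℕ} → (Fin n → Val A m) → Exp A m
  | _, .val v, _, s => .val (v.subst s)
  | _, .app e₁ e₂, _, s => .app (e₁.subst s) (e₂.subst s)
  | _, .fresh e, _, s => .fresh (e.subst (liftSub s))
  | _, .reset v e, _, s => .reset (v.subst s) (e.subst s)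
  | _, .grab v e, _, s => .grab (v.subst s) (e.subst (liftSub s))
  | _, .push v e, _, s => .push (v.subst s) (e.subst s)

/-- Simultaneous substitution of values for the free variables of a value. -/
def Val.subst {A : Type} : {n : ℕ} → Val A n → {m : ℕ} → (Fin n → Val A m) → Val A m
  | _, .var x, _, s => s x
  | _, .lam e, _, s => .lam (e.subst (liftSub s))
  | _, .const a, _, _ => .const a
  | _, .cont E, _, s => .cont (E.subst s)

/-- Simultaneous substitution of values for the free variables of an evaluation context. -/
def Ectx.subst {A : Type} : {n : ℕ} → Ectx A n → {m : ℕ} → (Fin n → Val A m) → Ectx A m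
  | _, .hole, _, _ => .hole
  | _, .appL E e, _, s => .appL (E.subst s) (e.subst s)
  | _, .appR v E, _, s => .appR (v.subst s) (E.subst s)
  | _, .reset a E, _, s => .reset a (E.subst s)

end

/-- `e{v/x}`, where `x` is the variable `0` of `e`. -/
def Exp.inst {A : Type} {n : ℕ} (e : Exp A (n + 1)) (v : Val A n) : Exp A n :=
  e.subst (Fin.cases v (fun i => .var i))

/-! ## Plugging, occurring prompts, surrounding prompts -/

/-- `E[e]`. -/
def Ectx.plug {A : Type} {n : ℕ} : Ectx A n → Exp A n → Exp A n
  | .hole, e => e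
  | .appL E e', e => .app (E.plug e) e'
  | .appR v E, e => .app (.val v) (E.plug e)
  | .reset a E, e => .reset (.const a) (E.plug e)

mutual

/-- The set of all prompts that occur in an expression. -/
def Exp.prompts {A : Type} : {n : ℕ} → Exp A n → Set A
  | _, .val v => v.prompts
  | _, .app e₁ e₂ => e₁.prompts ∪ e₂.prompts
  | _, .fresh e => e.prompts
  | _, .reset v e => v.prompts ∪ e.prompts
  | _, .grab v e => v.prompts ∪ e.prompts
  | _, .push v e => v.prompts ∪ e.prompts

/-- The set of all prompts that occur in a value. -/
def Val.prompts {A : Type} : {n : ℕ} → Val A n → Set A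
  | _, .var _ => ∅
  | _, .lam e => e.prompts
  | _, .const a => {a}
  | _, .cont E => E.prompts

/-- The set of all prompts that occur in an evaluation context. -/
def Ectx.prompts {A : Type} : {n : ℕ} → Ectx A n → Set A
  | _, .hole => ∅
  | _, .appL E e => E.prompts ∪ e.prompts
  | _, .appR v E => v.prompts ∪ E.prompts
  | _, .reset a E => {a} ∪ E.prompts

end

/-- The set of all prompts that guard the hole of an evaluation context. -/
def Ectx.surrounding {A : Type} {n : ℕ} : Ectx A n → Set A
  | .hole => ∅
  | .appL E _ => E.surrounding
  | .appR _ E => E.surrounding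
  | .reset a E => {a} ∪ E.surrounding

/-- The set of all prompts that occur in a sequence of closed values. -/
def seqPrompts (Γ : List (Val Prompt 0)) : Set Prompt :=
  {p | ∃ v ∈ Γ, p ∈ v.prompts}

/-- Given the prompt sets of `m₁`, `m₂`, `m₃`: the prompts of `m₁` that are not in `m₂`
do not occur in `m₃`. -/
def FreshCond (P₁ P₂ P₃ : Set Prompt) : Prop :=
  (P₁ \ P₂) ∩ P₃ = ∅

/-! ## Reduction semantics -/

/-- The reduction relation. -/
inductive Red {n : ℕ} : Exp Prompt n → Exp Prompt n → Prop
  | beta (e : Exp Prompt (n + 1)) (v : Val Prompt n) :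
      Red (.app (.val (.lam e)) (.val v)) (e.inst v)
  | reset (p : Prompt) (v : Val Prompt n) :
      Red (.reset (.const p) (.val v)) (.val v)
  | grab (p : Prompt) (E : Ectx Prompt n) (e : Exp Prompt (n + 1)) (h : p ∉ E.surrounding) :
      Red (.reset (.const p) (E.plug (.grab (.const p) e))) (e.inst (.cont E))
  | push (E : Ectx Prompt n) (e : Exp Prompt n) :
      Red (.push (.cont E) e) (E.plug e)
  | fresh (p : Prompt) (e : Exp Prompt (n + 1)) (h : p ∉ e.prompts) :
      Red (.fresh e) (e.inst (.const p))
  | compat (E : Ectx Prompt n) (e₁ e₂ : Exp Prompt n) (h : Red e₁ e₂)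
      (hf : FreshCond e₂.prompts e₁.prompts E.prompts) :
      Red (E.plug e₁) (E.plug e₂)

/-- Reduction in zero or more steps. -/
def RedStar {n : ℕ} : Exp Prompt n → Exp Prompt n → Prop :=
  Relation.ReflTransGen Red

/-- Normal forms: expressions that do not reduce. -/
def NormalForm {n : ℕ} (e : Exp Prompt n) : Prop :=
  ∀ e', ¬ Red e e'

/-- The expression is a value. -/
def IsValue {n : ℕ} (e : Exp Prompt n) : Prop :=
  ∃ v, e = .val v

/-- Control-stuck terms `E[grab p x. e]` with `p` not surrounding the hole of `E`. -/
def IsStuck {n : ℕ} (e : Exp Prompt n) : Prop :=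
  ∃ (E : Ectx Prompt n) (p : Prompt) (e' : Exp Prompt (n + 1)),
    p ∉ E.surrounding ∧ e = E.plug (.grab (.const p) e')

/-- Errors: the normal forms that are neither values nor control-stuck. -/
def IsError {n : ℕ} (e : Exp Prompt n) : Prop :=
  NormalForm e ∧ ¬ IsValue e ∧ ¬ IsStuck e

/-- There is an infinite sequence of reductions starting with `e`. -/
def Diverges {n : ℕ} (e : Exp Prompt n) : Prop :=
  ∃ f : ℕ → Exp Prompt n, f 0 = e ∧ ∀ k, Red (f k) (f (k + 1))

/-- The expression diverges or reduces to an error. -/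
def DivOrErr {n : ℕ} (e : Exp Prompt n) : Prop :=
  Diverges e ∨ ∃ e', RedStar e e' ∧ IsError e'

/-- Two closed expressions have equivalent observable actions. -/
def ObsEq (e₁ e₂ : Exp Prompt 0) : Prop :=
  ((∃ e, RedStar e₁ e ∧ IsValue e) ↔ (∃ e, RedStar e₂ e ∧ IsValue e)) ∧
  ((∃ e, RedStar e₁ e ∧ IsStuck e) ↔ (∃ e, RedStar e₂ e ∧ IsStuck e)) ∧
  (DivOrErr e₁ ↔ DivOrErr e₂)

/-- Contextual equivalence of closed expressions: equivalent observable actions in all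
(closed) evaluation contexts in which no prompt occurs. -/
def CtxEq (e₁ e₂ : Exp Prompt 0) : Prop :=
  ∀ E : Ectx Prompt 0, E.prompts = ∅ → ObsEq (E.plug e₁) (E.plug e₂)

/-! ## Filling multi-hole contexts with a sequence of closed values

`Valid Γ C` says that filling `C` with `Γ` produces an expression (a value, an evaluation
context): every hole index is within the length of `Γ`, and every hole used as a delimiter of an
evaluation context is filled with a prompt. The function `fill` is total; it is used
only under `Valid`, where the default values below are never consulted. -/

/-- The value for the hole `a` (with an arbitrary default value out of range). -/
def look (Γ : List (Val Prompt 0)) (a : Hole) : Val Prompt 0 :=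
  Γ.getD a.idx (.lam (.val (.var 0)))

/-- The prompt denoted by a value (with an arbitrary default for other values). -/
def Val.toPrompt {n : ℕ} : Val Prompt n → Prompt
  | .const p => p
  | _ => ⟨0⟩

mutual

/-- `C[Γ]` for a multi-hole context. -/
def Exp.fill (Γ : List (Val Prompt 0)) : {n : ℕ} → Exp Hole n → Exp Prompt n
  | _, .val v => .val (v.fill Γ)
  | _, .app e₁ e₂ => .app (e₁.fill Γ) (e₂.fill Γ)
  | _, .fresh e => .fresh (e.fill Γ)
  | _, .reset v e => .reset (v.fill Γ) (e.fill Γ)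
  | _, .grab v e => .grab (v.fill Γ) (e.fill Γ)
  | _, .push v e => .push (v.fill Γ) (e.fill Γ)

/-- `V[Γ]` for a multi-hole value context. -/
def Val.fill (Γ : List (Val Prompt 0)) : {n : ℕ} → Val Hole n → Val Prompt n
  | _, .var x => .var x
  | _, .lam e => .lam (e.fill Γ)
  | n, .const a => (look Γ a).weaken n
  | _, .cont E => .cont (E.fill Γ)

/-- `E[Γ]` for a multi-hole evaluation context. -/
def Ectx.fill (Γ : List (Val Prompt 0)) : {n : ℕ} → Ectx Hole n → Ectx Prompt n
  | _, .hole => .hole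
  | _, .appL E e => .appL (E.fill Γ) (e.fill Γ)
  | _, .appR v E => .appR (v.fill Γ) (E.fill Γ)
  | _, .reset a E => .reset (look Γ a).toPrompt (E.fill Γ)

end

mutual

/-- Filling the multi-hole context with `Γ` produces an expression. -/
def Exp.Valid (Γ : List (Val Prompt 0)) : {n : ℕ} → Exp Hole n → Prop
  | _, .val v => v.Valid Γ
  | _, .app e₁ e₂ => e₁.Valid Γ ∧ e₂.Valid Γ
  | _, .fresh e => e.Valid Γ
  | _, .reset v e => v.Valid Γ ∧ e.Valid Γ
  | _, .grab v e => v.Valid Γ ∧ e.Valid Γ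
  | _, .push v e => v.Valid Γ ∧ e.Valid Γ

/-- Filling the multi-hole value context with `Γ` produces a value. -/
def Val.Valid (Γ : List (Val Prompt 0)) : {n : ℕ} → Val Hole n → Prop
  | _, .var _ => True
  | _, .lam e => e.Valid Γ
  | _, .const a => a.idx < Γ.length
  | _, .cont E => E.Valid Γ

/-- Filling the multi-hole evaluation context with `Γ` produces an evaluation context. -/
def Ectx.Valid (Γ : List (Val Prompt 0)) : {n : ℕ} → Ectx Hole n → Prop
  | _, .hole => True
  | _, .appL E e => E.Valid Γ ∧ e.Valid Γ
  | _, .appR v E => v.Valid Γ ∧ E.Valid Γ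
  | _, .reset a E => (∃ p, Γ[a.idx]? = some (.const p)) ∧ E.Valid Γ

end

/-! ## Labeled transition system -/

/-- States `(Γ, e)`: a finite sequence of closed values and a closed expression.
A state `(Γ, v)` whose expression is a value is the sequence of values `Γ, v`, that is,
`Γ ++ [v]`. -/
abbrev State : Type := List (Val Prompt 0) × Exp Prompt 0

/-- Labels of transitions. -/
inductive Label
  | tau
  | lam (i : ℕ) (V : Val Hole 0)
  | val
  | ctx (i : ℕ) (C : Exp Hole 0)
  | prompt (i j : ℕ)
  | new
  | stuck (E : Ectx Hole 0)

/-- One reduction step for reducible expressions; normal forms are related to themselves. -/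
def RedBis (e e' : Exp Prompt 0) : Prop :=
  Red e e' ∨ (NormalForm e ∧ e' = e)

/-- The transitions. In the rules whose source is a sequence of values `Δ`, the source is
written `(Γ, v)`, with `Δ = Γ ++ [v]`. -/
inductive Step : State → Label → State → Prop
  | tau (Γ : List (Val Prompt 0)) (e₁ e₂ : Exp Prompt 0) (h : Red e₁ e₂)
      (hf : FreshCond e₂.prompts e₁.prompts (seqPrompts Γ)) :
      Step (Γ, e₁) .tau (Γ, e₂)
  | lam (Γ : List (Val Prompt 0)) (v : Val Prompt 0) (i : ℕ) (V : Val Hole 0)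
      (e : Exp Prompt 1) (hi : (Γ ++ [v])[i]? = some (.lam e)) (hV : V.Valid (Γ ++ [v])) :
      Step (Γ, .val v) (.lam i V) (Γ ++ [v], e.inst (V.fill (Γ ++ [v])))
  | val (Γ : List (Val Prompt 0)) (v : Val Prompt 0) :
      Step (Γ, .val v) .val (Γ, .val v)
  | ctx (Γ : List (Val Prompt 0)) (v : Val Prompt 0) (i : ℕ) (C : Exp Hole 0)
      (E : Ectx Prompt 0) (hi : (Γ ++ [v])[i]? = some (.cont E)) (hC : C.Valid (Γ ++ [v])) :
      Step (Γ, .val v) (.ctx i C) (Γ ++ [v], E.plug (C.fill (Γ ++ [v])))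
  | prompt (Γ : List (Val Prompt 0)) (v : Val Prompt 0) (i j : ℕ) (p : Prompt)
      (hi : (Γ ++ [v])[i]? = some (.const p)) (hj : (Γ ++ [v])[j]? = some (.const p)) :
      Step (Γ, .val v) (.prompt i j) (Γ, .val v)
  | new (Γ : List (Val Prompt 0)) (v : Val Prompt 0) (p : Prompt)
      (hp : p ∉ seqPrompts (Γ ++ [v])) :
      Step (Γ, .val v) .new (Γ ++ [v], .val (.const p))
  | stuck (Γ : List (Val Prompt 0)) (F : Ectx Hole 0) (E : Ectx Prompt 0) (p : Prompt)
      (e : Exp Prompt 1) (e' : Exp Prompt 0) (hp : p ∉ E.surrounding) (hF : F.Valid Γ)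
      (hr : RedBis ((F.fill Γ).plug (E.plug (.grab (.const p) e))) e') :
      Step (Γ, E.plug (.grab (.const p) e)) (.stuck F) (Γ, e')

/-- Zero or more internal transitions. -/
def WeakTau : State → State → Prop :=
  Relation.ReflTransGen (fun s s' => Step s .tau s')

/-- Weak transitions. -/
def WeakStep (s : State) (a : Label) (s' : State) : Prop :=
  (a = .tau ∧ WeakTau s s') ∨
  (a ≠ .tau ∧ ∃ s₁ s₂, WeakTau s s₁ ∧ Step s₁ a s₂ ∧ WeakTau s₂ s')

/-! ## Bisimilarity -/

/-- The relation `R` progresses to the relation `S`. -/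
def Progresses (R S : State → State → Prop) : Prop :=
  (∀ s t, R s t → S s t) ∧
  ∀ s t, R s t →
    (∀ a s', Step s a s' → ∃ t', WeakStep t a t' ∧ S s' t') ∧
    (∀ a t', Step t a t' → ∃ s', WeakStep s a s' ∧ S s' t')

/-- Bisimulations. -/
def IsBisimulation (R : State → State → Prop) : Prop :=
  Progresses R R

/-- Bisimilarity: the union of all bisimulations. -/
def Bisimilar (s t : State) : Prop :=
  ∃ R, IsBisimulation R ∧ R s t

end LamPrompt

/-! # Contextual equivalence coincides with bisimilarity

Reduction is deterministic up to the choice of generated prompts: an expression has at most one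
active subexpression in evaluation position, and two reducts differ by a permutation of prompts
(`Red.deterministic`). Hence the number of steps to a value or to a control-stuck expression does
not depend on the choices, and diverging or reaching an error means reaching neither
(`divOrErr_iff`). So only the predicates `Conv O` matter, for the outcomes `O` made of values or of
control-stuck expressions.

*Bisimilar expressions are contextually equivalent.* Two statements are proved simultaneously by
induction on the number of steps to the outcome (`conv_of_bisimilar`): bisimilar states `(Γ, e₁)` and
`(Δ, e₂)` have the same outcomes in `F[Γ]` and `F[Δ]`, and bisimilar sequences `Γ` and `Δ` yield
expressions `C[Γ]` and `C[Δ]` with the same outcomes. Each step of `C[Γ]` either takes place in `C`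
itself and is copied, or involves an element of `Γ`, and then a labelled transition provides the
matching step (`SeqBisimilar.fire`).

*Contextually equivalent expressions are bisimilar.* The relation `TestEq`, which says that `F[Γ][e₁]`
and `F[Δ][e₂]` have the same outcomes for all `F`, is a bisimulation. Every transition out of a
sequence of values amounts to a test by a context `C` that uses all the values, the last one
included, while `TestEq` grants the last value `v` only in the hole of an evaluation context. If the
hole for `v` could be abstracted, the test would be `(λ z. C) v`. This is not always possible, since
the syntax has no continuation `⌜E⌝` with a variable as a delimiter. Instead, `Exp.abstr` replaces
`⌜E⌝` by an expression `new x. reset x (E[grab x k. k])` that builds the continuation, and drops `⌜E⌝`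
where it can only cause an error; the relation `ExpSim` between a term and its variant is a
simulation that preserves outcomes in both directions (`ExpSim.conv_iff`). The kinds of values, and
equality of prompts, are told apart by small tests (`conv_reset_iff`, `conv_push_iff`,
`SeqTestEq.prompt`). -/

namespace LamPrompt

/-! ### Renaming and substitution -/

theorem liftRen_comp {n m k : ℕ} (r : Fin n → Fin m) (r' : Fin m → Fin k) :
    (fun i => liftRen r' (liftRen r i)) = liftRen (fun i => r' (r i)) := by
  funext i
  cases i using Fin.cases <;> rfl

mutual

theorem Exp.rename_rename {A : Type} : ∀ {n : ℕ} (e : Exp A n) {m k : ℕ} (r : Fin n → Fin m)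
    (r' : Fin m → Fin k), (e.rename r).rename r' = e.rename (fun i => r' (r i))
  | _, .val v, _, _, r, r' => by simp [Exp.rename, v.rename_rename]
  | _, .app e₁ e₂, _, _, r, r' => by
    simp [Exp.rename, e₁.rename_rename, e₂.rename_rename]
  | _, .fresh e, _, _, r, r' => by simp [Exp.rename, e.rename_rename, liftRen_comp]
  | _, .reset v e, _, _, r, r' => by simp [Exp.rename, v.rename_rename, e.rename_rename]
  | _, .grab v e, _, _, r, r' => by
    simp [Exp.rename, v.rename_rename, e.rename_rename, liftRen_comp]
  | _, .push v e, _, _, r, r' => by simp [Exp.rename, v.rename_rename, e.rename_rename]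

theorem Val.rename_rename {A : Type} : ∀ {n : ℕ} (v : Val A n) {m k : ℕ} (r : Fin n → Fin m)
    (r' : Fin m → Fin k), (v.rename r).rename r' = v.rename (fun i => r' (r i))
  | _, .var _, _, _, _, _ => rfl
  | _, .lam e, _, _, r, r' => by simp [Val.rename, e.rename_rename, liftRen_comp]
  | _, .const _, _, _, _, _ => rfl
  | _, .cont E, _, _, r, r' => by simp [Val.rename, E.rename_rename]

theorem Ectx.rename_rename {A : Type} : ∀ {n : ℕ} (E : Ectx A n) {m k : ℕ} (r : Fin n → Fin m)
    (r' : Fin m → Fin k), (E.rename r).rename r' = E.rename (fun i => r' (r i))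
  | _, .hole, _, _, _, _ => rfl
  | _, .appL E e, _, _, r, r' => by simp [Ectx.rename, E.rename_rename, e.rename_rename]
  | _, .appR v E, _, _, r, r' => by simp [Ectx.rename, E.rename_rename, v.rename_rename]
  | _, .reset a E, _, _, r, r' => by simp [Ectx.rename, E.rename_rename]

end

theorem liftSub_liftRen {A : Type} {n m k : ℕ} (r : Fin n → Fin m) (s : Fin m → Val A k) :
    (fun i => liftSub s (liftRen r i)) = liftSub (fun i => s (r i)) := by
  funext i
  cases i using Fin.cases <;> rfl

mutual

theorem Exp.rename_subst {A : Type} : ∀ {n : ℕ} (e : Exp A n) {m k : ℕ} (r : Fin n → Fin m)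
    (s : Fin m → Val A k), (e.rename r).subst s = e.subst (fun i => s (r i))
  | _, .val v, _, _, r, s => by simp [Exp.rename, Exp.subst, v.rename_subst]
  | _, .app e₁ e₂, _, _, r, s => by
    simp [Exp.rename, Exp.subst, e₁.rename_subst, e₂.rename_subst]
  | _, .fresh e, _, _, r, s => by
    simp [Exp.rename, Exp.subst, e.rename_subst, liftSub_liftRen]
  | _, .reset v e, _, _, r, s => by
    simp [Exp.rename, Exp.subst, v.rename_subst, e.rename_subst]
  | _, .grab v e, _, _, r, s => by
    simp [Exp.rename, Exp.subst, v.rename_subst, e.rename_subst, liftSub_liftRen]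
  | _, .push v e, _, _, r, s => by
    simp [Exp.rename, Exp.subst, v.rename_subst, e.rename_subst]

theorem Val.rename_subst {A : Type} : ∀ {n : ℕ} (v : Val A n) {m k : ℕ} (r : Fin n → Fin m)
    (s : Fin m → Val A k), (v.rename r).subst s = v.subst (fun i => s (r i))
  | _, .var _, _, _, _, _ => rfl
  | _, .lam e, _, _, r, s => by
    simp [Val.rename, Val.subst, e.rename_subst, liftSub_liftRen]
  | _, .const _, _, _, _, _ => rfl
  | _, .cont E, _, _, r, s => by simp [Val.rename, Val.subst, E.rename_subst]

theorem Ectx.rename_subst {A : Type} : ∀ {n : ℕ} (E : Ectx A n) {m k : ℕ} (r : Fin n → Fin m)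
    (s : Fin m → Val A k), (E.rename r).subst s = E.subst (fun i => s (r i))
  | _, .hole, _, _, _, _ => rfl
  | _, .appL E e, _, _, r, s => by
    simp [Ectx.rename, Ectx.subst, E.rename_subst, e.rename_subst]
  | _, .appR v E, _, _, r, s => by
    simp [Ectx.rename, Ectx.subst, E.rename_subst, v.rename_subst]
  | _, .reset a E, _, _, r, s => by simp [Ectx.rename, Ectx.subst, E.rename_subst]

end

theorem liftSub_rename {A : Type} {n m k : ℕ} (s : Fin n → Val A m) (r : Fin m → Fin k) :
    (fun i => (liftSub s i).rename (liftRen r)) = liftSub (fun i => (s i).rename r) := by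
  funext i
  cases i using Fin.cases with
  | zero => rfl
  | succ i =>
    simp only [liftSub, Fin.cases_succ, Val.rename_rename]
    rfl

mutual

theorem Exp.subst_rename {A : Type} : ∀ {n : ℕ} (e : Exp A n) {m k : ℕ} (s : Fin n → Val A m)
    (r : Fin m → Fin k), (e.subst s).rename r = e.subst (fun i => (s i).rename r)
  | _, .val v, _, _, s, r => by simp [Exp.rename, Exp.subst, v.subst_rename]
  | _, .app e₁ e₂, _, _, s, r => by
    simp [Exp.rename, Exp.subst, e₁.subst_rename, e₂.subst_rename]
  | _, .fresh e, _, _, s, r => by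
    simp [Exp.rename, Exp.subst, e.subst_rename, liftSub_rename]
  | _, .reset v e, _, _, s, r => by
    simp [Exp.rename, Exp.subst, v.subst_rename, e.subst_rename]
  | _, .grab v e, _, _, s, r => by
    simp [Exp.rename, Exp.subst, v.subst_rename, e.subst_rename, liftSub_rename]
  | _, .push v e, _, _, s, r => by
    simp [Exp.rename, Exp.subst, v.subst_rename, e.subst_rename]

theorem Val.subst_rename {A : Type} : ∀ {n : ℕ} (v : Val A n) {m k : ℕ} (s : Fin n → Val A m)
    (r : Fin m → Fin k), (v.subst s).rename r = v.subst (fun i => (s i).rename r)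
  | _, .var _, _, _, _, _ => rfl
  | _, .lam e, _, _, s, r => by
    simp [Val.rename, Val.subst, e.subst_rename, liftSub_rename]
  | _, .const _, _, _, _, _ => rfl
  | _, .cont E, _, _, s, r => by simp [Val.rename, Val.subst, E.subst_rename]

theorem Ectx.subst_rename {A : Type} : ∀ {n : ℕ} (E : Ectx A n) {m k : ℕ} (s : Fin n → Val A m)
    (r : Fin m → Fin k), (E.subst s).rename r = E.subst (fun i => (s i).rename r)
  | _, .hole, _, _, _, _ => rfl
  | _, .appL E e, _, _, s, r => by
    simp [Ectx.rename, Ectx.subst, E.subst_rename, e.subst_rename]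
  | _, .appR v E, _, _, s, r => by
    simp [Ectx.rename, Ectx.subst, E.subst_rename, v.subst_rename]
  | _, .reset a E, _, _, s, r => by simp [Ectx.rename, Ectx.subst, E.subst_rename]

end

theorem liftSub_var {A : Type} {n m : ℕ} (r : Fin n → Fin m) :
    liftSub (fun i => Val.var (A := A) (r i)) = fun i => .var (liftRen r i) := by
  funext i
  cases i using Fin.cases <;> rfl

mutual

theorem Exp.subst_var_eq_rename {A : Type} : ∀ {n : ℕ} (e : Exp A n) {m : ℕ} (r : Fin n → Fin m),
    e.subst (fun i => .var (r i)) = e.rename r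
  | _, .val v, _, r => by simp [Exp.rename, Exp.subst, v.subst_var_eq_rename]
  | _, .app e₁ e₂, _, r => by
    simp [Exp.rename, Exp.subst, e₁.subst_var_eq_rename, e₂.subst_var_eq_rename]
  | _, .fresh e, _, r => by simp [Exp.rename, Exp.subst, e.subst_var_eq_rename, liftSub_var]
  | _, .reset v e, _, r => by
    simp [Exp.rename, Exp.subst, v.subst_var_eq_rename, e.subst_var_eq_rename]
  | _, .grab v e, _, r => by
    simp [Exp.rename, Exp.subst, v.subst_var_eq_rename, e.subst_var_eq_rename, liftSub_var]
  | _, .push v e, _, r => by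
    simp [Exp.rename, Exp.subst, v.subst_var_eq_rename, e.subst_var_eq_rename]

theorem Val.subst_var_eq_rename {A : Type} : ∀ {n : ℕ} (v : Val A n) {m : ℕ} (r : Fin n → Fin m),
    v.subst (fun i => .var (r i)) = v.rename r
  | _, .var _, _, _ => rfl
  | _, .lam e, _, r => by simp [Val.rename, Val.subst, e.subst_var_eq_rename, liftSub_var]
  | _, .const _, _, _ => rfl
  | _, .cont E, _, r => by simp [Val.rename, Val.subst, E.subst_var_eq_rename]

theorem Ectx.subst_var_eq_rename {A : Type} : ∀ {n : ℕ} (E : Ectx A n) {m : ℕ}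
    (r : Fin n → Fin m), E.subst (fun i => .var (r i)) = E.rename r
  | _, .hole, _, _ => rfl
  | _, .appL E e, _, r => by
    simp [Ectx.rename, Ectx.subst, E.subst_var_eq_rename, e.subst_var_eq_rename]
  | _, .appR v E, _, r => by
    simp [Ectx.rename, Ectx.subst, E.subst_var_eq_rename, v.subst_var_eq_rename]
  | _, .reset a E, _, r => by simp [Ectx.rename, Ectx.subst, E.subst_var_eq_rename]

end

theorem liftRen_id {n : ℕ} : liftRen (fun i : Fin n => i) = fun i => i := by
  funext i
  cases i using Fin.cases <;> rfl

mutual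

theorem Exp.rename_id {A : Type} : ∀ {n : ℕ} (e : Exp A n), e.rename (fun i => i) = e
  | _, .val v => by simp [Exp.rename, v.rename_id]
  | _, .app e₁ e₂ => by simp [Exp.rename, e₁.rename_id, e₂.rename_id]
  | _, .fresh e => by simp [Exp.rename, e.rename_id, liftRen_id]
  | _, .reset v e => by simp [Exp.rename, v.rename_id, e.rename_id]
  | _, .grab v e => by simp [Exp.rename, v.rename_id, e.rename_id, liftRen_id]
  | _, .push v e => by simp [Exp.rename, v.rename_id, e.rename_id]

theorem Val.rename_id {A : Type} : ∀ {n : ℕ} (v : Val A n), v.rename (fun i => i) = v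
  | _, .var _ => rfl
  | _, .lam e => by simp [Val.rename, e.rename_id, liftRen_id]
  | _, .const _ => rfl
  | _, .cont E => by simp [Val.rename, E.rename_id]

theorem Ectx.rename_id {A : Type} : ∀ {n : ℕ} (E : Ectx A n), E.rename (fun i => i) = E
  | _, .hole => rfl
  | _, .appL E e => by simp [Ectx.rename, E.rename_id, e.rename_id]
  | _, .appR v E => by simp [Ectx.rename, E.rename_id, v.rename_id]
  | _, .reset a E => by simp [Ectx.rename, E.rename_id]

end

theorem Ectx.subst_var {A : Type} {n : ℕ} (E : Ectx A n) : E.subst (fun i => .var i) = E := by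
  rw [E.subst_var_eq_rename (fun i => i), E.rename_id]

theorem Val.weaken_rename {A : Type} (v : Val A 0) {n m : ℕ} (r : Fin n → Fin m) :
    (v.weaken n).rename r = v.weaken m := by
  rw [Val.weaken, Val.rename_rename, Val.weaken]
  congr 1
  exact Subsingleton.elim _ _

theorem Val.weaken_subst {A : Type} (v : Val A 0) {n m : ℕ} (s : Fin n → Val A m) :
    (v.weaken n).subst s = v.weaken m := by
  rw [Val.weaken, Val.rename_subst, Val.weaken, ← Val.subst_var_eq_rename]
  congr 1
  exact Subsingleton.elim _ _

theorem Val.weaken_zero {A : Type} (v : Val A 0) : v.weaken 0 = v := by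
  rw [Val.weaken, Subsingleton.elim (fun i : Fin 0 => (i.elim0 : Fin 0)) (fun i => i), v.rename_id]

/-! ### Evaluation contexts -/

/-- The composite `E₁[E₂]` of two evaluation contexts. -/
def Ectx.comp {A : Type} {n : ℕ} : Ectx A n → Ectx A n → Ectx A n
  | .hole, E' => E'
  | .appL E e, E' => .appL (E.comp E') e
  | .appR v E, E' => .appR v (E.comp E')
  | .reset a E, E' => .reset a (E.comp E')

theorem Ectx.comp_plug {A : Type} {n : ℕ} (E E' : Ectx A n) (e : Exp A n) :
    (E.comp E').plug e = E.plug (E'.plug e) := by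
  match E with
  | .hole => rfl
  | .appL E _ | .appR _ E | .reset _ E => simp [Ectx.comp, Ectx.plug, E.comp_plug E' e]

theorem Ectx.comp_assoc {A : Type} {n : ℕ} (E E' E'' : Ectx A n) :
    (E.comp E').comp E'' = E.comp (E'.comp E'') := by
  match E with
  | .hole => rfl
  | .appL E _ | .appR _ E | .reset _ E => simp [Ectx.comp, E.comp_assoc E' E'']

theorem Ectx.comp_surrounding {A : Type} {n : ℕ} (E E' : Ectx A n) :
    (E.comp E').surrounding = E.surrounding ∪ E'.surrounding := by
  match E with
  | .hole => simp [Ectx.comp, Ectx.surrounding]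
  | .appL E _ | .appR _ E | .reset _ E =>
    simp [Ectx.comp, Ectx.surrounding, E.comp_surrounding E', Set.insert_union]

theorem Ectx.comp_prompts {A : Type} {n : ℕ} (E E' : Ectx A n) :
    (E.comp E').prompts = E.prompts ∪ E'.prompts := by
  match E with
  | .hole => simp [Ectx.comp, Ectx.prompts]
  | .appL E _ => simp [Ectx.comp, Ectx.prompts, E.comp_prompts E', Set.union_right_comm]
  | .appR _ E | .reset _ E =>
    simp [Ectx.comp, Ectx.prompts, E.comp_prompts E', Set.insert_union, Set.union_assoc]

theorem Ectx.plug_prompts {A : Type} {n : ℕ} (E : Ectx A n) (e : Exp A n) :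
    (E.plug e).prompts = E.prompts ∪ e.prompts := by
  match E with
  | .hole => simp [Ectx.plug, Ectx.prompts]
  | .appL E _ => simp [Ectx.plug, Ectx.prompts, Exp.prompts, E.plug_prompts e,
      Set.union_right_comm]
  | .appR _ E | .reset _ E =>
    simp [Ectx.plug, Ectx.prompts, Exp.prompts, Val.prompts, E.plug_prompts e, Set.insert_union,
      Set.union_assoc]

theorem Ectx.plug_subst {A : Type} {n m : ℕ} (E : Ectx A n) (e : Exp A n) (s : Fin n → Val A m) :
    (E.plug e).subst s = (E.subst s).plug (e.subst s) := by
  match E with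
  | .hole => rfl
  | .appL E _ | .appR _ E | .reset _ E =>
    simp [Ectx.plug, Ectx.subst, Exp.subst, Val.subst, E.plug_subst e s]

/-- A delimiter that guards the hole of a context has an innermost occurrence. -/
theorem Ectx.exists_innermost {A : Type} {n : ℕ} (E : Ectx A n) (a : A)
    (h : a ∈ E.surrounding) :
    ∃ E₁ E₂ : Ectx A n, E = E₁.comp (.reset a E₂) ∧ a ∉ E₂.surrounding := by
  match E with
  | .hole => simp [Ectx.surrounding] at h
  | .appL E e =>
    obtain ⟨E₁, E₂, rfl, h'⟩ := E.exists_innermost a h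
    exact ⟨.appL E₁ e, E₂, rfl, h'⟩
  | .appR v E =>
    obtain ⟨E₁, E₂, rfl, h'⟩ := E.exists_innermost a h
    exact ⟨.appR v E₁, E₂, rfl, h'⟩
  | .reset b E =>
    by_cases hE : a ∈ E.surrounding
    · obtain ⟨E₁, E₂, rfl, h'⟩ := E.exists_innermost a hE
      exact ⟨.reset b E₁, E₂, rfl, h'⟩
    · have : a = b := by simpa [Ectx.surrounding, hE] using h
      subst this
      exact ⟨.hole, E, rfl, hE⟩

/-! ### Occurring constants -/

mutual

theorem Exp.rename_prompts {A : Type} : ∀ {n : ℕ} (e : Exp A n) {m : ℕ} (r : Fin n → Fin m),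
    (e.rename r).prompts = e.prompts
  | _, .val v, _, r => by simp [Exp.rename, Exp.prompts, v.rename_prompts]
  | _, .app e₁ e₂, _, r => by
    simp [Exp.rename, Exp.prompts, e₁.rename_prompts, e₂.rename_prompts]
  | _, .fresh e, _, r => by simp [Exp.rename, Exp.prompts, e.rename_prompts]
  | _, .reset v e, _, r | _, .grab v e, _, r | _, .push v e, _, r => by
    simp [Exp.rename, Exp.prompts, v.rename_prompts, e.rename_prompts]

theorem Val.rename_prompts {A : Type} : ∀ {n : ℕ} (v : Val A n) {m : ℕ} (r : Fin n → Fin m),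
    (v.rename r).prompts = v.prompts
  | _, .var _, _, _ => rfl
  | _, .lam e, _, r => by simp [Val.rename, Val.prompts, e.rename_prompts]
  | _, .const _, _, _ => rfl
  | _, .cont E, _, r => by simp [Val.rename, Val.prompts, E.rename_prompts]

theorem Ectx.rename_prompts {A : Type} : ∀ {n : ℕ} (E : Ectx A n) {m : ℕ} (r : Fin n → Fin m),
    (E.rename r).prompts = E.prompts
  | _, .hole, _, _ => rfl
  | _, .appL E e, _, r => by
    simp [Ectx.rename, Ectx.prompts, E.rename_prompts, e.rename_prompts]
  | _, .appR v E, _, r => by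
    simp [Ectx.rename, Ectx.prompts, E.rename_prompts, v.rename_prompts]
  | _, .reset a E, _, r => by simp [Ectx.rename, Ectx.prompts, E.rename_prompts]

end

theorem liftSub_prompts_subset {A : Type} {n m : ℕ} {s : Fin n → Val A m} {S : Set A}
    (hs : ∀ i, (s i).prompts ⊆ S) (i : Fin (n + 1)) : (liftSub s i).prompts ⊆ S := by
  cases i using Fin.cases with
  | zero => simp [liftSub, Val.prompts]
  | succ i => simpa [liftSub, Val.rename_prompts] using hs i

mutual

theorem Exp.subst_prompts_subset {A : Type} : ∀ {n : ℕ} (e : Exp A n) {m : ℕ}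
    (s : Fin n → Val A m) {S : Set A}, e.prompts ⊆ S → (∀ i, (s i).prompts ⊆ S) →
    (e.subst s).prompts ⊆ S
  | _, .val v, _, s, _, h, hs => v.subst_prompts_subset s h hs
  | _, .app e₁ e₂, _, s, _, h, hs => Set.union_subset
    (e₁.subst_prompts_subset s (Set.union_subset_iff.1 h).1 hs)
    (e₂.subst_prompts_subset s (Set.union_subset_iff.1 h).2 hs)
  | _, .fresh e, _, _, _, h, hs => e.subst_prompts_subset _ h (liftSub_prompts_subset hs)
  | _, .reset v e, _, s, _, h, hs => Set.union_subset
    (v.subst_prompts_subset s (Set.union_subset_iff.1 h).1 hs)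
    (e.subst_prompts_subset s (Set.union_subset_iff.1 h).2 hs)
  | _, .grab v e, _, s, _, h, hs => Set.union_subset
    (v.subst_prompts_subset s (Set.union_subset_iff.1 h).1 hs)
    (e.subst_prompts_subset _ (Set.union_subset_iff.1 h).2 (liftSub_prompts_subset hs))
  | _, .push v e, _, s, _, h, hs => Set.union_subset
    (v.subst_prompts_subset s (Set.union_subset_iff.1 h).1 hs)
    (e.subst_prompts_subset s (Set.union_subset_iff.1 h).2 hs)

theorem Val.subst_prompts_subset {A : Type} : ∀ {n : ℕ} (v : Val A n) {m : ℕ}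
    (s : Fin n → Val A m) {S : Set A}, v.prompts ⊆ S → (∀ i, (s i).prompts ⊆ S) →
    (v.subst s).prompts ⊆ S
  | _, .var x, _, _, _, _, hs => hs x
  | _, .lam e, _, _, _, h, hs => e.subst_prompts_subset _ h (liftSub_prompts_subset hs)
  | _, .const _, _, _, _, h, _ => h
  | _, .cont E, _, s, _, h, hs => E.subst_prompts_subset s h hs

theorem Ectx.subst_prompts_subset {A : Type} : ∀ {n : ℕ} (E : Ectx A n) {m : ℕ}
    (s : Fin n → Val A m) {S : Set A}, E.prompts ⊆ S → (∀ i, (s i).prompts ⊆ S) →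
    (E.subst s).prompts ⊆ S
  | _, .hole, _, _, _, h, _ => h
  | _, .appL E e, _, s, _, h, hs => Set.union_subset
    (E.subst_prompts_subset s (Set.union_subset_iff.1 h).1 hs)
    (e.subst_prompts_subset s (Set.union_subset_iff.1 h).2 hs)
  | _, .appR v E, _, s, _, h, hs => Set.union_subset
    (v.subst_prompts_subset s (Set.union_subset_iff.1 h).1 hs)
    (E.subst_prompts_subset s (Set.union_subset_iff.1 h).2 hs)
  | _, .reset _ E, _, s, _, h, hs => Set.union_subset (Set.union_subset_iff.1 h).1
    (E.subst_prompts_subset s (Set.union_subset_iff.1 h).2 hs)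

end

theorem Exp.inst_prompts_subset {A : Type} {n : ℕ} (e : Exp A (n + 1)) (v : Val A n) :
    (e.inst v).prompts ⊆ e.prompts ∪ v.prompts := by
  refine e.subst_prompts_subset _ Set.subset_union_left fun i => ?_
  cases i using Fin.cases with
  | zero => exact Set.subset_union_right
  | succ i => simp [Val.prompts]

mutual

theorem Exp.prompts_finite {A : Type} : ∀ {n : ℕ} (e : Exp A n), e.prompts.Finite
  | _, .val v => v.prompts_finite
  | _, .app e₁ e₂ => e₁.prompts_finite.union e₂.prompts_finite
  | _, .fresh e => e.prompts_finite
  | _, .reset v e | _, .grab v e | _, .push v e => v.prompts_finite.union e.prompts_finite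

theorem Val.prompts_finite {A : Type} : ∀ {n : ℕ} (v : Val A n), v.prompts.Finite
  | _, .var _ => Set.finite_empty
  | _, .lam e => e.prompts_finite
  | _, .const a => Set.finite_singleton a
  | _, .cont E => E.prompts_finite

theorem Ectx.prompts_finite {A : Type} : ∀ {n : ℕ} (E : Ectx A n), E.prompts.Finite
  | _, .hole => Set.finite_empty
  | _, .appL E e => E.prompts_finite.union e.prompts_finite
  | _, .appR v E => v.prompts_finite.union E.prompts_finite
  | _, .reset a E => (Set.finite_singleton a).union E.prompts_finite

end

theorem seqPrompts_finite (Γ : List (Val Prompt 0)) : (seqPrompts Γ).Finite := by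
  have : seqPrompts Γ = ⋃ v ∈ {v | v ∈ Γ}, v.prompts := by ext p; simp [seqPrompts]
  rw [this]
  exact Γ.finite_toSet.biUnion fun v _ => v.prompts_finite

theorem exists_fresh_prompt {S : Set Prompt} (hS : S.Finite) : ∃ p, p ∉ S := by
  have : Infinite Prompt := Infinite.of_injective Prompt.mk fun _ _ h => by injection h
  exact hS.exists_notMem

mutual

/-- Two substitutions that agree except on variables carrying `a` have the same effect on an
expression whose instance avoids `a`: the variables on which they differ do not occur. -/
theorem Exp.subst_congr_of_notMem {A : Type} {a : A} : ∀ {n : ℕ} (e : Exp A n) {m : ℕ}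
    {s t : Fin n → Val A m}, (∀ i, s i = t i ∨ a ∈ (s i).prompts) → a ∉ (e.subst s).prompts →
    e.subst s = e.subst t
  | _, .val v, _, _, _, h, ha => by
    simp only [Exp.subst, Exp.prompts] at ha ⊢
    rw [v.subst_congr_of_notMem h ha]
  | _, .app e₁ e₂, _, _, _, h, ha => by
    simp only [Exp.subst, Exp.prompts, Set.mem_union, not_or] at ha ⊢
    rw [e₁.subst_congr_of_notMem h ha.1, e₂.subst_congr_of_notMem h ha.2]
  | _, .fresh e, _, _, _, h, ha => by
    simp only [Exp.subst, Exp.prompts] at ha ⊢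
    rw [e.subst_congr_of_notMem (liftSub_agree h) ha]
  | _, .reset v e, _, _, _, h, ha | _, .push v e, _, _, _, h, ha => by
    simp only [Exp.subst, Exp.prompts, Set.mem_union, not_or] at ha ⊢
    rw [v.subst_congr_of_notMem h ha.1, e.subst_congr_of_notMem h ha.2]
  | _, .grab v e, _, _, _, h, ha => by
    simp only [Exp.subst, Exp.prompts, Set.mem_union, not_or] at ha ⊢
    rw [v.subst_congr_of_notMem h ha.1, e.subst_congr_of_notMem (liftSub_agree h) ha.2]

theorem Val.subst_congr_of_notMem {A : Type} {a : A} : ∀ {n : ℕ} (v : Val A n) {m : ℕ}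
    {s t : Fin n → Val A m}, (∀ i, s i = t i ∨ a ∈ (s i).prompts) → a ∉ (v.subst s).prompts →
    v.subst s = v.subst t
  | _, .var x, _, _, _, h, ha => (h x).resolve_right ha
  | _, .lam e, _, _, _, h, ha => by
    simp only [Val.subst, Val.prompts] at ha ⊢
    rw [e.subst_congr_of_notMem (liftSub_agree h) ha]
  | _, .const _, _, _, _, _, _ => rfl
  | _, .cont E, _, _, _, h, ha => by
    simp only [Val.subst, Val.prompts] at ha ⊢
    rw [E.subst_congr_of_notMem h ha]

theorem Ectx.subst_congr_of_notMem {A : Type} {a : A} : ∀ {n : ℕ} (E : Ectx A n) {m : ℕ}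
    {s t : Fin n → Val A m}, (∀ i, s i = t i ∨ a ∈ (s i).prompts) → a ∉ (E.subst s).prompts →
    E.subst s = E.subst t
  | _, .hole, _, _, _, _, _ => rfl
  | _, .appL E e, _, _, _, h, ha => by
    simp only [Ectx.subst, Ectx.prompts, Set.mem_union, not_or] at ha ⊢
    rw [E.subst_congr_of_notMem h ha.1, e.subst_congr_of_notMem h ha.2]
  | _, .appR v E, _, _, _, h, ha => by
    simp only [Ectx.subst, Ectx.prompts, Set.mem_union, not_or] at ha ⊢
    rw [v.subst_congr_of_notMem h ha.1, E.subst_congr_of_notMem h ha.2]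
  | _, .reset _ E, _, _, _, h, ha => by
    simp only [Ectx.subst, Ectx.prompts, Set.mem_union, not_or] at ha ⊢
    rw [E.subst_congr_of_notMem h ha.2]

theorem liftSub_agree {A : Type} {a : A} {n m : ℕ} {s t : Fin n → Val A m}
    (h : ∀ i, s i = t i ∨ a ∈ (s i).prompts) (i : Fin (n + 1)) :
    liftSub s i = liftSub t i ∨ a ∈ (liftSub s i).prompts := by
  cases i using Fin.cases with
  | zero => exact .inl rfl
  | succ i =>
    simp only [liftSub, Fin.cases_succ, Val.rename_prompts]
    exact (h i).imp_left fun h => by rw [h]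

end

/-- If `e{a/x}` does not contain `a`, then `x` does not occur in `e`. -/
theorem Exp.inst_congr_of_notMem {A : Type} {n : ℕ} {e : Exp A (n + 1)} {a : A}
    (h : a ∉ (e.inst (.const a)).prompts) (v : Val A n) : e.inst (.const a) = e.inst v := by
  refine e.subst_congr_of_notMem (a := a) (fun i => ?_) h
  cases i using Fin.cases with
  | zero => exact .inr rfl
  | succ i => exact .inl rfl

/-! ### Renaming of constants -/

mutual

/-- Replacement of the constants of an expression along a map. -/
def Exp.map {A B : Type} (f : A → B) : {n : ℕ} → Exp A n → Exp B n
  | _, .val v => .val (v.map f)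
  | _, .app e₁ e₂ => .app (e₁.map f) (e₂.map f)
  | _, .fresh e => .fresh (e.map f)
  | _, .reset v e => .reset (v.map f) (e.map f)
  | _, .grab v e => .grab (v.map f) (e.map f)
  | _, .push v e => .push (v.map f) (e.map f)

/-- Replacement of the constants of a value along a map. -/
def Val.map {A B : Type} (f : A → B) : {n : ℕ} → Val A n → Val B n
  | _, .var x => .var x
  | _, .lam e => .lam (e.map f)
  | _, .const a => .const (f a)
  | _, .cont E => .cont (E.map f)

/-- Replacement of the constants of an evaluation context along a map. -/
def Ectx.map {A B : Type} (f : A → B) : {n : ℕ} → Ectx A n → Ectx B n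
  | _, .hole => .hole
  | _, .appL E e => .appL (E.map f) (e.map f)
  | _, .appR v E => .appR (v.map f) (E.map f)
  | _, .reset a E => .reset (f a) (E.map f)

end

mutual

theorem Exp.map_rename {A B : Type} (f : A → B) : ∀ {n : ℕ} (e : Exp A n) {m : ℕ}
    (r : Fin n → Fin m), (e.rename r).map f = (e.map f).rename r
  | _, .val v, _, r => by simp [Exp.rename, Exp.map, v.map_rename f]
  | _, .app e₁ e₂, _, r => by simp [Exp.rename, Exp.map, e₁.map_rename f, e₂.map_rename f]
  | _, .fresh e, _, r => by simp [Exp.rename, Exp.map, e.map_rename f]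
  | _, .reset v e, _, r | _, .grab v e, _, r | _, .push v e, _, r => by
    simp [Exp.rename, Exp.map, v.map_rename f, e.map_rename f]

theorem Val.map_rename {A B : Type} (f : A → B) : ∀ {n : ℕ} (v : Val A n) {m : ℕ}
    (r : Fin n → Fin m), (v.rename r).map f = (v.map f).rename r
  | _, .var _, _, _ => rfl
  | _, .lam e, _, r => by simp [Val.rename, Val.map, e.map_rename f]
  | _, .const _, _, _ => rfl
  | _, .cont E, _, r => by simp [Val.rename, Val.map, E.map_rename f]

theorem Ectx.map_rename {A B : Type} (f : A → B) : ∀ {n : ℕ} (E : Ectx A n) {m : ℕ}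
    (r : Fin n → Fin m), (E.rename r).map f = (E.map f).rename r
  | _, .hole, _, _ => rfl
  | _, .appL E e, _, r => by simp [Ectx.rename, Ectx.map, E.map_rename f, e.map_rename f]
  | _, .appR v E, _, r => by simp [Ectx.rename, Ectx.map, E.map_rename f, v.map_rename f]
  | _, .reset a E, _, r => by simp [Ectx.rename, Ectx.map, E.map_rename f]

end

theorem map_liftSub {A B : Type} (f : A → B) {n m : ℕ} (s : Fin n → Val A m) :
    (fun i => (liftSub s i).map f) = liftSub (fun i => (s i).map f) := by
  funext i
  cases i using Fin.cases with
  | zero => rfl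
  | succ i => exact (s i).map_rename f _

mutual

theorem Exp.map_subst {A B : Type} (f : A → B) : ∀ {n : ℕ} (e : Exp A n) {m : ℕ}
    (s : Fin n → Val A m), (e.subst s).map f = (e.map f).subst (fun i => (s i).map f)
  | _, .val v, _, s => by simp [Exp.subst, Exp.map, v.map_subst f]
  | _, .app e₁ e₂, _, s => by simp [Exp.subst, Exp.map, e₁.map_subst f, e₂.map_subst f]
  | _, .fresh e, _, s => by simp [Exp.subst, Exp.map, e.map_subst f, map_liftSub]
  | _, .reset v e, _, s | _, .grab v e, _, s | _, .push v e, _, s => by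
    simp [Exp.subst, Exp.map, v.map_subst f, e.map_subst f, map_liftSub]

theorem Val.map_subst {A B : Type} (f : A → B) : ∀ {n : ℕ} (v : Val A n) {m : ℕ}
    (s : Fin n → Val A m), (v.subst s).map f = (v.map f).subst (fun i => (s i).map f)
  | _, .var _, _, _ => rfl
  | _, .lam e, _, s => by simp [Val.subst, Val.map, e.map_subst f, map_liftSub]
  | _, .const _, _, _ => rfl
  | _, .cont E, _, s => by simp [Val.subst, Val.map, E.map_subst f]

theorem Ectx.map_subst {A B : Type} (f : A → B) : ∀ {n : ℕ} (E : Ectx A n) {m : ℕ}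
    (s : Fin n → Val A m), (E.subst s).map f = (E.map f).subst (fun i => (s i).map f)
  | _, .hole, _, _ => rfl
  | _, .appL E e, _, s => by simp [Ectx.subst, Ectx.map, E.map_subst f, e.map_subst f]
  | _, .appR v E, _, s => by simp [Ectx.subst, Ectx.map, E.map_subst f, v.map_subst f]
  | _, .reset a E, _, s => by simp [Ectx.subst, Ectx.map, E.map_subst f]

end

theorem Exp.map_inst {A B : Type} (f : A → B) {n : ℕ} (e : Exp A (n + 1)) (v : Val A n) :
    (e.inst v).map f = (e.map f).inst (v.map f) := by
  rw [Exp.inst, Exp.map_subst, Exp.inst]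
  congr 1
  funext i
  cases i using Fin.cases <;> rfl

theorem Ectx.map_plug {A B : Type} (f : A → B) {n : ℕ} (E : Ectx A n) (e : Exp A n) :
    (E.plug e).map f = (E.map f).plug (e.map f) := by
  match E with
  | .hole => rfl
  | .appL E _ | .appR _ E | .reset _ E =>
    simp [Ectx.plug, Ectx.map, Exp.map, Val.map, E.map_plug f e]

theorem Ectx.map_comp {A B : Type} (f : A → B) {n : ℕ} (E E' : Ectx A n) :
    (E.comp E').map f = (E.map f).comp (E'.map f) := by
  match E with
  | .hole => rfl
  | .appL E _ | .appR _ E | .reset _ E => simp [Ectx.comp, Ectx.map, E.map_comp f E']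

theorem Ectx.map_surrounding {A B : Type} (f : A → B) {n : ℕ} (E : Ectx A n) :
    (E.map f).surrounding = f '' E.surrounding := by
  match E with
  | .hole => simp [Ectx.map, Ectx.surrounding]
  | .appL E _ | .appR _ E | .reset _ E =>
    simp [Ectx.map, Ectx.surrounding, E.map_surrounding f, Set.image_insert_eq]

mutual

theorem Exp.map_prompts {A B : Type} (f : A → B) : ∀ {n : ℕ} (e : Exp A n),
    (e.map f).prompts = f '' e.prompts
  | _, .val v => v.map_prompts f
  | _, .app e₁ e₂ => by
    simp [Exp.map, Exp.prompts, e₁.map_prompts, e₂.map_prompts, Set.image_union]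
  | _, .fresh e => e.map_prompts f
  | _, .reset v e | _, .grab v e | _, .push v e => by
    simp [Exp.map, Exp.prompts, e.map_prompts, v.map_prompts, Set.image_union]

theorem Val.map_prompts {A B : Type} (f : A → B) : ∀ {n : ℕ} (v : Val A n),
    (v.map f).prompts = f '' v.prompts
  | _, .var _ => by simp [Val.map, Val.prompts]
  | _, .lam e => e.map_prompts f
  | _, .const _ => by simp [Val.map, Val.prompts]
  | _, .cont E => E.map_prompts f

theorem Ectx.map_prompts {A B : Type} (f : A → B) : ∀ {n : ℕ} (E : Ectx A n),
    (E.map f).prompts = f '' E.prompts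
  | _, .hole => by simp [Ectx.map, Ectx.prompts]
  | _, .appL E e => by
    simp [Ectx.map, Ectx.prompts, E.map_prompts, e.map_prompts, Set.image_union]
  | _, .appR v E => by
    simp [Ectx.map, Ectx.prompts, E.map_prompts, v.map_prompts, Set.image_union]
  | _, .reset a E => by
    simp [Ectx.map, Ectx.prompts, E.map_prompts, Set.image_insert_eq]

end

mutual

theorem Exp.map_eq_self {A : Type} {f : A → A} : ∀ {n : ℕ} {e : Exp A n},
    (∀ a ∈ e.prompts, f a = a) → e.map f = e
  | _, .val v, h => congrArg Exp.val (Val.map_eq_self (v := v) h)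
  | _, .app e₁ e₂, h => by
    simp only [Exp.prompts, Set.mem_union, or_imp, forall_and] at h
    rw [Exp.map, Exp.map_eq_self h.1, Exp.map_eq_self h.2]
  | _, .fresh e, h => congrArg Exp.fresh (Exp.map_eq_self (e := e) h)
  | _, .reset v e, h | _, .grab v e, h | _, .push v e, h => by
    simp only [Exp.prompts, Set.mem_union, or_imp, forall_and] at h
    rw [Exp.map, Exp.map_eq_self h.2, Val.map_eq_self h.1]

theorem Val.map_eq_self {A : Type} {f : A → A} : ∀ {n : ℕ} {v : Val A n},
    (∀ a ∈ v.prompts, f a = a) → v.map f = v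
  | _, .var _, _ => rfl
  | _, .lam e, h => congrArg Val.lam (Exp.map_eq_self (e := e) h)
  | _, .const a, h => congrArg Val.const (h a rfl)
  | _, .cont E, h => congrArg Val.cont (Ectx.map_eq_self (E := E) h)

theorem Ectx.map_eq_self {A : Type} {f : A → A} : ∀ {n : ℕ} {E : Ectx A n},
    (∀ a ∈ E.prompts, f a = a) → E.map f = E
  | _, .hole, _ => rfl
  | _, .appL E e, h => by
    simp only [Ectx.prompts, Set.mem_union, or_imp, forall_and] at h
    rw [Ectx.map, Ectx.map_eq_self h.1, Exp.map_eq_self h.2]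
  | _, .appR v E, h => by
    simp only [Ectx.prompts, Set.mem_union, or_imp, forall_and] at h
    rw [Ectx.map, Ectx.map_eq_self h.2, Val.map_eq_self h.1]
  | _, .reset a E, h => by
    simp only [Ectx.prompts, Set.mem_union, or_imp, forall_and] at h
    rw [Ectx.map, Ectx.map_eq_self h.2, h.1 a rfl]

end

/-! ### Unique decomposition into an evaluation context and an active expression -/

/-- Expressions in which evaluation takes place at the root, when the constants satisfying `D` are
those that may delimit an evaluation context. They need not be redexes: a `grab` waits for its
delimiter, and an ill-formed application, for instance, is active and does not reduce. -/
inductive Active {A : Type} (D : A → Prop) {n : ℕ} : Exp A n → Prop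
  | app (v w : Val A n) : Active D (.app (.val v) (.val w))
  | fresh (e : Exp A (n + 1)) : Active D (.fresh e)
  | resetVal (v w : Val A n) : Active D (.reset v (.val w))
  | resetBad (v : Val A n) (e : Exp A n) (h : ∀ a, v = .const a → ¬ D a) : Active D (.reset v e)
  | grab (v : Val A n) (e : Exp A (n + 1)) : Active D (.grab v e)
  | push (v : Val A n) (e : Exp A n) : Active D (.push v e)

theorem Exp.exists_decomposition {A : Type} (D : A → Prop) {n : ℕ} (e : Exp A n) :
    (∃ v, e = .val v) ∨ ∃ (E : Ectx A n) (r : Exp A n),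
      (∀ a ∈ E.surrounding, D a) ∧ Active D r ∧ e = E.plug r := by
  match e with
  | .val v => exact .inl ⟨v, rfl⟩
  | .app e₁ e₂ =>
    right
    rcases e₁.exists_decomposition D with ⟨v, rfl⟩ | ⟨E, r, hE, hr, rfl⟩
    · rcases e₂.exists_decomposition D with ⟨w, rfl⟩ | ⟨E, r, hE, hr, rfl⟩
      · exact ⟨.hole, _, by simp [Ectx.surrounding], .app v w, rfl⟩
      · exact ⟨.appR v E, r, hE, hr, rfl⟩
    · exact ⟨.appL E e₂, r, hE, hr, rfl⟩
  | .fresh e => exact .inr ⟨.hole, _, by simp [Ectx.surrounding], .fresh e, rfl⟩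
  | .reset v e =>
    right
    by_cases h : ∃ a, v = .const a ∧ D a
    · obtain ⟨a, rfl, ha⟩ := h
      rcases e.exists_decomposition D with ⟨w, rfl⟩ | ⟨E, r, hE, hr, rfl⟩
      · exact ⟨.hole, _, by simp [Ectx.surrounding], .resetVal _ w, rfl⟩
      · exact ⟨.reset a E, r, by simpa [Ectx.surrounding, ha] using hE, hr, rfl⟩
    · push Not at h
      exact ⟨.hole, _, by simp [Ectx.surrounding], .resetBad v e h, rfl⟩
  | .grab v e => exact .inr ⟨.hole, _, by simp [Ectx.surrounding], .grab v e, rfl⟩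
  | .push v e => exact .inr ⟨.hole, _, by simp [Ectx.surrounding], .push v e, rfl⟩

/-- Active expressions of the calculus, in which every prompt may act as a delimiter. -/
abbrev IsActive {n : ℕ} (e : Exp Prompt n) : Prop := Active (fun _ => True) e

theorem IsActive.plug_ne_val {n : ℕ} {r : Exp Prompt n} (hr : IsActive r) (E : Ectx Prompt n)
    (v : Val Prompt n) : E.plug r ≠ .val v := by
  cases E
  case hole => cases hr <;> nofun
  all_goals nofun

theorem IsActive.plug_inj {n : ℕ} {r r' : Exp Prompt n} (hr : IsActive r) (hr' : IsActive r')
    {E E' : Ectx Prompt n} (h : E.plug r = E'.plug r') : E = E' ∧ r = r' := by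
  match E, E' with
  | .hole, .hole => exact ⟨rfl, h⟩
  | .hole, .appL E' e =>
    simp only [Ectx.plug] at h; subst h
    generalize h : E'.plug r' = e' at hr
    cases hr; exact absurd h (hr'.plug_ne_val _ _)
  | .hole, .appR w E' =>
    simp only [Ectx.plug] at h; subst h
    generalize h : E'.plug r' = e' at hr
    cases hr; exact absurd h (hr'.plug_ne_val _ _)
  | .hole, .reset p E' =>
    simp only [Ectx.plug] at h; subst h
    generalize h : E'.plug r' = e' at hr
    cases hr with
    | resetVal => exact absurd h (hr'.plug_ne_val _ _)
    | resetBad _ _ h => exact absurd trivial (h p rfl)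
  | .appL E e, .hole =>
    simp only [Ectx.plug] at h; subst h
    generalize h : E.plug r = e' at hr'
    cases hr'; exact absurd h (hr.plug_ne_val _ _)
  | .appR w E, .hole =>
    simp only [Ectx.plug] at h; subst h
    generalize h : E.plug r = e' at hr'
    cases hr'; exact absurd h (hr.plug_ne_val _ _)
  | .reset p E, .hole =>
    simp only [Ectx.plug] at h; subst h
    generalize h : E.plug r = e' at hr'
    cases hr' with
    | resetVal => exact absurd h (hr.plug_ne_val _ _)
    | resetBad _ _ h => exact absurd trivial (h p rfl)
  | .appL E e, .appL E' e' =>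
    simp only [Ectx.plug, Exp.app.injEq] at h
    obtain ⟨rfl, rfl⟩ := hr.plug_inj hr' h.1
    exact ⟨by rw [h.2], rfl⟩
  | .appR v E, .appR v' E' =>
    simp only [Ectx.plug, Exp.app.injEq, Exp.val.injEq] at h
    obtain ⟨rfl, rfl⟩ := hr.plug_inj hr' h.2
    exact ⟨by rw [h.1], rfl⟩
  | .reset p E, .reset p' E' =>
    simp only [Ectx.plug, Exp.reset.injEq, Val.const.injEq] at h
    obtain ⟨rfl, rfl⟩ := hr.plug_inj hr' h.2
    exact ⟨by rw [h.1], rfl⟩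
  | .appL E e, .appR v E' =>
    simp only [Ectx.plug, Exp.app.injEq] at h
    exact absurd h.1 (hr.plug_ne_val _ _)
  | .appR v E, .appL E' e =>
    simp only [Ectx.plug, Exp.app.injEq] at h
    exact absurd h.1.symm (hr'.plug_ne_val _ _)
  | .appL E e, .reset p E' | .appR v E, .reset p E' => simp [Ectx.plug] at h
  | .reset p E, .appL E' e | .reset p E, .appR v E' => simp [Ectx.plug] at h

/-! ### Reduction at the active expression -/

/-- `Fire E r u`: the expression `E[r]`, with `r` active, reduces to `u`. For prompt generation the
prompt is required to avoid the context as well. -/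
inductive Fire {n : ℕ} (E : Ectx Prompt n) : Exp Prompt n → Exp Prompt n → Prop
  | beta (e : Exp Prompt (n + 1)) (v : Val Prompt n) :
      Fire E (.app (.val (.lam e)) (.val v)) (E.plug (e.inst v))
  | reset (p : Prompt) (v : Val Prompt n) :
      Fire E (.reset (.const p) (.val v)) (E.plug (.val v))
  | push (E' : Ectx Prompt n) (e : Exp Prompt n) :
      Fire E (.push (.cont E') e) (E.plug (E'.plug e))
  | fresh (p : Prompt) (e : Exp Prompt (n + 1)) (he : p ∉ e.prompts) (hE : p ∉ E.prompts) :
      Fire E (.fresh e) (E.plug (e.inst (.const p)))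
  | grab (p : Prompt) (E₁ E₂ : Ectx Prompt n) (e : Exp Prompt (n + 1))
      (hE : E = E₁.comp (.reset p E₂)) (hp : p ∉ E₂.surrounding) :
      Fire E (.grab (.const p) e) (E₁.plug (e.inst (.cont E₂)))

theorem Fire.isActive {n : ℕ} {E : Ectx Prompt n} {r u : Exp Prompt n} (h : Fire E r u) :
    IsActive r := by
  cases h <;> constructor

theorem FreshCond.of_subset {S T U : Set Prompt} (h : S ⊆ T) : FreshCond S T U := by
  simp [FreshCond, Set.sdiff_eq_empty.2 h]

theorem FreshCond.notMem {S T U : Set Prompt} (h : FreshCond S T U) {p : Prompt} (hS : p ∈ S)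
    (hT : p ∉ T) : p ∉ U :=
  fun hU => Set.eq_empty_iff_forall_notMem.1 h p ⟨⟨hS, hT⟩, hU⟩

theorem FreshCond.intro {S T U : Set Prompt} (h : ∀ p ∈ S, p ∉ T → p ∉ U) : FreshCond S T U :=
  Set.eq_empty_iff_forall_notMem.2 fun p hp => h p hp.1.1 hp.1.2 hp.2

theorem FreshCond.mono {S T U U' : Set Prompt} (h : FreshCond S T U) (hU : U' ⊆ U) :
    FreshCond S T U' :=
  .intro fun _ hS hT hU' => h.notMem hS hT (hU hU')

theorem grab_prompts_subset {n : ℕ} (p : Prompt) (E : Ectx Prompt n) (e : Exp Prompt (n + 1)) :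
    (e.inst (.cont E)).prompts ⊆
      (Exp.reset (.const p) (E.plug (.grab (.const p) e))).prompts := by
  refine (e.inst_prompts_subset _).trans ?_
  simp only [Exp.prompts, Ectx.plug_prompts, Val.prompts]
  rintro q (h | h)
  · exact .inr (.inr (.inr h))
  · exact .inr (.inl h)

theorem Fire.red {n : ℕ} {E : Ectx Prompt n} {r u : Exp Prompt n} (h : Fire E r u) :
    Red (E.plug r) u := by
  cases h with
  | beta e v =>
    exact .compat E _ _ (.beta e v) (.of_subset (by
      simpa [Exp.prompts, Val.prompts] using e.inst_prompts_subset v))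
  | reset p v => exact .compat E _ _ (.reset p v) (.of_subset (by simp [Exp.prompts]))
  | push E' e =>
    exact .compat E _ _ (.push E' e) (.of_subset (by
      simp [Exp.prompts, Val.prompts, Ectx.plug_prompts]))
  | fresh p e he hE =>
    refine .compat E _ _ (.fresh p e he) (.intro fun q hq hq' => ?_)
    rcases e.inst_prompts_subset _ hq with h | h
    · exact absurd h hq'
    · rwa [Set.mem_singleton_iff.1 h]
  | grab p E₁ E₂ e hE hp =>
    subst hE
    rw [Ectx.comp_plug]
    exact .compat E₁ _ _ (.grab p E₂ e hp) (.of_subset (grab_prompts_subset p E₂ e))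

theorem Fire.prompts_subset {n : ℕ} {E : Ectx Prompt n} {r u : Exp Prompt n} (h : Fire E r u)
    (hr : ∀ e, r ≠ .fresh e) : u.prompts ⊆ (E.plug r).prompts := by
  cases h with
  | beta e v =>
    simp only [Ectx.plug_prompts]
    exact Set.union_subset_union_right _ (e.inst_prompts_subset v)
  | reset p v =>
    simp only [Ectx.plug_prompts, Exp.prompts]
    exact Set.union_subset_union_right _ Set.subset_union_right
  | push E' e => simp [Ectx.plug_prompts, Exp.prompts, Val.prompts]
  | fresh p e => exact absurd rfl (hr e)
  | grab p E₁ E₂ e hE hp =>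
    subst hE
    rw [Ectx.comp_plug]
    simp only [Ectx.plug_prompts E₁]
    exact Set.union_subset_union_right _ (grab_prompts_subset p E₂ e)

/-- Firing an active expression inside a larger context. A generated prompt that clashes with the
outer context can only be one that is not used, and is replaced. -/
theorem Fire.comp {n : ℕ} {E E' : Ectx Prompt n} {r u : Exp Prompt n} (h : Fire E r u)
    (hf : FreshCond u.prompts (E.plug r).prompts E'.prompts) :
    Fire (E'.comp E) r (E'.plug u) := by
  cases h with
  | beta e v => rw [← Ectx.comp_plug]; exact .beta e v
  | reset p v => rw [← Ectx.comp_plug]; exact .reset p v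
  | push E'' e => rw [← Ectx.comp_plug]; exact .push E'' e
  | fresh p e he hE =>
    rw [← Ectx.comp_plug]
    by_cases hp : p ∈ E'.prompts
    · have hp' : p ∉ (e.inst (.const p)).prompts := by
        intro h
        refine hf.notMem (p := p) ?_ ?_ hp
        · rw [Ectx.plug_prompts]
          exact .inr h
        · simp [Ectx.plug_prompts, Exp.prompts, he, hE]
      obtain ⟨q, hq⟩ := exists_fresh_prompt
        ((e.prompts_finite.union E.prompts_finite).union E'.prompts_finite)
      simp only [Set.mem_union, not_or] at hq
      rw [Exp.inst_congr_of_notMem hp' (.const q)]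
      exact .fresh q e hq.1.1 (by simp [Ectx.comp_prompts, hq])
    · exact .fresh p e he (by simp [Ectx.comp_prompts, hp, hE])
  | grab p E₁ E₂ e hE hp =>
    subst hE
    rw [← Ectx.comp_plug]
    exact .grab p _ E₂ e (Ectx.comp_assoc _ _ _).symm hp

theorem Red.exists_fire {n : ℕ} {t u : Exp Prompt n} (h : Red t u) :
    ∃ E r, t = E.plug r ∧ Fire E r u := by
  induction h with
  | beta e v => exact ⟨.hole, _, rfl, .beta e v⟩
  | reset p v => exact ⟨.hole, _, rfl, .reset p v⟩
  | grab p E e h => exact ⟨.reset p E, _, rfl, .grab p .hole E e rfl h⟩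
  | push E e => exact ⟨.hole, _, rfl, .push E e⟩
  | fresh p e h => exact ⟨.hole, _, rfl, .fresh p e h (by simp [Ectx.prompts])⟩
  | compat E e₁ e₂ _ hf ih =>
    obtain ⟨E', r, rfl, hr⟩ := ih
    exact ⟨E.comp E', r, (Ectx.comp_plug _ _ _).symm, hr.comp hf⟩

theorem IsActive.red_iff_fire {n : ℕ} {r : Exp Prompt n} (hr : IsActive r) {E : Ectx Prompt n}
    {u : Exp Prompt n} : Red (E.plug r) u ↔ Fire E r u := by
  refine ⟨fun h => ?_, Fire.red⟩
  obtain ⟨E', r', h, h'⟩ := h.exists_fire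
  obtain ⟨rfl, rfl⟩ := hr.plug_inj h'.isActive h
  exact h'

/-- An active expression that reduces in a larger context reduces already in the smaller one,
unless it is a `grab` whose delimiter lies in the outer context. -/
theorem Fire.of_comp {n : ℕ} {E E' : Ectx Prompt n} {r u : Exp Prompt n}
    (h : Fire (E'.comp E) r u) : (∃ u', Fire E r u') ∨ IsStuck (E.plug r) := by
  cases h with
  | beta e v => exact .inl ⟨_, .beta e v⟩
  | reset p v => exact .inl ⟨_, .reset p v⟩
  | push E'' e => exact .inl ⟨_, .push E'' e⟩
  | fresh p e he hE =>
    rw [Ectx.comp_prompts, Set.mem_union, not_or] at hE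
    exact .inl ⟨_, .fresh p e he hE.2⟩
  | grab p E₁ E₂ e hE hp =>
    by_cases h : p ∈ E.surrounding
    · obtain ⟨E₁', E₂', rfl, h'⟩ := E.exists_innermost p h
      exact .inl ⟨_, .grab p E₁' E₂' e rfl h'⟩
    · exact .inr ⟨E, p, e, h, rfl⟩

theorem Red.exists_fresh_red {n : ℕ} {t u : Exp Prompt n} (hred : Red t u) {S : Set Prompt}
    (hS : S.Finite) : ∃ u', Red t u' ∧ FreshCond u'.prompts t.prompts S := by
  obtain ⟨E, r, rfl, h⟩ := hred.exists_fire
  by_cases hr : ∃ e, r = .fresh e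
  · obtain ⟨e, rfl⟩ := hr
    obtain ⟨q, hq⟩ := exists_fresh_prompt
      ((e.prompts_finite.union E.prompts_finite).union hS)
    simp only [Set.mem_union, not_or] at hq
    refine ⟨_, (Fire.fresh q e hq.1.1 hq.1.2).red, .intro fun p hp hp' => ?_⟩
    simp only [Ectx.plug_prompts, Exp.prompts, Set.mem_union, not_or] at hp hp'
    rcases hp with hp | hp
    · exact absurd hp hp'.1
    · rcases e.inst_prompts_subset _ hp with hp | hp
      · exact absurd hp hp'.2
      · rw [Set.mem_singleton_iff.1 hp]
        exact hq.2
  · push Not at hr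
    exact ⟨u, h.red, .of_subset (h.prompts_subset hr)⟩

theorem Ectx.innermost_unique {n : ℕ} {p : Prompt} {E₁ E₂ E₁' E₂' : Ectx Prompt n}
    (h : E₁.comp (.reset p E₂) = E₁'.comp (.reset p E₂')) (h₂ : p ∉ E₂.surrounding)
    (h₂' : p ∉ E₂'.surrounding) : E₁ = E₁' ∧ E₂ = E₂' := by
  match E₁, E₁' with
  | .hole, .hole => simpa [Ectx.comp] using h
  | .reset q E, .hole =>
    simp only [Ectx.comp, Ectx.reset.injEq] at h
    simp [← h.2, Ectx.comp_surrounding, Ectx.surrounding] at h₂'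
  | .hole, .reset q E =>
    simp only [Ectx.comp, Ectx.reset.injEq] at h
    simp [h.2, Ectx.comp_surrounding, Ectx.surrounding] at h₂
  | .appL E _, .appL E' _ =>
    simp only [Ectx.comp, Ectx.appL.injEq] at h
    obtain ⟨rfl, rfl⟩ := Ectx.innermost_unique h.1 h₂ h₂'
    simp [h.2]
  | .appR _ E, .appR _ E' | .reset _ E, .reset _ E' =>
    simp only [Ectx.comp, Ectx.appR.injEq, Ectx.reset.injEq] at h
    obtain ⟨rfl, rfl⟩ := Ectx.innermost_unique h.2 h₂ h₂'
    simp [h.1]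
  | .hole, .appL _ _ | .hole, .appR _ _ | .appL _ _, .hole | .appR _ _, .hole
  | .appL _ _, .appR _ _ | .appR _ _, .appL _ _ | .reset _ _, .appR _ _
  | .reset _ _, .appL _ _ | .appL _ _, .reset _ _ | .appR _ _, .reset _ _ =>
    simp [Ectx.comp] at h

/-- Reduction is deterministic up to the choice of the generated prompt. -/
theorem Fire.deterministic {n : ℕ} {E : Ectx Prompt n} {r u u' : Exp Prompt n} (h : Fire E r u)
    (h' : Fire E r u') : ∃ π : Equiv.Perm Prompt, u' = u.map π := by
  classical
  have refl : ∀ u : Exp Prompt n, ∃ π : Equiv.Perm Prompt, u = u.map π := fun u =>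
    ⟨1, (Exp.map_eq_self fun _ _ => rfl).symm⟩
  cases h with
  | beta e v | reset p v | push E'' e => cases h'; exact refl _
  | fresh p e he hE =>
    cases h' with
    | fresh q _ he' hE' =>
      have hfix : ∀ {S : Set Prompt}, p ∉ S → q ∉ S → ∀ a ∈ S, Equiv.swap p q a = a :=
        fun hp hq a ha => Equiv.swap_apply_of_ne_of_ne (fun h => hp (h ▸ ha))
          (fun h => hq (h ▸ ha))
      refine ⟨Equiv.swap p q, ?_⟩
      rw [Ectx.map_plug, Exp.map_inst, Exp.map_eq_self (hfix he he'),
        Ectx.map_eq_self (hfix hE hE'), Val.map, Equiv.swap_apply_left]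
  | grab p E₁ E₂ e hE hp =>
    cases h' with
    | grab _ E₁' E₂' _ hE' hp' =>
      obtain ⟨rfl, rfl⟩ := Ectx.innermost_unique (hE.symm.trans hE') hp hp'
      exact refl _

theorem Fire.map {n : ℕ} (π : Equiv.Perm Prompt) {E : Ectx Prompt n} {r u : Exp Prompt n}
    (h : Fire E r u) : Fire (E.map π) (r.map π) (u.map π) := by
  cases h with
  | beta e v => simpa [Ectx.map_plug, Exp.map_inst, Exp.map, Val.map] using .beta _ _
  | reset p v => simpa [Ectx.map_plug, Exp.map, Val.map] using .reset _ _
  | push E' e => simpa [Ectx.map_plug, Exp.map, Val.map] using .push _ _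
  | fresh p e he hE =>
    simp only [Ectx.map_plug, Exp.map_inst, Exp.map, Val.map]
    exact .fresh _ _ (by simpa [Exp.map_prompts] using he) (by simpa [Ectx.map_prompts] using hE)
  | grab p E₁ E₂ e hE hp =>
    subst hE
    simp only [Ectx.map_plug, Exp.map_inst, Exp.map, Val.map]
    exact .grab _ _ _ _ (by simp [Ectx.map_comp, Ectx.map])
      (by simpa [Ectx.map_surrounding] using hp)

theorem Red.map {n : ℕ} (π : Equiv.Perm Prompt) {t u : Exp Prompt n} (hred : Red t u) :
    Red (t.map π) (u.map π) := by
  obtain ⟨E, r, rfl, h⟩ := hred.exists_fire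
  rw [Ectx.map_plug]
  exact (h.map π).red

theorem Red.deterministic {n : ℕ} {t u u' : Exp Prompt n} (hred : Red t u) (h' : Red t u') :
    ∃ π : Equiv.Perm Prompt, u' = u.map π := by
  obtain ⟨E, r, rfl, h⟩ := hred.exists_fire
  exact h.deterministic (h.isActive.red_iff_fire.1 h')

/-! ### Outcomes of evaluation -/

theorem isStuck_plug_iff {n : ℕ} {E : Ectx Prompt n} {r : Exp Prompt n} (hr : IsActive r) :
    IsStuck (E.plug r) ↔ ∃ p e, p ∉ E.surrounding ∧ r = .grab (.const p) e := by
  constructor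
  · rintro ⟨E', p, e, hp, h⟩
    obtain ⟨rfl, rfl⟩ := hr.plug_inj (.grab _ _) h
    exact ⟨p, e, hp, rfl⟩
  · rintro ⟨p, e, hp, rfl⟩
    exact ⟨E, p, e, hp, rfl⟩

theorem IsValue.normalForm {n : ℕ} {e : Exp Prompt n} (h : IsValue e) : NormalForm e := by
  obtain ⟨v, rfl⟩ := h
  intro e' h
  obtain ⟨E, r, h, h'⟩ := h.exists_fire
  exact h'.isActive.plug_ne_val E v h.symm

theorem IsStuck.normalForm {n : ℕ} {e : Exp Prompt n} (h : IsStuck e) : NormalForm e := by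
  obtain ⟨E, p, e, hp, rfl⟩ := h
  intro e' h
  cases (IsActive.red_iff_fire (.grab _ _)).1 h with
  | grab _ E₁ E₂ _ hE _ =>
    subst hE
    simp [Ectx.comp_surrounding, Ectx.surrounding] at hp

theorem IsValue.not_isStuck {n : ℕ} {e : Exp Prompt n} (h : IsValue e) : ¬ IsStuck e := by
  obtain ⟨v, rfl⟩ := h
  rintro ⟨E, p, e, -, h⟩
  exact IsActive.plug_ne_val (.grab _ _) E v h.symm

/-- Observable outcomes: unions of the set of values and the set of control-stuck expressions. -/
structure Outcome (O : Exp Prompt 0 → Prop) : Prop where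
  isValue_or_isStuck : ∀ {e}, O e → IsValue e ∨ IsStuck e
  of_isValue : ∀ {e e'}, IsValue e → IsValue e' → O e → O e'
  of_isStuck : ∀ {e e'}, IsStuck e → IsStuck e' → O e → O e'

theorem outcome_isValue : Outcome IsValue where
  isValue_or_isStuck := .inl
  of_isValue := fun _ h _ => h
  of_isStuck := fun h _ h' => absurd h h'.not_isStuck

theorem outcome_isStuck : Outcome IsStuck where
  isValue_or_isStuck := .inr
  of_isValue := fun h _ h' => absurd h' h.not_isStuck
  of_isStuck := fun _ h _ => h

theorem Outcome.normalForm {O : Exp Prompt 0 → Prop} (hO : Outcome O) {e : Exp Prompt 0}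
    (h : O e) : NormalForm e :=
  (hO.isValue_or_isStuck h).elim IsValue.normalForm IsStuck.normalForm

theorem Outcome.map {O : Exp Prompt 0 → Prop} (hO : Outcome O) (π : Equiv.Perm Prompt)
    {e : Exp Prompt 0} (h : O e) : O (e.map π) := by
  rcases hO.isValue_or_isStuck h with h' | h'
  · refine hO.of_isValue h' ?_ h
    obtain ⟨v, rfl⟩ := h'
    exact ⟨_, rfl⟩
  · refine hO.of_isStuck h' ?_ h
    obtain ⟨E, p, e, hp, rfl⟩ := h'
    exact ⟨E.map π, π p, e.map π, by simpa [Ectx.map_surrounding] using hp,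
      by simp [Ectx.map_plug, Exp.map, Val.map]⟩

/-- The expression reaches the outcome `O` in exactly `k` steps. -/
def ConvIn (O : Exp Prompt 0 → Prop) : ℕ → Exp Prompt 0 → Prop
  | 0, e => O e
  | k + 1, e => ∃ e', Red e e' ∧ ConvIn O k e'

/-- The expression reaches the outcome `O`. -/
def Conv (O : Exp Prompt 0 → Prop) (e : Exp Prompt 0) : Prop :=
  ∃ k, ConvIn O k e

theorem ConvIn.map {O : Exp Prompt 0 → Prop} (hO : Outcome O) (π : Equiv.Perm Prompt) {k : ℕ}
    {e : Exp Prompt 0} (h : ConvIn O k e) : ConvIn O k (e.map π) := by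
  induction k generalizing e with
  | zero => exact hO.map π h
  | succ k ih =>
    obtain ⟨e', h, h'⟩ := h
    exact ⟨_, h.map π, ih h'⟩

/-- The number of steps needed to reach an outcome does not depend on the generated prompts. -/
theorem ConvIn.of_red {O : Exp Prompt 0 → Prop} (hO : Outcome O) {k : ℕ} {e e' : Exp Prompt 0}
    (h : ConvIn O k e) (hr : Red e e') : ∃ j, k = j + 1 ∧ ConvIn O j e' := by
  cases k with
  | zero => exact absurd hr (hO.normalForm h e')
  | succ k =>
    obtain ⟨u, hu, h⟩ := h
    obtain ⟨π, rfl⟩ := hu.deterministic hr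
    exact ⟨k, rfl, h.map hO π⟩

theorem conv_iff_of_red {O : Exp Prompt 0 → Prop} (hO : Outcome O) {e e' : Exp Prompt 0}
    (hr : Red e e') : Conv O e ↔ Conv O e' := by
  constructor
  · rintro ⟨k, h⟩
    obtain ⟨j, -, h⟩ := h.of_red hO hr
    exact ⟨j, h⟩
  · rintro ⟨k, h⟩
    exact ⟨k + 1, e', hr, h⟩

theorem conv_iff_of_redStar {O : Exp Prompt 0 → Prop} (hO : Outcome O) {e e' : Exp Prompt 0}
    (hr : RedStar e e') : Conv O e ↔ Conv O e' := by
  induction hr with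
  | refl => rfl
  | tail _ h ih => exact ih.trans (conv_iff_of_red hO h)

theorem conv_iff {O : Exp Prompt 0 → Prop} {e : Exp Prompt 0} :
    Conv O e ↔ ∃ e', RedStar e e' ∧ O e' := by
  constructor
  · rintro ⟨k, h⟩
    induction k generalizing e with
    | zero => exact ⟨e, .refl, h⟩
    | succ k ih =>
      obtain ⟨u, hu, h⟩ := h
      obtain ⟨e', he, h⟩ := ih h
      exact ⟨e', .head hu he, h⟩
  · rintro ⟨e', he, h⟩
    induction he using Relation.ReflTransGen.head_induction_on with
    | refl => exact ⟨0, h⟩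
    | head h _ ih =>
      obtain ⟨k, hk⟩ := ih
      exact ⟨k + 1, _, h, hk⟩

theorem ConvIn.not_diverges {O : Exp Prompt 0 → Prop} (hO : Outcome O) {k : ℕ}
    {e : Exp Prompt 0} (h : ConvIn O k e) : ¬ Diverges e := by
  rintro ⟨f, rfl, hf⟩
  have : ∀ i, ∃ j, k = j + i ∧ ConvIn O j (f i) := by
    intro i
    induction i with
    | zero => exact ⟨k, rfl, h⟩
    | succ i ih =>
      obtain ⟨j, rfl, hj⟩ := ih
      obtain ⟨j, rfl, hj'⟩ := hj.of_red hO (hf i)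
      exact ⟨j, by omega, hj'⟩
  obtain ⟨j, hj, -⟩ := this (k + 1)
  omega

theorem Conv.not_divOrErr {O : Exp Prompt 0 → Prop} (hO : Outcome O) {e : Exp Prompt 0}
    (h : Conv O e) : ¬ DivOrErr e := by
  rintro (hd | ⟨e', he, hn, hv, hs⟩)
  · obtain ⟨k, h⟩ := h
    exact h.not_diverges hO hd
  · rw [conv_iff_of_redStar hO he] at h
    obtain ⟨k | k, h⟩ := h
    · exact (hO.isValue_or_isStuck h).elim hv hs
    · obtain ⟨u, hu, -⟩ := h
      exact hn u hu

theorem diverges_of_forall_exists_red {n : ℕ} {e : Exp Prompt n}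
    (h : ∀ e', RedStar e e' → ∃ u, Red e' u) : Diverges e := by
  choose f hf using fun x : {e' // RedStar e e'} => h x.1 x.2
  let g : ℕ → {e' // RedStar e e'} := fun k =>
    k.rec ⟨e, .refl⟩ fun _ x => ⟨f x, x.2.tail (hf x)⟩
  exact ⟨fun k => (g k).1, rfl, fun k => hf (g k)⟩

theorem divOrErr_iff {e : Exp Prompt 0} :
    DivOrErr e ↔ ¬ Conv IsValue e ∧ ¬ Conv IsStuck e := by
  constructor
  · exact fun h => ⟨fun h' => h'.not_divOrErr outcome_isValue h,
      fun h' => h'.not_divOrErr outcome_isStuck h⟩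
  · rintro ⟨hv, hs⟩
    by_cases h : ∀ e', RedStar e e' → ∃ u, Red e' u
    · exact .inl (diverges_of_forall_exists_red h)
    · push Not at h
      obtain ⟨e', he, hn⟩ := h
      exact .inr ⟨e', he, hn, fun h => hv (conv_iff.2 ⟨e', he, h⟩),
        fun h => hs (conv_iff.2 ⟨e', he, h⟩)⟩

/-- Divergence and errors need not be tested: they are the absence of the other outcomes. -/
theorem obsEq_iff {e₁ e₂ : Exp Prompt 0} :
    ObsEq e₁ e₂ ↔ ∀ O, Outcome O → (Conv O e₁ ↔ Conv O e₂) := by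
  constructor
  · rintro ⟨hv, hs, -⟩ O hO
    simp only [conv_iff]
    have key : ∀ {e₁ e₂}, ((∃ e, RedStar e₁ e ∧ IsValue e) → (∃ e, RedStar e₂ e ∧ IsValue e)) →
        ((∃ e, RedStar e₁ e ∧ IsStuck e) → (∃ e, RedStar e₂ e ∧ IsStuck e)) →
        (∃ e, RedStar e₁ e ∧ O e) → ∃ e, RedStar e₂ e ∧ O e := by
      rintro e₁ e₂ hv hs ⟨e, he, h⟩
      rcases hO.isValue_or_isStuck h with h' | h'
      · obtain ⟨u, hu, hu'⟩ := hv ⟨e, he, h'⟩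
        exact ⟨u, hu, hO.of_isValue h' hu' h⟩
      · obtain ⟨u, hu, hu'⟩ := hs ⟨e, he, h'⟩
        exact ⟨u, hu, hO.of_isStuck h' hu' h⟩
    exact ⟨key hv.1 hs.1, key hv.2 hs.2⟩
  · intro h
    refine ⟨?_, ?_, ?_⟩
    · simpa only [conv_iff] using h _ outcome_isValue
    · simpa only [conv_iff] using h _ outcome_isStuck
    · rw [divOrErr_iff, divOrErr_iff, h _ outcome_isValue, h _ outcome_isStuck]

/-! ### Filling multi-hole contexts -/

mutual

theorem Exp.fill_rename (Γ : List (Val Prompt 0)) : ∀ {n : ℕ} (e : Exp Hole n) {m : ℕ}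
    (r : Fin n → Fin m), (e.rename r).fill Γ = (e.fill Γ).rename r
  | _, .val v, _, r => by simp [Exp.rename, Exp.fill, v.fill_rename Γ]
  | _, .app e₁ e₂, _, r => by
    simp [Exp.rename, Exp.fill, e₁.fill_rename Γ, e₂.fill_rename Γ]
  | _, .fresh e, _, r => by simp [Exp.rename, Exp.fill, e.fill_rename Γ]
  | _, .reset v e, _, r | _, .grab v e, _, r | _, .push v e, _, r => by
    simp [Exp.rename, Exp.fill, v.fill_rename Γ, e.fill_rename Γ]

theorem Val.fill_rename (Γ : List (Val Prompt 0)) : ∀ {n : ℕ} (v : Val Hole n) {m : ℕ}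
    (r : Fin n → Fin m), (v.rename r).fill Γ = (v.fill Γ).rename r
  | _, .var _, _, _ => rfl
  | _, .lam e, _, r => by simp [Val.rename, Val.fill, e.fill_rename Γ]
  | _, .const a, _, r => by simp [Val.rename, Val.fill, Val.weaken_rename]
  | _, .cont E, _, r => by simp [Val.rename, Val.fill, E.fill_rename Γ]

theorem Ectx.fill_rename (Γ : List (Val Prompt 0)) : ∀ {n : ℕ} (E : Ectx Hole n) {m : ℕ}
    (r : Fin n → Fin m), (E.rename r).fill Γ = (E.fill Γ).rename r
  | _, .hole, _, _ => rfl
  | _, .appL E e, _, r => by simp [Ectx.rename, Ectx.fill, E.fill_rename Γ, e.fill_rename Γ]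
  | _, .appR v E, _, r => by simp [Ectx.rename, Ectx.fill, E.fill_rename Γ, v.fill_rename Γ]
  | _, .reset a E, _, r => by simp [Ectx.rename, Ectx.fill, E.fill_rename Γ]

end

theorem fill_liftSub (Γ : List (Val Prompt 0)) {n m : ℕ} (s : Fin n → Val Hole m) :
    (fun i => (liftSub s i).fill Γ) = liftSub (fun i => (s i).fill Γ) := by
  funext i
  cases i using Fin.cases with
  | zero => rfl
  | succ i => exact (s i).fill_rename Γ _

mutual

theorem Exp.fill_subst (Γ : List (Val Prompt 0)) : ∀ {n : ℕ} (e : Exp Hole n) {m : ℕ}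
    (s : Fin n → Val Hole m), (e.subst s).fill Γ = (e.fill Γ).subst (fun i => (s i).fill Γ)
  | _, .val v, _, s => by simp [Exp.subst, Exp.fill, v.fill_subst Γ]
  | _, .app e₁ e₂, _, s => by
    simp [Exp.subst, Exp.fill, e₁.fill_subst Γ, e₂.fill_subst Γ]
  | _, .fresh e, _, s => by simp [Exp.subst, Exp.fill, e.fill_subst Γ, fill_liftSub]
  | _, .reset v e, _, s | _, .grab v e, _, s | _, .push v e, _, s => by
    simp [Exp.subst, Exp.fill, v.fill_subst Γ, e.fill_subst Γ, fill_liftSub]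

theorem Val.fill_subst (Γ : List (Val Prompt 0)) : ∀ {n : ℕ} (v : Val Hole n) {m : ℕ}
    (s : Fin n → Val Hole m), (v.subst s).fill Γ = (v.fill Γ).subst (fun i => (s i).fill Γ)
  | _, .var _, _, _ => rfl
  | _, .lam e, _, s => by simp [Val.subst, Val.fill, e.fill_subst Γ, fill_liftSub]
  | _, .const a, _, s => by simp [Val.subst, Val.fill, Val.weaken_subst]
  | _, .cont E, _, s => by simp [Val.subst, Val.fill, E.fill_subst Γ]

theorem Ectx.fill_subst (Γ : List (Val Prompt 0)) : ∀ {n : ℕ} (E : Ectx Hole n) {m : ℕ}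
    (s : Fin n → Val Hole m), (E.subst s).fill Γ = (E.fill Γ).subst (fun i => (s i).fill Γ)
  | _, .hole, _, _ => rfl
  | _, .appL E e, _, s => by simp [Ectx.subst, Ectx.fill, E.fill_subst Γ, e.fill_subst Γ]
  | _, .appR v E, _, s => by simp [Ectx.subst, Ectx.fill, E.fill_subst Γ, v.fill_subst Γ]
  | _, .reset a E, _, s => by simp [Ectx.subst, Ectx.fill, E.fill_subst Γ]

end

theorem Exp.fill_inst (Γ : List (Val Prompt 0)) {n : ℕ} (e : Exp Hole (n + 1)) (v : Val Hole n) :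
    (e.inst v).fill Γ = (e.fill Γ).inst (v.fill Γ) := by
  rw [Exp.inst, Exp.fill_subst, Exp.inst]
  congr 1
  funext i
  cases i using Fin.cases <;> rfl

theorem look_of_getElem? {Γ : List (Val Prompt 0)} {a : Hole} {v : Val Prompt 0}
    (h : Γ[a.idx]? = some v) : look Γ a = v := by
  simp [look, List.getD, h]

theorem getElem?_of_lt {Γ : List (Val Prompt 0)} {a : Hole} (h : a.idx < Γ.length) :
    Γ[a.idx]? = some (look Γ a) := by
  simp [look, List.getD, h]

theorem lt_of_getElem? {Γ : List (Val Prompt 0)} {i : ℕ} {v : Val Prompt 0}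
    (h : Γ[i]? = some v) : i < Γ.length :=
  (List.getElem?_eq_some_iff.1 h).1

/-- The hole `a` is filled with a prompt. -/
def IsDelim (Γ : List (Val Prompt 0)) (a : Hole) : Prop :=
  ∃ p, Γ[a.idx]? = some (.const p)

theorem Ectx.fill_plug (Γ : List (Val Prompt 0)) {n : ℕ} (E : Ectx Hole n) (e : Exp Hole n)
    (hE : E.Valid Γ) : (E.plug e).fill Γ = (E.fill Γ).plug (e.fill Γ) := by
  match E with
  | .hole => rfl
  | .appL E e' => simp [Ectx.plug, Exp.fill, Ectx.fill, E.fill_plug Γ e hE.1]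
  | .appR v E => simp [Ectx.plug, Exp.fill, Ectx.fill, E.fill_plug Γ e hE.2]
  | .reset a E =>
    obtain ⟨p, hp⟩ := hE.1
    simp [Ectx.plug, Exp.fill, Ectx.fill, Val.fill, E.fill_plug Γ e hE.2, look_of_getElem? hp,
      Val.toPrompt, Val.weaken, Val.rename]

theorem Ectx.fill_comp (Γ : List (Val Prompt 0)) {n : ℕ} (E E' : Ectx Hole n) :
    (E.comp E').fill Γ = (E.fill Γ).comp (E'.fill Γ) := by
  match E with
  | .hole => rfl
  | .appL E _ | .appR _ E | .reset _ E => simp [Ectx.comp, Ectx.fill, E.fill_comp Γ E']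

theorem look_prompts_subset {Γ : List (Val Prompt 0)} {a : Hole} (h : a.idx < Γ.length) :
    (look Γ a).prompts ⊆ seqPrompts Γ :=
  fun _ hp => ⟨_, List.mem_of_getElem? (getElem?_of_lt h), hp⟩

mutual

theorem Exp.fill_prompts_subset {Γ : List (Val Prompt 0)} : ∀ {n : ℕ} {e : Exp Hole n},
    e.Valid Γ → (e.fill Γ).prompts ⊆ seqPrompts Γ
  | _, .val v, h => Val.fill_prompts_subset (v := v) h
  | _, .app _ _, h =>
    Set.union_subset (Exp.fill_prompts_subset h.1) (Exp.fill_prompts_subset h.2)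
  | _, .fresh e, h => Exp.fill_prompts_subset (e := e) h
  | _, .reset _ _, h | _, .grab _ _, h | _, .push _ _, h =>
    Set.union_subset (Val.fill_prompts_subset h.1) (Exp.fill_prompts_subset h.2)

theorem Val.fill_prompts_subset {Γ : List (Val Prompt 0)} : ∀ {n : ℕ} {v : Val Hole n},
    v.Valid Γ → (v.fill Γ).prompts ⊆ seqPrompts Γ
  | _, .var _, _ => Set.empty_subset _
  | _, .lam e, h => Exp.fill_prompts_subset (e := e) h
  | _, .const a, h => by
    simpa only [Val.fill, Val.weaken, Val.rename_prompts] using look_prompts_subset h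
  | _, .cont E, h => Ectx.fill_prompts_subset (E := E) h

theorem Ectx.fill_prompts_subset {Γ : List (Val Prompt 0)} : ∀ {n : ℕ} {E : Ectx Hole n},
    E.Valid Γ → (E.fill Γ).prompts ⊆ seqPrompts Γ
  | _, .hole, _ => Set.empty_subset _
  | _, .appL E e, h =>
    Set.union_subset (Ectx.fill_prompts_subset h.1) (Exp.fill_prompts_subset h.2)
  | _, .appR v E, h =>
    Set.union_subset (Val.fill_prompts_subset h.1) (Ectx.fill_prompts_subset h.2)
  | _, .reset a E, h => by
    obtain ⟨p, hp⟩ := h.1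
    refine Set.union_subset ?_ (Ectx.fill_prompts_subset h.2)
    rintro q rfl
    exact ⟨_, List.mem_of_getElem? hp, by simp [look_of_getElem? hp, Val.toPrompt, Val.prompts]⟩

end

mutual

theorem Exp.Valid.congr {Γ Δ : List (Val Prompt 0)} (hl : Γ.length ≤ Δ.length)
    (hd : ∀ a, IsDelim Γ a → IsDelim Δ a) : ∀ {n : ℕ} {e : Exp Hole n}, e.Valid Γ → e.Valid Δ
  | _, .val v, h => Val.Valid.congr hl hd (v := v) h
  | _, .app _ _, h => ⟨Exp.Valid.congr hl hd h.1, Exp.Valid.congr hl hd h.2⟩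
  | _, .fresh e, h => Exp.Valid.congr hl hd (e := e) h
  | _, .reset _ _, h | _, .grab _ _, h | _, .push _ _, h =>
    ⟨Val.Valid.congr hl hd h.1, Exp.Valid.congr hl hd h.2⟩

theorem Val.Valid.congr {Γ Δ : List (Val Prompt 0)} (hl : Γ.length ≤ Δ.length)
    (hd : ∀ a, IsDelim Γ a → IsDelim Δ a) : ∀ {n : ℕ} {v : Val Hole n}, v.Valid Γ → v.Valid Δ
  | _, .var _, _ => trivial
  | _, .lam e, h => Exp.Valid.congr hl hd (e := e) h
  | _, .const _, h => lt_of_lt_of_le (b := Γ.length) h hl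
  | _, .cont E, h => Ectx.Valid.congr hl hd (E := E) h

theorem Ectx.Valid.congr {Γ Δ : List (Val Prompt 0)} (hl : Γ.length ≤ Δ.length)
    (hd : ∀ a, IsDelim Γ a → IsDelim Δ a) : ∀ {n : ℕ} {E : Ectx Hole n}, E.Valid Γ → E.Valid Δ
  | _, .hole, _ => trivial
  | _, .appL _ _, h => ⟨Ectx.Valid.congr hl hd h.1, Exp.Valid.congr hl hd h.2⟩
  | _, .appR _ _, h => ⟨Val.Valid.congr hl hd h.1, Ectx.Valid.congr hl hd h.2⟩
  | _, .reset a _, h => ⟨hd a h.1, Ectx.Valid.congr hl hd h.2⟩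

end

theorem getElem?_append_of_some {Γ Γ' : List (Val Prompt 0)} {i : ℕ} {v : Val Prompt 0}
    (h : Γ[i]? = some v) : (Γ ++ Γ')[i]? = some v := by
  rw [List.getElem?_append_left (lt_of_getElem? h), h]

theorem IsDelim.append {Γ : List (Val Prompt 0)} (Γ' : List (Val Prompt 0)) {a : Hole}
    (h : IsDelim Γ a) : IsDelim (Γ ++ Γ') a :=
  h.imp fun _ => getElem?_append_of_some

theorem Exp.Valid.append {Γ : List (Val Prompt 0)} (Γ' : List (Val Prompt 0)) {n : ℕ}
    {e : Exp Hole n} (h : e.Valid Γ) : e.Valid (Γ ++ Γ') :=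
  h.congr (by simp) fun _ => IsDelim.append Γ'

theorem Ectx.Valid.append {Γ : List (Val Prompt 0)} (Γ' : List (Val Prompt 0)) {n : ℕ}
    {E : Ectx Hole n} (h : E.Valid Γ) : E.Valid (Γ ++ Γ') :=
  h.congr (by simp) fun _ => IsDelim.append Γ'

theorem look_append {Γ : List (Val Prompt 0)} (Γ' : List (Val Prompt 0)) {a : Hole}
    (h : a.idx < Γ.length) : look (Γ ++ Γ') a = look Γ a :=
  look_of_getElem? (getElem?_append_of_some (getElem?_of_lt h))

mutual

theorem Exp.fill_append {Γ : List (Val Prompt 0)} (Γ' : List (Val Prompt 0)) : ∀ {n : ℕ}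
    {e : Exp Hole n}, e.Valid Γ → e.fill (Γ ++ Γ') = e.fill Γ
  | _, .val v, h => congrArg Exp.val (Val.fill_append Γ' (v := v) h)
  | _, .app _ _, h => congrArg₂ Exp.app (Exp.fill_append Γ' h.1) (Exp.fill_append Γ' h.2)
  | _, .fresh e, h => congrArg Exp.fresh (Exp.fill_append Γ' (e := e) h)
  | _, .reset _ _, h => congrArg₂ Exp.reset (Val.fill_append Γ' h.1) (Exp.fill_append Γ' h.2)
  | _, .grab _ _, h => congrArg₂ Exp.grab (Val.fill_append Γ' h.1) (Exp.fill_append Γ' h.2)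
  | _, .push _ _, h => congrArg₂ Exp.push (Val.fill_append Γ' h.1) (Exp.fill_append Γ' h.2)

theorem Val.fill_append {Γ : List (Val Prompt 0)} (Γ' : List (Val Prompt 0)) : ∀ {n : ℕ}
    {v : Val Hole n}, v.Valid Γ → v.fill (Γ ++ Γ') = v.fill Γ
  | _, .var _, _ => rfl
  | _, .lam e, h => congrArg Val.lam (Exp.fill_append Γ' (e := e) h)
  | n, .const _, h => congrArg (Val.weaken · n) (look_append Γ' h)
  | _, .cont E, h => congrArg Val.cont (Ectx.fill_append Γ' (E := E) h)

theorem Ectx.fill_append {Γ : List (Val Prompt 0)} (Γ' : List (Val Prompt 0)) : ∀ {n : ℕ}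
    {E : Ectx Hole n}, E.Valid Γ → E.fill (Γ ++ Γ') = E.fill Γ
  | _, .hole, _ => rfl
  | _, .appL E e, h => congrArg₂ Ectx.appL (Ectx.fill_append Γ' h.1) (Exp.fill_append Γ' h.2)
  | _, .appR v E, h => congrArg₂ Ectx.appR (Val.fill_append Γ' h.1) (Ectx.fill_append Γ' h.2)
  | _, .reset a E, h => by
    have ha : a.idx < Γ.length := lt_of_getElem? h.1.choose_spec
    rw [Ectx.fill, Ectx.fill, Ectx.fill_append Γ' h.2, look_append Γ' ha]

end

mutual

theorem Exp.Valid.rename {Γ : List (Val Prompt 0)} : ∀ {n : ℕ} {e : Exp Hole n} {m : ℕ}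
    {r : Fin n → Fin m}, e.Valid Γ → (e.rename r).Valid Γ
  | _, .val v, _, _, h => Val.Valid.rename (v := v) h
  | _, .app _ _, _, _, h => ⟨Exp.Valid.rename h.1, Exp.Valid.rename h.2⟩
  | _, .fresh e, _, _, h => Exp.Valid.rename (e := e) h
  | _, .reset _ _, _, _, h | _, .grab _ _, _, _, h | _, .push _ _, _, _, h =>
    ⟨Val.Valid.rename h.1, Exp.Valid.rename h.2⟩

theorem Val.Valid.rename {Γ : List (Val Prompt 0)} : ∀ {n : ℕ} {v : Val Hole n} {m : ℕ}
    {r : Fin n → Fin m}, v.Valid Γ → (v.rename r).Valid Γ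
  | _, .var _, _, _, _ => trivial
  | _, .lam e, _, _, h => Exp.Valid.rename (e := e) h
  | _, .const _, _, _, h => h
  | _, .cont E, _, _, h => Ectx.Valid.rename (E := E) h

theorem Ectx.Valid.rename {Γ : List (Val Prompt 0)} : ∀ {n : ℕ} {E : Ectx Hole n} {m : ℕ}
    {r : Fin n → Fin m}, E.Valid Γ → (E.rename r).Valid Γ
  | _, .hole, _, _, _ => trivial
  | _, .appL _ _, _, _, h => ⟨Ectx.Valid.rename h.1, Exp.Valid.rename h.2⟩
  | _, .appR _ _, _, _, h => ⟨Val.Valid.rename h.1, Ectx.Valid.rename h.2⟩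
  | _, .reset _ _, _, _, h => ⟨h.1, Ectx.Valid.rename h.2⟩

end

theorem liftSub_valid {Γ : List (Val Prompt 0)} {n m : ℕ} {s : Fin n → Val Hole m}
    (hs : ∀ i, (s i).Valid Γ) (i : Fin (n + 1)) : (liftSub s i).Valid Γ := by
  cases i using Fin.cases with
  | zero => trivial
  | succ i => exact (hs i).rename

mutual

theorem Exp.Valid.subst {Γ : List (Val Prompt 0)} : ∀ {n : ℕ} {e : Exp Hole n} {m : ℕ}
    {s : Fin n → Val Hole m}, e.Valid Γ → (∀ i, (s i).Valid Γ) → (e.subst s).Valid Γ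
  | _, .val v, _, _, h, hs => Val.Valid.subst (v := v) h hs
  | _, .app _ _, _, _, h, hs => ⟨Exp.Valid.subst h.1 hs, Exp.Valid.subst h.2 hs⟩
  | _, .fresh e, _, _, h, hs => Exp.Valid.subst (e := e) h (liftSub_valid hs)
  | _, .reset _ _, _, _, h, hs => ⟨Val.Valid.subst h.1 hs, Exp.Valid.subst h.2 hs⟩
  | _, .grab _ _, _, _, h, hs => ⟨Val.Valid.subst h.1 hs, Exp.Valid.subst h.2 (liftSub_valid hs)⟩
  | _, .push _ _, _, _, h, hs => ⟨Val.Valid.subst h.1 hs, Exp.Valid.subst h.2 hs⟩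

theorem Val.Valid.subst {Γ : List (Val Prompt 0)} : ∀ {n : ℕ} {v : Val Hole n} {m : ℕ}
    {s : Fin n → Val Hole m}, v.Valid Γ → (∀ i, (s i).Valid Γ) → (v.subst s).Valid Γ
  | _, .var x, _, _, _, hs => hs x
  | _, .lam e, _, _, h, hs => Exp.Valid.subst (e := e) h (liftSub_valid hs)
  | _, .const _, _, _, h, _ => h
  | _, .cont E, _, _, h, hs => Ectx.Valid.subst (E := E) h hs

theorem Ectx.Valid.subst {Γ : List (Val Prompt 0)} : ∀ {n : ℕ} {E : Ectx Hole n} {m : ℕ}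
    {s : Fin n → Val Hole m}, E.Valid Γ → (∀ i, (s i).Valid Γ) → (E.subst s).Valid Γ
  | _, .hole, _, _, _, _ => trivial
  | _, .appL _ _, _, _, h, hs => ⟨Ectx.Valid.subst h.1 hs, Exp.Valid.subst h.2 hs⟩
  | _, .appR _ _, _, _, h, hs => ⟨Val.Valid.subst h.1 hs, Ectx.Valid.subst h.2 hs⟩
  | _, .reset _ _, _, _, h, hs => ⟨h.1, Ectx.Valid.subst h.2 hs⟩

end

theorem Exp.Valid.inst {Γ : List (Val Prompt 0)} {n : ℕ} {e : Exp Hole (n + 1)} {v : Val Hole n}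
    (he : e.Valid Γ) (hv : v.Valid Γ) : (e.inst v).Valid Γ :=
  he.subst fun i => by
    cases i using Fin.cases with
    | zero => exact hv
    | succ i => trivial

theorem Ectx.Valid.plug {Γ : List (Val Prompt 0)} {n : ℕ} {E : Ectx Hole n} {e : Exp Hole n}
    (hE : E.Valid Γ) (he : e.Valid Γ) : (E.plug e).Valid Γ := by
  match E with
  | .hole => exact he
  | .appL E _ => exact ⟨hE.1.plug he, hE.2⟩
  | .appR v E => exact ⟨hE.1, hE.2.plug he⟩
  | .reset a E => exact ⟨lt_of_getElem? hE.1.choose_spec, hE.2.plug he⟩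

theorem Ectx.Valid.comp {Γ : List (Val Prompt 0)} {n : ℕ} {E E' : Ectx Hole n}
    (hE : E.Valid Γ) (hE' : E'.Valid Γ) : (E.comp E').Valid Γ := by
  match E with
  | .hole => exact hE'
  | .appL E _ => exact ⟨hE.1.comp hE', hE.2⟩
  | .appR v E => exact ⟨hE.1, hE.2.comp hE'⟩
  | .reset a E => exact ⟨hE.1, hE.2.comp hE'⟩

theorem Ectx.Valid.of_comp {Γ : List (Val Prompt 0)} {n : ℕ} {E E' : Ectx Hole n}
    (h : (E.comp E').Valid Γ) : E.Valid Γ ∧ E'.Valid Γ := by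
  match E with
  | .hole => exact ⟨trivial, h⟩
  | .appL E _ => exact ⟨⟨(Ectx.Valid.of_comp h.1).1, h.2⟩, (Ectx.Valid.of_comp h.1).2⟩
  | .appR _ E | .reset _ E =>
    exact ⟨⟨h.1, (Ectx.Valid.of_comp h.2).1⟩, (Ectx.Valid.of_comp h.2).2⟩

theorem Exp.Valid.of_plug {Γ : List (Val Prompt 0)} {n : ℕ} {E : Ectx Hole n} {e : Exp Hole n}
    (h : (E.plug e).Valid Γ) (hE : ∀ a ∈ E.surrounding, IsDelim Γ a) :
    E.Valid Γ ∧ e.Valid Γ := by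
  match E with
  | .hole => exact ⟨trivial, h⟩
  | .appL E _ => exact ⟨⟨(Exp.Valid.of_plug h.1 hE).1, h.2⟩, (Exp.Valid.of_plug h.1 hE).2⟩
  | .appR _ E => exact ⟨⟨h.1, (Exp.Valid.of_plug h.2 hE).1⟩, (Exp.Valid.of_plug h.2 hE).2⟩
  | .reset a E =>
    have hE' := fun b hb => hE b (.inr hb)
    exact ⟨⟨hE a (.inl rfl), (Exp.Valid.of_plug h.2 hE').1⟩, (Exp.Valid.of_plug h.2 hE').2⟩

/-- A multi-hole context is a value or has its evaluation position inside; a hole counts as a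
delimiter if it is filled with a prompt. -/
theorem Exp.Valid.decompose {Γ : List (Val Prompt 0)} {n : ℕ} {e : Exp Hole n} (h : e.Valid Γ) :
    (∃ v, e = .val v) ∨ ∃ (E : Ectx Hole n) (r : Exp Hole n),
      E.Valid Γ ∧ r.Valid Γ ∧ Active (IsDelim Γ) r ∧ e = E.plug r := by
  refine (e.exists_decomposition (IsDelim Γ)).imp_right ?_
  rintro ⟨E, r, hE, hr, rfl⟩
  exact ⟨E, r, (h.of_plug hE).1, (h.of_plug hE).2, hr, rfl⟩

theorem Val.fill_eq_const {Γ : List (Val Prompt 0)} {n : ℕ} {v : Val Hole n} {p : Prompt}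
    (hv : v.Valid Γ) (h : v.fill Γ = .const p) :
    ∃ a, v = .const a ∧ Γ[a.idx]? = some (.const p) := by
  cases v with
  | const a =>
    refine ⟨a, rfl, (getElem?_of_lt hv).trans ?_⟩
    simp only [Val.fill, Val.weaken] at h
    cases hl : look Γ a with
    | var i => exact i.elim0
    | const q => rw [hl, Val.rename] at h; simpa using h
    | lam e | cont E => rw [hl, Val.rename] at h; cases h
  | var | lam | cont => simp [Val.fill] at h

theorem Val.fill_const_zero (Γ : List (Val Prompt 0)) (a : Hole) :
    (Val.const a : Val Hole 0).fill Γ = look Γ a :=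
  Val.weaken_zero _

theorem Val.fill_eq_lam {Γ : List (Val Prompt 0)} {v : Val Hole 0} {e : Exp Prompt 1}
    (hv : v.Valid Γ) (h : v.fill Γ = .lam e) :
    (∃ c, v = .lam c ∧ c.fill Γ = e) ∨ ∃ a, v = .const a ∧ Γ[a.idx]? = some (.lam e) := by
  cases v with
  | var i => exact i.elim0
  | lam c => exact .inl ⟨c, rfl, by simpa [Val.fill] using h⟩
  | const a =>
    rw [Val.fill_const_zero] at h
    exact .inr ⟨a, rfl, (getElem?_of_lt hv).trans (congrArg some h)⟩
  | cont => simp [Val.fill] at h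

theorem Val.fill_eq_cont {Γ : List (Val Prompt 0)} {v : Val Hole 0} {E : Ectx Prompt 0}
    (hv : v.Valid Γ) (h : v.fill Γ = .cont E) :
    (∃ F, v = .cont F ∧ F.fill Γ = E) ∨ ∃ a, v = .const a ∧ Γ[a.idx]? = some (.cont E) := by
  cases v with
  | var i => exact i.elim0
  | cont F => exact .inl ⟨F, rfl, by simpa [Val.fill] using h⟩
  | const a =>
    rw [Val.fill_const_zero] at h
    exact .inr ⟨a, rfl, (getElem?_of_lt hv).trans (congrArg some h)⟩
  | lam => simp [Val.fill] at h

theorem Active.fill {Γ : List (Val Prompt 0)} {n : ℕ} {r : Exp Hole n}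
    (h : Active (IsDelim Γ) r) (hr : r.Valid Γ) : IsActive (r.fill Γ) := by
  cases h with
  | app v w => exact .app _ _
  | fresh e => exact .fresh _
  | resetVal v w => exact .resetVal _ _
  | resetBad v e h =>
    refine .resetBad _ _ fun p hp => ?_
    obtain ⟨a, rfl, ha⟩ := Val.fill_eq_const hr.1 hp
    exact absurd ⟨p, ha⟩ (h a rfl)
  | grab v e => exact .grab _ _
  | push v e => exact .push _ _

theorem Ectx.mem_surrounding_fill {Γ : List (Val Prompt 0)} {n : ℕ} {F : Ectx Hole n}
    (hF : F.Valid Γ) {p : Prompt} :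
    p ∈ (F.fill Γ).surrounding ↔ ∃ a ∈ F.surrounding, Γ[a.idx]? = some (.const p) := by
  match F with
  | .hole => simp [Ectx.fill, Ectx.surrounding]
  | .appL F _ => exact F.mem_surrounding_fill hF.1
  | .appR _ F => exact F.mem_surrounding_fill hF.2
  | .reset a F =>
    obtain ⟨q, hq⟩ := hF.1
    simp [Ectx.fill, Ectx.surrounding, F.mem_surrounding_fill hF.2, look_of_getElem? hq, hq,
      Val.toPrompt, eq_comm]

theorem Ectx.split_fill {Γ : List (Val Prompt 0)} {n : ℕ} {F : Ectx Hole n} (hF : F.Valid Γ)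
    {p : Prompt} {E₁ E₂ : Ectx Prompt n} (h : F.fill Γ = E₁.comp (.reset p E₂)) :
    ∃ (F₁ : Ectx Hole n) (a : Hole) (F₂ : Ectx Hole n), F = F₁.comp (.reset a F₂) ∧ F₁.fill Γ = E₁ ∧ F₂.fill Γ = E₂ ∧
      Γ[a.idx]? = some (.const p) := by
  match F, E₁ with
  | .reset a F, .hole =>
    obtain ⟨q, hq⟩ := hF.1
    simp only [Ectx.fill, Ectx.comp, Ectx.reset.injEq, look_of_getElem? hq, Val.toPrompt] at h
    exact ⟨.hole, a, F, rfl, rfl, h.2, h.1 ▸ hq⟩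
  | .reset a F, .reset q E₁ =>
    simp only [Ectx.fill, Ectx.comp, Ectx.reset.injEq] at h
    obtain ⟨F₁, b, F₂, rfl, rfl, rfl, hb⟩ := F.split_fill hF.2 h.2
    exact ⟨.reset a F₁, b, F₂, rfl, by simp [Ectx.fill, h.1], rfl, hb⟩
  | .appL F e, .appL E₁ e' =>
    simp only [Ectx.fill, Ectx.comp, Ectx.appL.injEq] at h
    obtain ⟨F₁, b, F₂, rfl, rfl, rfl, hb⟩ := F.split_fill hF.1 h.1
    exact ⟨.appL F₁ e, b, F₂, rfl, by simp [Ectx.fill, h.2], rfl, hb⟩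
  | .appR v F, .appR v' E₁ =>
    simp only [Ectx.fill, Ectx.comp, Ectx.appR.injEq] at h
    obtain ⟨F₁, b, F₂, rfl, rfl, rfl, hb⟩ := F.split_fill hF.2 h.2
    exact ⟨.appR v F₁, b, F₂, rfl, by simp [Ectx.fill, h.1], rfl, hb⟩
  | .hole, .hole | .hole, .appL _ _ | .hole, .appR _ _ | .hole, .reset _ _
  | .appL _ _, .hole | .appL _ _, .appR _ _ | .appL _ _, .reset _ _
  | .appR _ _, .hole | .appR _ _, .appL _ _ | .appR _ _, .reset _ _
  | .reset _ _, .appL _ _ | .reset _ _, .appR _ _ => simp [Ectx.fill, Ectx.comp] at h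

mutual

/-- Expressions without prompts are multi-hole contexts without holes. -/
theorem Exp.exists_fill_nil : ∀ {n : ℕ} (e : Exp Prompt n), e.prompts = ∅ →
    ∃ c : Exp Hole n, c.Valid [] ∧ c.fill [] = e
  | _, .val v, h => by
    obtain ⟨c, hc, rfl⟩ := v.exists_fill_nil h
    exact ⟨.val c, hc, rfl⟩
  | _, .app e₁ e₂, h => by
    obtain ⟨c₁, hc₁, rfl⟩ := e₁.exists_fill_nil (Set.union_empty_iff.1 h).1
    obtain ⟨c₂, hc₂, rfl⟩ := e₂.exists_fill_nil (Set.union_empty_iff.1 h).2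
    exact ⟨.app c₁ c₂, ⟨hc₁, hc₂⟩, rfl⟩
  | _, .fresh e, h => by
    obtain ⟨c, hc, rfl⟩ := e.exists_fill_nil h
    exact ⟨.fresh c, hc, rfl⟩
  | _, .reset v e, h => by
    obtain ⟨c₁, hc₁, rfl⟩ := v.exists_fill_nil (Set.union_empty_iff.1 h).1
    obtain ⟨c₂, hc₂, rfl⟩ := e.exists_fill_nil (Set.union_empty_iff.1 h).2
    exact ⟨.reset c₁ c₂, ⟨hc₁, hc₂⟩, rfl⟩
  | _, .grab v e, h => by
    obtain ⟨c₁, hc₁, rfl⟩ := v.exists_fill_nil (Set.union_empty_iff.1 h).1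
    obtain ⟨c₂, hc₂, rfl⟩ := e.exists_fill_nil (Set.union_empty_iff.1 h).2
    exact ⟨.grab c₁ c₂, ⟨hc₁, hc₂⟩, rfl⟩
  | _, .push v e, h => by
    obtain ⟨c₁, hc₁, rfl⟩ := v.exists_fill_nil (Set.union_empty_iff.1 h).1
    obtain ⟨c₂, hc₂, rfl⟩ := e.exists_fill_nil (Set.union_empty_iff.1 h).2
    exact ⟨.push c₁ c₂, ⟨hc₁, hc₂⟩, rfl⟩

theorem Val.exists_fill_nil : ∀ {n : ℕ} (v : Val Prompt n), v.prompts = ∅ →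
    ∃ c : Val Hole n, c.Valid [] ∧ c.fill [] = v
  | _, .var x, _ => ⟨.var x, trivial, rfl⟩
  | _, .lam e, h => by
    obtain ⟨c, hc, rfl⟩ := e.exists_fill_nil h
    exact ⟨.lam c, hc, rfl⟩
  | _, .const a, h => absurd h (Set.singleton_ne_empty a)
  | _, .cont E, h => by
    obtain ⟨F, hF, rfl⟩ := E.exists_fill_nil h
    exact ⟨.cont F, hF, rfl⟩

theorem Ectx.exists_fill_nil : ∀ {n : ℕ} (E : Ectx Prompt n), E.prompts = ∅ →
    ∃ F : Ectx Hole n, F.Valid [] ∧ F.fill [] = E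
  | _, .hole, _ => ⟨.hole, trivial, rfl⟩
  | _, .appL E e, h => by
    obtain ⟨c₁, hc₁, rfl⟩ := E.exists_fill_nil (Set.union_empty_iff.1 h).1
    obtain ⟨c₂, hc₂, rfl⟩ := e.exists_fill_nil (Set.union_empty_iff.1 h).2
    exact ⟨.appL c₁ c₂, ⟨hc₁, hc₂⟩, rfl⟩
  | _, .appR v E, h => by
    obtain ⟨c₁, hc₁, rfl⟩ := v.exists_fill_nil (Set.union_empty_iff.1 h).1
    obtain ⟨c₂, hc₂, rfl⟩ := E.exists_fill_nil (Set.union_empty_iff.1 h).2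
    exact ⟨.appR c₁ c₂, ⟨hc₁, hc₂⟩, rfl⟩
  | _, .reset a _, h => absurd (Set.union_empty_iff.1 h).1 (Set.singleton_ne_empty a)

end

/-! ### Weak transitions and bisimilarity of sequences of values -/

theorem Red.plug_fill {Γ : List (Val Prompt 0)} {F : Ectx Hole 0} (hF : F.Valid Γ)
    {e e' : Exp Prompt 0} (h : Red e e')
    (hf : FreshCond e'.prompts e.prompts (seqPrompts Γ)) :
    Red ((F.fill Γ).plug e) ((F.fill Γ).plug e') :=
  .compat _ _ _ h (hf.mono (Ectx.fill_prompts_subset hF))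

theorem Step.tau_inv {Γ : List (Val Prompt 0)} {e : Exp Prompt 0} {t : State}
    (h : Step (Γ, e) .tau t) :
    ∃ e', t = (Γ, e') ∧ Red e e' ∧ FreshCond e'.prompts e.prompts (seqPrompts Γ) := by
  cases h with
  | tau _ _ e' h hf => exact ⟨e', rfl, h, hf⟩

theorem WeakTau.inv {Γ : List (Val Prompt 0)} {e : Exp Prompt 0} {t : State}
    (h : WeakTau (Γ, e) t) :
    ∃ e', t = (Γ, e') ∧
      ∀ F : Ectx Hole 0, F.Valid Γ → RedStar ((F.fill Γ).plug e) ((F.fill Γ).plug e') := by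
  induction h with
  | refl => exact ⟨e, rfl, fun _ _ => .refl⟩
  | tail _ hs ih =>
    obtain ⟨u, rfl, hu⟩ := ih
    obtain ⟨u', rfl, hr, hf⟩ := hs.tau_inv
    exact ⟨u', rfl, fun F hF => (hu F hF).tail (hr.plug_fill hF hf)⟩

theorem WeakTau.of_val {Γ : List (Val Prompt 0)} {v : Val Prompt 0} {t : State}
    (h : WeakTau (Γ, .val v) t) : t = (Γ, .val v) := by
  rcases h.cases_head with h | ⟨s, hs, -⟩
  · exact h.symm
  · obtain ⟨e', -, hr, -⟩ := hs.tau_inv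
    exact absurd hr (IsValue.normalForm ⟨v, rfl⟩ e')

theorem Bisimilar.symm {s t : State} (h : Bisimilar s t) : Bisimilar t s := by
  obtain ⟨R, hR, h⟩ := h
  exact ⟨fun s t => R t s, ⟨fun _ _ h => h, fun s t h => ⟨(hR.2 t s h).2, (hR.2 t s h).1⟩⟩, h⟩

theorem Bisimilar.step {s t s' : State} {a : Label} (h : Bisimilar s t) (hs : Step s a s') :
    ∃ t', WeakStep t a t' ∧ Bisimilar s' t' := by
  obtain ⟨R, hR, h⟩ := h
  obtain ⟨t', ht, h'⟩ := (hR.2 s t h).1 a s' hs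
  exact ⟨t', ht, R, hR, h'⟩

/-- Bisimilarity of sequences of values: a nonempty sequence `Γ ++ [v]` is the state `(Γ, v)`. -/
def SeqBisimilar (Γ Δ : List (Val Prompt 0)) : Prop :=
  ∃ Γ₀ v Δ₀ w, Γ = Γ₀ ++ [v] ∧ Δ = Δ₀ ++ [w] ∧ Bisimilar (Γ₀, .val v) (Δ₀, .val w)

theorem SeqBisimilar.symm {Γ Δ : List (Val Prompt 0)} (h : SeqBisimilar Γ Δ) :
    SeqBisimilar Δ Γ := by
  obtain ⟨Γ₀, v, Δ₀, w, hΓ, hΔ, h⟩ := h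
  exact ⟨Δ₀, w, Γ₀, v, hΔ, hΓ, h.symm⟩

theorem Bisimilar.step_of_val {s : State} {Δ : List (Val Prompt 0)} {w : Val Prompt 0}
    {a : Label} {s' : State} (h : Bisimilar s (Δ, .val w)) (hs : Step s a s') (ha : a ≠ .tau) :
    ∃ t t', Step (Δ, .val w) a t ∧ WeakTau t t' ∧ Bisimilar s' t' := by
  obtain ⟨t', ⟨h, -⟩ | ⟨-, s₁, s₂, h₁, h₂, h₃⟩, h'⟩ := h.step hs
  · exact absurd h ha
  · rw [h₁.of_val] at h₂
    exact ⟨s₂, t', h₂, h₃, h'⟩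

theorem SeqBisimilar.prompt {Γ Δ : List (Val Prompt 0)} (h : SeqBisimilar Γ Δ) {i j : ℕ}
    {p : Prompt} (hi : Γ[i]? = some (.const p)) (hj : Γ[j]? = some (.const p)) :
    ∃ q, Δ[i]? = some (.const q) ∧ Δ[j]? = some (.const q) := by
  obtain ⟨Γ₀, v, Δ₀, w, rfl, rfl, h⟩ := h
  obtain ⟨t, t', hs, -, -⟩ := h.step_of_val (.prompt Γ₀ v i j p hi hj) (by simp)
  generalize hc : (Δ₀, Exp.val w) = c at hs
  cases hs with
  | prompt Δ₁ w₁ _ _ q hi hj => cases hc; exact ⟨q, hi, hj⟩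

theorem SeqBisimilar.lam {Γ Δ : List (Val Prompt 0)} (h : SeqBisimilar Γ Δ) {i : ℕ}
    {e : Exp Prompt 1} (hi : Γ[i]? = some (.lam e)) {V : Val Hole 0} (hV : V.Valid Γ) :
    ∃ e' u, Δ[i]? = some (.lam e') ∧ WeakTau (Δ, e'.inst (V.fill Δ)) (Δ, u) ∧
      Bisimilar (Γ, e.inst (V.fill Γ)) (Δ, u) := by
  obtain ⟨Γ₀, v, Δ₀, w, rfl, rfl, h⟩ := h
  obtain ⟨t, t', hs, ht, h'⟩ := h.step_of_val (.lam Γ₀ v i V e hi hV) (by simp)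
  generalize hc : (Δ₀, Exp.val w) = c at hs
  cases hs with
  | lam Δ₁ w₁ _ _ e' hi _ =>
    cases hc
    obtain ⟨u, rfl, -⟩ := ht.inv
    exact ⟨e', u, hi, ht, h'⟩

theorem SeqBisimilar.ctx {Γ Δ : List (Val Prompt 0)} (h : SeqBisimilar Γ Δ) {i : ℕ}
    {E : Ectx Prompt 0} (hi : Γ[i]? = some (.cont E)) {C : Exp Hole 0} (hC : C.Valid Γ) :
    ∃ E' u, Δ[i]? = some (.cont E') ∧ WeakTau (Δ, E'.plug (C.fill Δ)) (Δ, u) ∧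
      Bisimilar (Γ, E.plug (C.fill Γ)) (Δ, u) := by
  obtain ⟨Γ₀, v, Δ₀, w, rfl, rfl, h⟩ := h
  obtain ⟨t, t', hs, ht, h'⟩ := h.step_of_val (.ctx Γ₀ v i C E hi hC) (by simp)
  generalize hc : (Δ₀, Exp.val w) = c at hs
  cases hs with
  | ctx Δ₁ w₁ _ _ E' hi _ =>
    cases hc
    obtain ⟨u, rfl, -⟩ := ht.inv
    exact ⟨E', u, hi, ht, h'⟩

theorem SeqBisimilar.new {Γ Δ : List (Val Prompt 0)} (h : SeqBisimilar Γ Δ) {p : Prompt}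
    (hp : p ∉ seqPrompts Γ) :
    ∃ q, q ∉ seqPrompts Δ ∧ SeqBisimilar (Γ ++ [.const p]) (Δ ++ [.const q]) := by
  obtain ⟨Γ₀, v, Δ₀, w, rfl, rfl, h⟩ := h
  obtain ⟨t, t', hs, ht, h'⟩ := h.step_of_val (.new Γ₀ v p hp) (by simp)
  generalize hc : (Δ₀, Exp.val w) = c at hs
  cases hs with
  | new Δ₁ w₁ q hq =>
    cases hc
    obtain rfl := ht.of_val
    exact ⟨q, hq, _, _, _, _, rfl, rfl, h'⟩

/-- Every element of a sequence is observable by some transition naming its position. -/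
theorem SeqBisimilar.length_le {Γ Δ : List (Val Prompt 0)} (h : SeqBisimilar Γ Δ) :
    Γ.length ≤ Δ.length := by
  by_contra! hlt
  have hi : Γ[Δ.length]? = some Γ[Δ.length] := List.getElem?_eq_getElem hlt
  cases hv : Γ[Δ.length] with
  | var i => exact i.elim0
  | lam e =>
    obtain ⟨e', u, h', -⟩ := h.lam (V := .lam (.val (.var 0))) (hi.trans (by rw [hv])) trivial
    simp at h'
  | const p =>
    obtain ⟨q, h', -⟩ := h.prompt (hi.trans (by rw [hv])) (hi.trans (by rw [hv]))
    simp at h'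
  | cont E =>
    obtain ⟨e', u, h', -⟩ := h.ctx (C := .val (.lam (.val (.var 0)))) (hi.trans (by rw [hv]))
      trivial
    simp at h'

theorem SeqBisimilar.isDelim {Γ Δ : List (Val Prompt 0)} (h : SeqBisimilar Γ Δ) (a : Hole)
    (ha : IsDelim Γ a) : IsDelim Δ a := by
  obtain ⟨p, hp⟩ := ha
  obtain ⟨q, hq, -⟩ := h.prompt hp hp
  exact ⟨q, hq⟩

theorem SeqBisimilar.ectx_valid {Γ Δ : List (Val Prompt 0)} (h : SeqBisimilar Γ Δ)
    {F : Ectx Hole 0} (hF : F.Valid Γ) : F.Valid Δ :=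
  hF.congr h.length_le h.isDelim

/-- Bisimilar sequences make the same delimiters of a context equal. -/
theorem SeqBisimilar.notMem_surrounding {Γ Δ : List (Val Prompt 0)} (h : SeqBisimilar Γ Δ)
    {F : Ectx Hole 0} (hF : F.Valid Γ) {a : Hole} {p q : Prompt}
    (hp : Γ[a.idx]? = some (.const p)) (hq : Δ[a.idx]? = some (.const q))
    (hn : p ∉ (F.fill Γ).surrounding) : q ∉ (F.fill Δ).surrounding := by
  intro hm
  obtain ⟨b, hb, hbq⟩ := (Ectx.mem_surrounding_fill (h.ectx_valid hF)).1 hm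
  obtain ⟨p', hp', hbp⟩ := h.symm.prompt hq hbq
  obtain rfl : p = p' := by simpa [hp] using hp'
  exact hn ((Ectx.mem_surrounding_fill hF).2 ⟨b, hb, hbp⟩)

/-! ### Bisimilar states have the same outcomes in all contexts -/

theorem look_append_length (Γ : List (Val Prompt 0)) (v : Val Prompt 0) :
    look (Γ ++ [v]) ⟨Γ.length⟩ = v :=
  look_of_getElem? (by simp)

/-- The redexes created by filling the same context with bisimilar sequences reduce in lockstep:
to fillings of the same context with (possibly longer) bisimilar sequences, or, when the redex uses
an element of the sequence, to bisimilar states placed in the same evaluation context. -/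
theorem SeqBisimilar.fire {Γ Δ : List (Val Prompt 0)} (h : SeqBisimilar Γ Δ) {F : Ectx Hole 0}
    (hF : F.Valid Γ) {R : Exp Hole 0} (hR : R.Valid Γ) (ha : Active (IsDelim Γ) R)
    {u : Exp Prompt 0} (hu : Fire (F.fill Γ) (R.fill Γ) u) :
    (∃ (Γ' Δ' : List (Val Prompt 0)) (C : Exp Hole 0), SeqBisimilar Γ' Δ' ∧ C.Valid Γ' ∧
      Fire (F.fill Γ) (R.fill Γ) (C.fill Γ') ∧ Fire (F.fill Δ) (R.fill Δ) (C.fill Δ')) ∨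
    (∃ e₁ e₂ e₂', Bisimilar (Γ, e₁) (Δ, e₂') ∧ WeakTau (Δ, e₂) (Δ, e₂') ∧
      Fire (F.fill Γ) (R.fill Γ) ((F.fill Γ).plug e₁) ∧
      Fire (F.fill Δ) (R.fill Δ) ((F.fill Δ).plug e₂)) := by
  have hFΔ := h.ectx_valid hF
  cases ha with
  | app V W =>
    simp only [Exp.fill] at hu ⊢
    generalize hv : V.fill Γ = v at hu
    cases hu with
    | beta e _ =>
      rcases Val.fill_eq_lam hR.1 hv with ⟨c, rfl, rfl⟩ | ⟨a, rfl, ha⟩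
      · left
        refine ⟨Γ, Δ, F.plug (c.inst W), h, hF.plug (Exp.Valid.inst hR.1 hR.2), ?_, ?_⟩
        · rw [F.fill_plug _ _ hF, Exp.fill_inst]; exact .beta _ _
        · rw [F.fill_plug _ _ hFΔ, Exp.fill_inst]; exact .beta _ _
      · right
        obtain ⟨e', u, hΔ, hw, hb⟩ := h.lam ha hR.2
        refine ⟨_, _, u, hb, hw, ?_, ?_⟩
        · exact .beta _ _
        · rw [Val.fill_const_zero, look_of_getElem? hΔ]; exact .beta _ _
  | fresh C =>
    left
    obtain ⟨p, hp⟩ := exists_fresh_prompt (seqPrompts_finite Γ)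
    obtain ⟨q, hq, h'⟩ := h.new hp
    have key : ∀ {Γ : List (Val Prompt 0)} {p : Prompt}, F.Valid Γ → C.Valid Γ →
        p ∉ seqPrompts Γ → Fire (F.fill Γ) ((Exp.fresh C).fill Γ)
          ((F.plug (C.inst (.const ⟨Γ.length⟩))).fill (Γ ++ [.const p])) := by
      intro Γ p hF hC hp
      rw [F.fill_plug _ _ (hF.append _), Exp.fill_inst, Val.fill_const_zero, look_append_length,
        Ectx.fill_append _ hF, Exp.fill_append _ hC]
      exact .fresh p _ (fun h => hp (Exp.fill_prompts_subset hC h))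
        (fun h => hp (Ectx.fill_prompts_subset hF h))
    have hl : Γ.length = Δ.length := h.length_le.antisymm h.symm.length_le
    refine ⟨_, _, _, h', ?_, key hF hR hp,
      hl ▸ key hFΔ (Exp.Valid.congr h.length_le h.isDelim hR) hq⟩
    refine (hF.append _).plug (Exp.Valid.inst (Exp.Valid.append _ (e := C) hR) ?_)
    show Γ.length < _
    simp
  | resetVal V W =>
    left
    simp only [Exp.fill] at hu ⊢
    generalize hv : V.fill Γ = v at hu
    cases hu with
    | reset p _ =>
      obtain ⟨a, rfl, ha⟩ := Val.fill_eq_const hR.1 hv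
      obtain ⟨q, hq, -⟩ := h.prompt ha ha
      refine ⟨Γ, Δ, F.plug (.val W), h, hF.plug hR.2, ?_, ?_⟩
      · rw [F.fill_plug _ _ hF]; exact .reset _ _
      · rw [F.fill_plug _ _ hFΔ, Val.fill_const_zero, look_of_getElem? hq]; exact .reset _ _
  | resetBad V C hbad =>
    simp only [Exp.fill] at hu
    generalize hv : V.fill Γ = v at hu
    generalize C.fill Γ = c at hu
    cases hu with
    | reset p _ =>
      obtain ⟨a, rfl, ha⟩ := Val.fill_eq_const hR.1 hv
      exact absurd ⟨p, ha⟩ (hbad a rfl)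
  | grab V C =>
    left
    simp only [Exp.fill] at hu ⊢
    generalize hv : V.fill Γ = v at hu
    cases hu with
    | grab p E₁ E₂ _ hE hp =>
      obtain ⟨a, rfl, ha⟩ := Val.fill_eq_const hR.1 hv
      obtain ⟨F₁, b, F₂, rfl, rfl, rfl, hb⟩ := Ectx.split_fill hF hE
      obtain ⟨q, hq, hqb⟩ := h.prompt ha hb
      have hF₁ := hF.of_comp.1
      have hF₂ : F₂.Valid Γ := hF.of_comp.2.2
      refine ⟨Γ, Δ, F₁.plug (C.inst (.cont F₂)), h, hF₁.plug (Exp.Valid.inst hR.2 hF₂), ?_, ?_⟩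
      · rw [F₁.fill_plug _ _ hF₁, Exp.fill_inst]
        exact .grab p _ _ _ hE hp
      · rw [F₁.fill_plug _ _ hFΔ.of_comp.1, Exp.fill_inst, Val.fill_const_zero,
          look_of_getElem? hq]
        refine .grab q _ _ _ ?_ (h.notMem_surrounding hF₂ ha hq hp)
        simp [Ectx.fill_comp, Ectx.fill, look_of_getElem? hqb, Val.toPrompt]
  | push V C =>
    simp only [Exp.fill] at hu ⊢
    generalize hv : V.fill Γ = v at hu
    cases hu with
    | push E _ =>
      rcases Val.fill_eq_cont hR.1 hv with ⟨G, rfl, rfl⟩ | ⟨a, rfl, ha⟩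
      · left
        have hG : G.Valid Γ := hR.1
        refine ⟨Γ, Δ, F.plug (G.plug C), h, hF.plug (hG.plug hR.2), ?_, ?_⟩
        · rw [F.fill_plug _ _ hF, G.fill_plug _ _ hG]; exact .push _ _
        · rw [F.fill_plug _ _ hFΔ, G.fill_plug _ _ (h.ectx_valid hG)]; exact .push _ _
      · right
        obtain ⟨E', u, hΔ, hw, hb⟩ := h.ctx ha hR.2
        refine ⟨_, _, u, hb, hw, ?_, ?_⟩
        · exact .push _ _
        · rw [Val.fill_const_zero, look_of_getElem? hΔ]; exact .push _ _

theorem SeqBisimilar.isStuck {Γ Δ : List (Val Prompt 0)} (h : SeqBisimilar Γ Δ) {F : Ectx Hole 0}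
    (hF : F.Valid Γ) {R : Exp Hole 0} (hR : R.Valid Γ) (ha : Active (IsDelim Γ) R)
    (hs : IsStuck ((F.fill Γ).plug (R.fill Γ))) : IsStuck ((F.fill Δ).plug (R.fill Δ)) := by
  obtain ⟨p, e, hp, he⟩ := (isStuck_plug_iff (ha.fill hR)).1 hs
  cases ha with
  | grab V C =>
    simp only [Exp.fill, Exp.grab.injEq] at he
    obtain ⟨a, rfl, ha⟩ := Val.fill_eq_const hR.1 he.1
    obtain ⟨q, hq, -⟩ := h.prompt ha ha
    refine ⟨_, q, C.fill Δ, h.notMem_surrounding hF ha hq hp, ?_⟩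
    rw [Exp.fill, Val.fill_const_zero, look_of_getElem? hq]
  | app | fresh | resetVal | resetBad | push => simp [Exp.fill] at he

theorem WeakStep.val_inv {Δ : List (Val Prompt 0)} {e : Exp Prompt 0} {t : State}
    (h : WeakStep (Δ, e) .val t) : ∃ w, t = (Δ, .val w) ∧ WeakTau (Δ, e) (Δ, .val w) := by
  obtain ⟨h, -⟩ | ⟨-, s₁, s₂, h₁, h₂, h₃⟩ := h
  · simp at h
  · obtain ⟨e', rfl, -⟩ := h₁.inv
    generalize hc : (Δ, e') = c at h₂
    cases h₂ with
    | val _ w =>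
      cases hc
      exact ⟨w, h₃.of_val, h₁⟩

theorem WeakStep.stuck_inv {Δ : List (Val Prompt 0)} {e : Exp Prompt 0} {F : Ectx Hole 0}
    {t : State} (h : WeakStep (Δ, e) (.stuck F) t) :
    ∃ e' u u', IsStuck e' ∧ WeakTau (Δ, e) (Δ, e') ∧ F.Valid Δ ∧
      RedBis ((F.fill Δ).plug e') u ∧ WeakTau (Δ, u) (Δ, u') ∧ t = (Δ, u') := by
  obtain ⟨h, -⟩ | ⟨-, s₁, s₂, h₁, h₂, h₃⟩ := h
  · simp at h
  · obtain ⟨e', rfl, -⟩ := h₁.inv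
    generalize hc : (Δ, e') = c at h₂
    cases h₂ with
    | stuck _ _ E p e₁ u hp hF hr =>
      cases hc
      obtain ⟨u', rfl, -⟩ := h₃.inv
      exact ⟨_, u, u', ⟨E, p, e₁, hp, rfl⟩, h₁, hF, hr, h₃, rfl⟩

theorem WeakTau.redStar {Δ : List (Val Prompt 0)} {e e' : Exp Prompt 0}
    (h : WeakTau (Δ, e) (Δ, e')) {F : Ectx Hole 0} (hF : F.Valid Δ) :
    RedStar ((F.fill Δ).plug e) ((F.fill Δ).plug e') := by
  obtain ⟨u, hu, h⟩ := h.inv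
  cases hu
  exact h F hF

theorem WeakTau.redStar_self {Δ : List (Val Prompt 0)} {e e' : Exp Prompt 0}
    (h : WeakTau (Δ, e) (Δ, e')) : RedStar e e' :=
  h.redStar (F := .hole) trivial

theorem RedBis.redStar {e e' : Exp Prompt 0} (h : RedBis e e') : RedStar e e' := by
  rcases h with h | ⟨-, rfl⟩
  · exact .single h
  · exact .refl

/-- The two statements are proved together, by induction on the number of steps: the first is
about contexts filled with bisimilar sequences of values, the second about bisimilar states in an
evaluation context. -/
theorem conv_of_bisimilar {O : Exp Prompt 0 → Prop} (hO : Outcome O) (k : ℕ) :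
    (∀ {Γ Δ : List (Val Prompt 0)} {C : Exp Hole 0}, SeqBisimilar Γ Δ → C.Valid Γ →
      ConvIn O k (C.fill Γ) → Conv O (C.fill Δ)) ∧
    (∀ {Γ Δ : List (Val Prompt 0)} {F : Ectx Hole 0} {e₁ e₂ : Exp Prompt 0}, F.Valid Γ →
      F.Valid Δ → Bisimilar (Γ, e₁) (Δ, e₂) → ConvIn O k ((F.fill Γ).plug e₁) →
      Conv O ((F.fill Δ).plug e₂)) := by
  induction k using Nat.strong_induction_on with
  | _ k ih =>
  have hseq : ∀ {Γ Δ : List (Val Prompt 0)} {C : Exp Hole 0}, SeqBisimilar Γ Δ → C.Valid Γ →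
      ConvIn O k (C.fill Γ) → Conv O (C.fill Δ) := by
    intro Γ Δ C h hC hk
    rcases hC.decompose with ⟨V, rfl⟩ | ⟨F, R, hF, hR, ha, rfl⟩
    · cases k with
      | zero => exact ⟨0, hO.of_isValue ⟨_, rfl⟩ ⟨_, rfl⟩ hk⟩
      | succ k =>
        obtain ⟨u, hu, -⟩ := hk
        exact absurd hu (IsValue.normalForm ⟨_, rfl⟩ u)
    · have hFΔ := h.ectx_valid hF
      rw [F.fill_plug _ _ hF] at hk
      rw [F.fill_plug _ _ hFΔ]
      cases k with
      | zero =>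
        rcases hO.isValue_or_isStuck hk with ⟨v, hv⟩ | hs
        · exact absurd hv ((ha.fill hR).plug_ne_val _ _)
        · exact ⟨0, hO.of_isStuck hs (h.isStuck hF hR ha hs) hk⟩
      | succ k =>
        have ⟨u, hu, _⟩ := hk
        rcases h.fire hF hR ha ((ha.fill hR).red_iff_fire.1 hu) with
          ⟨Γ', Δ', C, h', hC', h₁, h₂⟩ | ⟨e₁, e₂, e₂', hb, hw, h₁, h₂⟩
        · obtain ⟨j, hj, hk'⟩ := hk.of_red hO h₁.red
          rw [conv_iff_of_red hO h₂.red]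
          exact (ih j (by omega)).1 h' hC' hk'
        · obtain ⟨j, hj, hk'⟩ := hk.of_red hO h₁.red
          rw [conv_iff_of_red hO h₂.red, conv_iff_of_redStar hO (hw.redStar hFΔ)]
          exact (ih j (by omega)).2 hF hFΔ hb hk'
  refine ⟨hseq, ?_⟩
  intro Γ Δ F e₁ e₂ hF hFΔ hb hk
  rcases e₁.exists_decomposition (fun _ => True) with ⟨v, rfl⟩ | ⟨E, r, -, hr, rfl⟩
  · -- A value becomes the last element of the sequence, and `F[v]` a filling of `F[□]`.
    obtain ⟨t, ht, hb'⟩ := hb.step (.val Γ v)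
    obtain ⟨w, rfl, hw⟩ := ht.val_inv
    have hs : SeqBisimilar (Γ ++ [v]) (Δ ++ [w]) := ⟨_, _, _, _, rfl, rfl, hb'⟩
    have hl : Γ.length = Δ.length := by
      simpa using hs.length_le.antisymm hs.symm.length_le
    have key : ∀ {Γ : List (Val Prompt 0)} (v : Val Prompt 0), F.Valid Γ →
        (F.plug (.val (.const ⟨Γ.length⟩))).fill (Γ ++ [v]) = (F.fill Γ).plug (.val v) := by
      intro Γ v hF
      rw [F.fill_plug _ _ (hF.append _), Exp.fill, Val.fill_const_zero, look_append_length,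
        Ectx.fill_append _ hF]
    rw [conv_iff_of_redStar hO (hw.redStar hFΔ), ← key w hFΔ, ← hl]
    refine hseq hs ((hF.append _).plug ?_) (by rwa [key v hF])
    show Γ.length < _
    simp
  · by_cases hs : IsStuck (E.plug r)
    · obtain ⟨E', p, e, hp, he⟩ := hs
      rw [he] at hb hk
      -- A control-stuck expression is tested in the context `F` itself; if the whole expression
      -- remains stuck, a second test, in the empty context, shows that the other side is stuck too.
      by_cases hn : NormalForm ((F.fill Γ).plug (E'.plug (.grab (.const p) e)))
      · obtain ⟨t, ht, hb'⟩ := hb.step (.stuck Γ F E' p e _ hp hF (.inr ⟨hn, rfl⟩))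
        obtain ⟨s, u, u', -, h₁, -, h₂, h₃, rfl⟩ := ht.stuck_inv
        cases k with
        | succ k =>
          obtain ⟨u, hu, -⟩ := hk
          exact absurd hu (hn u)
        | zero =>
          have hst := (hO.isValue_or_isStuck hk).resolve_left fun ⟨v, hv⟩ => by
            rw [← Ectx.comp_plug] at hv
            exact absurd hv (IsActive.plug_ne_val (.grab _ _) _ _)
          have ⟨E₃, p₃, e₃, hp₃, he₃⟩ := hst
          rw [he₃] at hb' hn
          obtain ⟨t, ht, -⟩ :=
            hb'.step (.stuck Γ .hole E₃ p₃ e₃ _ hp₃ trivial (.inr ⟨hn, rfl⟩))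
          obtain ⟨s', _, _, hs', h₄, -⟩ := ht.stuck_inv
          rw [conv_iff_of_redStar hO (h₁.redStar hFΔ), conv_iff_of_redStar hO h₂.redStar,
            conv_iff_of_redStar hO h₃.redStar_self,
            conv_iff_of_redStar hO h₄.redStar_self]
          exact ⟨0, hO.of_isStuck hst hs' hk⟩
      · unfold NormalForm at hn
        push Not at hn
        obtain ⟨u₁, hu₁⟩ := hn
        obtain ⟨t, ht, hb'⟩ := hb.step (.stuck Γ F E' p e u₁ hp hF (.inl hu₁))
        obtain ⟨s, u, u', -, h₁, -, h₂, h₃, rfl⟩ := ht.stuck_inv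
        obtain ⟨j, hj, hk'⟩ := hk.of_red hO hu₁
        rw [conv_iff_of_redStar hO (h₁.redStar hFΔ), conv_iff_of_redStar hO h₂.redStar,
          conv_iff_of_redStar hO h₃.redStar_self]
        exact (ih j (by omega)).2 (F := .hole) trivial trivial hb' hk'
    · -- The remaining expressions reduce or are errors, and do so inside `e₁`.
      rw [← Ectx.comp_plug] at hk
      cases k with
      | zero =>
        rcases hO.isValue_or_isStuck hk with ⟨v, hv⟩ | hst
        · exact absurd hv (IsActive.plug_ne_val hr _ _)
        · obtain ⟨p, e, hp, rfl⟩ := (isStuck_plug_iff hr).1 hst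
          rw [Ectx.comp_surrounding, Set.mem_union, not_or] at hp
          exact absurd ((isStuck_plug_iff hr).2 ⟨p, e, hp.2, rfl⟩) hs
      | succ k =>
        have ⟨u, hu, _⟩ := hk
        obtain ⟨u', hu'⟩ := (IsActive.red_iff_fire hr |>.1 hu).of_comp.resolve_right hs
        obtain ⟨u', hu', hf⟩ := hu'.red.exists_fresh_red (seqPrompts_finite Γ)
        obtain ⟨t, ht, hb'⟩ := hb.step (.tau Γ _ u' hu' hf)
        obtain ⟨-, hw⟩ | ⟨h, -⟩ := ht
        · obtain ⟨e₂', rfl, -⟩ := hw.inv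
          rw [Ectx.comp_plug] at hk
          obtain ⟨j, hj, hk'⟩ := hk.of_red hO (hu'.plug_fill hF hf)
          rw [conv_iff_of_redStar hO (hw.redStar hFΔ)]
          exact (ih j (by omega)).2 hF hFΔ hb' hk'
        · exact absurd rfl h

theorem Bisimilar.ctxEq {e₁ e₂ : Exp Prompt 0} (h : Bisimilar ([], e₁) ([], e₂)) :
    CtxEq e₁ e₂ := by
  intro E hE
  obtain ⟨F, hF, rfl⟩ := E.exists_fill_nil hE
  refine obsEq_iff.2 fun O hO => ⟨?_, ?_⟩
  · rintro ⟨k, hk⟩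
    exact (conv_of_bisimilar hO k).2 hF hF h hk
  · rintro ⟨k, hk⟩
    exact (conv_of_bisimilar hO k).2 hF hF h.symm hk

/-! ### Continuations rebuilt at run time -/

/-- The expression `new x. reset x (E[grab x k. k])`, which evaluates to the value `⌜E⌝`. -/
def Ectx.reify {n : ℕ} (E : Ectx Prompt n) : Exp Prompt n :=
  .fresh (.reset (.var 0) ((E.rename Fin.succ).plug (.grab (.var 0) (.val (.var 0)))))

theorem Ectx.reify_subst {n m : ℕ} (E : Ectx Prompt n) (s : Fin n → Val Prompt m) :
    E.reify.subst s = (E.subst s).reify := by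
  simp [Ectx.reify, Exp.subst, Val.subst, Ectx.plug_subst, Ectx.rename_subst, Ectx.subst_rename,
    liftSub]

theorem Ectx.reify_rename {n m : ℕ} (E : Ectx Prompt n) (r : Fin n → Fin m) :
    E.reify.rename r = (E.rename r).reify := by
  rw [← Exp.subst_var_eq_rename, Ectx.reify_subst, Ectx.subst_var_eq_rename]

theorem Ectx.surrounding_subset_prompts {A : Type} {n : ℕ} (E : Ectx A n) :
    E.surrounding ⊆ E.prompts := by
  match E with
  | .hole => exact fun _ h => h
  | .appL E _ => exact fun _ h => .inl (E.surrounding_subset_prompts h)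
  | .appR _ E => exact fun _ h => .inr (E.surrounding_subset_prompts h)
  | .reset _ E => exact Set.union_subset_union_right _ E.surrounding_subset_prompts

theorem Ectx.reify_redStar {n : ℕ} (E E₀ : Ectx Prompt n) :
    RedStar (E₀.plug E.reify) (E₀.plug (.val (.cont E))) := by
  obtain ⟨q, hq⟩ := exists_fresh_prompt (E.prompts_finite.union E₀.prompts_finite)
  rw [Set.mem_union, not_or] at hq
  have h₁ := Fire.fresh (E := E₀) q
    (.reset (.var 0) ((E.rename Fin.succ).plug (.grab (.var 0) (.val (.var 0)))))
    (by simpa [Exp.prompts, Val.prompts, Ectx.plug_prompts, Ectx.rename_prompts] using hq.1) hq.2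
  have h₂ : (Exp.reset (.var 0) ((E.rename Fin.succ).plug (.grab (.var 0) (.val (.var 0))))).inst
      (.const q) = .reset (.const q) (E.plug (.grab (.const q) (.val (.var 0)))) := by
    simp [Exp.inst, Exp.subst, Val.subst, Ectx.plug_subst, Ectx.rename_subst, liftSub,
      Ectx.subst_var]
  rw [h₂] at h₁
  refine .head h₁.red (.single ?_)
  have h₃ := (Fire.grab (E := E₀.comp (.reset q E)) q E₀ E (.val (.var 0)) rfl
    fun h => hq.1 (E.surrounding_subset_prompts h)).red
  rwa [Ectx.comp_plug] at h₃

mutual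

/-- `ExpSim e e'`: the expression `e'` is `e` with some continuation values `⌜E⌝` in expression
position replaced by expressions that evaluate to them, some `push ⌜E⌝ e` replaced by
`push ⌜□⌝ E[e]`, and continuation values in positions where they can only cause errors replaced
arbitrarily. -/
inductive ExpSim : {n : ℕ} → Exp Prompt n → Exp Prompt n → Prop
  | val {n : ℕ} {v v' : Val Prompt n} : ValSim v v' → ExpSim (.val v) (.val v')
  | reify {n : ℕ} {E E' : Ectx Prompt n} : EctxSim E E' → ExpSim (.val (.cont E)) E'.reify
  | app {n : ℕ} {e₁ e₁' e₂ e₂' : Exp Prompt n} :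
      ExpSim e₁ e₁' → ExpSim e₂ e₂' → ExpSim (.app e₁ e₂) (.app e₁' e₂')
  | appHead {n : ℕ} {v v' : Val Prompt n} {e e' : Exp Prompt n} :
      HeadSim v v' → ExpSim e e' → ExpSim (.app (.val v) e) (.app (.val v') e')
  | fresh {n : ℕ} {e e' : Exp Prompt (n + 1)} : ExpSim e e' → ExpSim (.fresh e) (.fresh e')
  | reset {n : ℕ} {v v' : Val Prompt n} {e e' : Exp Prompt n} :
      HeadSim v v' → ExpSim e e' → ExpSim (.reset v e) (.reset v' e')
  | grab {n : ℕ} {v v' : Val Prompt n} {e e' : Exp Prompt (n + 1)} :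
      HeadSim v v' → ExpSim e e' → ExpSim (.grab v e) (.grab v' e')
  | push {n : ℕ} {v v' : Val Prompt n} {e e' : Exp Prompt n} :
      ValSim v v' → ExpSim e e' → ExpSim (.push v e) (.push v' e')
  | pushCont {n : ℕ} {E E' : Ectx Prompt n} {e e' : Exp Prompt n} :
      EctxSim E E' → ExpSim e e' → ExpSim (.push (.cont E) e) (.push (.cont .hole) (E'.plug e'))

/-- The relation `ExpSim` on values. -/
inductive ValSim : {n : ℕ} → Val Prompt n → Val Prompt n → Prop
  | var {n : ℕ} (x : Fin n) : ValSim (.var x) (.var x)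
  | lam {n : ℕ} {e e' : Exp Prompt (n + 1)} : ExpSim e e' → ValSim (.lam e) (.lam e')
  | const {n : ℕ} (p : Prompt) : ValSim (n := n) (.const p) (.const p)
  | cont {n : ℕ} {E E' : Ectx Prompt n} : EctxSim E E' → ValSim (.cont E) (.cont E')

/-- The relation `ExpSim` on values in head position of an application, `reset` or `grab`, where
all continuations are alike: they cause errors. -/
inductive HeadSim : {n : ℕ} → Val Prompt n → Val Prompt n → Prop
  | of {n : ℕ} {v v' : Val Prompt n} : ValSim v v' → HeadSim v v'
  | cont {n : ℕ} (E E' : Ectx Prompt n) : HeadSim (.cont E) (.cont E')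

/-- The relation `ExpSim` on evaluation contexts. -/
inductive EctxSim : {n : ℕ} → Ectx Prompt n → Ectx Prompt n → Prop
  | hole {n : ℕ} : EctxSim (n := n) .hole .hole
  | appL {n : ℕ} {E E' : Ectx Prompt n} {e e' : Exp Prompt n} :
      EctxSim E E' → ExpSim e e' → EctxSim (.appL E e) (.appL E' e')
  | appR {n : ℕ} {v v' : Val Prompt n} {E E' : Ectx Prompt n} :
      HeadSim v v' → EctxSim E E' → EctxSim (.appR v E) (.appR v' E')
  | reset {n : ℕ} (p : Prompt) {E E' : Ectx Prompt n} :
      EctxSim E E' → EctxSim (.reset p E) (.reset p E')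

end

mutual

theorem ExpSim.refl : ∀ {n : ℕ} (e : Exp Prompt n), ExpSim e e
  | _, .val v => .val (.refl v)
  | _, .app e₁ e₂ => .app (.refl e₁) (.refl e₂)
  | _, .fresh e => .fresh (.refl e)
  | _, .reset v e => .reset (.of (.refl v)) (.refl e)
  | _, .grab v e => .grab (.of (.refl v)) (.refl e)
  | _, .push v e => .push (.refl v) (.refl e)

theorem ValSim.refl : ∀ {n : ℕ} (v : Val Prompt n), ValSim v v
  | _, .var x => .var x
  | _, .lam e => .lam (.refl e)
  | _, .const p => .const p
  | _, .cont E => .cont (.refl E)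

theorem EctxSim.refl : ∀ {n : ℕ} (E : Ectx Prompt n), EctxSim E E
  | _, .hole => .hole
  | _, .appL E e => .appL (.refl E) (.refl e)
  | _, .appR v E => .appR (.of (.refl v)) (.refl E)
  | _, .reset p E => .reset p (.refl E)

end

theorem Ectx.plug_rename {n m : ℕ} (E : Ectx Prompt n) (e : Exp Prompt n) (r : Fin n → Fin m) :
    (E.plug e).rename r = (E.rename r).plug (e.rename r) := by
  simp only [← Exp.subst_var_eq_rename, Ectx.plug_subst, Ectx.subst_var_eq_rename]

mutual

theorem ExpSim.rename : ∀ {n : ℕ} {e e' : Exp Prompt n} {m : ℕ} (r : Fin n → Fin m),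
    ExpSim e e' → ExpSim (e.rename r) (e'.rename r)
  | _, _, _, _, r, .val h => .val (h.rename r)
  | _, _, _, _, r, .reify h => by rw [Ectx.reify_rename]; exact .reify (h.rename r)
  | _, _, _, _, r, .app h₁ h₂ => .app (h₁.rename r) (h₂.rename r)
  | _, _, _, _, r, .appHead h₁ h₂ => .appHead (h₁.rename r) (h₂.rename r)
  | _, _, _, _, r, .fresh h => .fresh (h.rename _)
  | _, _, _, _, r, .reset h₁ h₂ => .reset (h₁.rename r) (h₂.rename r)
  | _, _, _, _, r, .grab h₁ h₂ => .grab (h₁.rename r) (h₂.rename _)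
  | _, _, _, _, r, .push h₁ h₂ => .push (h₁.rename r) (h₂.rename r)
  | _, _, _, _, r, .pushCont h₁ h₂ => by
    simpa only [Exp.rename, Val.rename, Ectx.rename, Ectx.plug_rename] using
      .pushCont (h₁.rename r) (h₂.rename r)

theorem ValSim.rename : ∀ {n : ℕ} {v v' : Val Prompt n} {m : ℕ} (r : Fin n → Fin m),
    ValSim v v' → ValSim (v.rename r) (v'.rename r)
  | _, _, _, _, r, .var x => .var (r x)
  | _, _, _, _, _, .lam h => .lam (h.rename _)
  | _, _, _, _, _, .const p => .const p
  | _, _, _, _, r, .cont h => .cont (h.rename r)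

theorem HeadSim.rename : ∀ {n : ℕ} {v v' : Val Prompt n} {m : ℕ} (r : Fin n → Fin m),
    HeadSim v v' → HeadSim (v.rename r) (v'.rename r)
  | _, _, _, _, r, .of h => .of (h.rename r)
  | _, _, _, _, r, .cont E E' => .cont (E.rename r) (E'.rename r)

theorem EctxSim.rename : ∀ {n : ℕ} {E E' : Ectx Prompt n} {m : ℕ} (r : Fin n → Fin m),
    EctxSim E E' → EctxSim (E.rename r) (E'.rename r)
  | _, _, _, _, _, .hole => .hole
  | _, _, _, _, r, .appL h₁ h₂ => .appL (h₁.rename r) (h₂.rename r)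
  | _, _, _, _, r, .appR h₁ h₂ => .appR (h₁.rename r) (h₂.rename r)
  | _, _, _, _, r, .reset p h => .reset p (h.rename r)

end

theorem liftSub_valSim {n m : ℕ} {s s' : Fin n → Val Prompt m} (hs : ∀ i, ValSim (s i) (s' i))
    (i : Fin (n + 1)) : ValSim (liftSub s i) (liftSub s' i) := by
  cases i using Fin.cases with
  | zero => exact .var 0
  | succ i => exact (hs i).rename _

mutual

theorem ExpSim.subst : ∀ {n : ℕ} {e e' : Exp Prompt n} {m : ℕ} {s s' : Fin n → Val Prompt m},
    (∀ i, ValSim (s i) (s' i)) → ExpSim e e' → ExpSim (e.subst s) (e'.subst s')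
  | _, _, _, _, _, _, hs, .val h => .val (h.subst hs)
  | _, _, _, _, _, _, hs, .reify h => by rw [Ectx.reify_subst]; exact .reify (h.subst hs)
  | _, _, _, _, _, _, hs, .app h₁ h₂ => .app (h₁.subst hs) (h₂.subst hs)
  | _, _, _, _, _, _, hs, .appHead h₁ h₂ => .appHead (h₁.subst hs) (h₂.subst hs)
  | _, _, _, _, _, _, hs, .fresh h => .fresh (h.subst (liftSub_valSim hs))
  | _, _, _, _, _, _, hs, .reset h₁ h₂ => .reset (h₁.subst hs) (h₂.subst hs)
  | _, _, _, _, _, _, hs, .grab h₁ h₂ => .grab (h₁.subst hs) (h₂.subst (liftSub_valSim hs))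
  | _, _, _, _, _, _, hs, .push h₁ h₂ => .push (h₁.subst hs) (h₂.subst hs)
  | _, _, _, _, _, _, hs, .pushCont h₁ h₂ => by
    simpa only [Exp.subst, Val.subst, Ectx.subst, Ectx.plug_subst] using
      .pushCont (h₁.subst hs) (h₂.subst hs)

theorem ValSim.subst : ∀ {n : ℕ} {v v' : Val Prompt n} {m : ℕ} {s s' : Fin n → Val Prompt m},
    (∀ i, ValSim (s i) (s' i)) → ValSim v v' → ValSim (v.subst s) (v'.subst s')
  | _, _, _, _, _, _, hs, .var x => hs x
  | _, _, _, _, _, _, hs, .lam h => .lam (h.subst (liftSub_valSim hs))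
  | _, _, _, _, _, _, _, .const p => .const p
  | _, _, _, _, _, _, hs, .cont h => .cont (h.subst hs)

theorem HeadSim.subst : ∀ {n : ℕ} {v v' : Val Prompt n} {m : ℕ} {s s' : Fin n → Val Prompt m},
    (∀ i, ValSim (s i) (s' i)) → HeadSim v v' → HeadSim (v.subst s) (v'.subst s')
  | _, _, _, _, _, _, hs, .of h => .of (h.subst hs)
  | _, _, _, _, _, _, _, .cont _ _ => .cont _ _

theorem EctxSim.subst : ∀ {n : ℕ} {E E' : Ectx Prompt n} {m : ℕ} {s s' : Fin n → Val Prompt m},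
    (∀ i, ValSim (s i) (s' i)) → EctxSim E E' → EctxSim (E.subst s) (E'.subst s')
  | _, _, _, _, _, _, _, .hole => .hole
  | _, _, _, _, _, _, hs, .appL h₁ h₂ => .appL (h₁.subst hs) (h₂.subst hs)
  | _, _, _, _, _, _, hs, .appR h₁ h₂ => .appR (h₁.subst hs) (h₂.subst hs)
  | _, _, _, _, _, _, hs, .reset p h => .reset p (h.subst hs)

end

theorem ExpSim.inst {n : ℕ} {e e' : Exp Prompt (n + 1)} {v v' : Val Prompt n} (he : ExpSim e e')
    (hv : ValSim v v') : ExpSim (e.inst v) (e'.inst v') :=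
  he.subst fun i => by
    cases i using Fin.cases with
    | zero => exact hv
    | succ i => exact .var i

theorem EctxSim.plug {n : ℕ} {E E' : Ectx Prompt n} {e e' : Exp Prompt n} (hE : EctxSim E E')
    (he : ExpSim e e') : ExpSim (E.plug e) (E'.plug e') := by
  match E, E', hE with
  | _, _, .hole => exact he
  | _, _, .appL h₁ h₂ => exact .app (h₁.plug he) h₂
  | _, _, .appR h₁ h₂ => exact .appHead h₁ (h₂.plug he)
  | _, _, .reset p h => exact .reset (.of (.const p)) (h.plug he)

theorem EctxSim.surrounding_eq {n : ℕ} {E E' : Ectx Prompt n} (hE : EctxSim E E') :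
    E.surrounding = E'.surrounding := by
  match E, E', hE with
  | _, _, .hole => rfl
  | _, _, .appL h _ => exact h.surrounding_eq
  | _, _, .appR _ h => exact h.surrounding_eq
  | _, _, .reset p h => simp [Ectx.surrounding, h.surrounding_eq]

theorem EctxSim.of_comp {n : ℕ} {E₁ E₂ E' : Ectx Prompt n} (h : EctxSim (E₁.comp E₂) E') :
    ∃ E₁' E₂', E' = E₁'.comp E₂' ∧ EctxSim E₁ E₁' ∧ EctxSim E₂ E₂' := by
  match E₁ with
  | .hole => exact ⟨.hole, E', rfl, .hole, h⟩
  | .appL E₁ e =>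
    cases h with
    | appL h he =>
      obtain ⟨E₁', E₂', rfl, h₁, h₂⟩ := h.of_comp
      exact ⟨.appL E₁' _, E₂', rfl, .appL h₁ he, h₂⟩
  | .appR v E₁ =>
    cases h with
    | appR hv h =>
      obtain ⟨E₁', E₂', rfl, h₁, h₂⟩ := h.of_comp
      exact ⟨.appR _ E₁', E₂', rfl, .appR hv h₁, h₂⟩
  | .reset p E₁ =>
    cases h with
    | reset _ h =>
      obtain ⟨E₁', E₂', rfl, h₁, h₂⟩ := h.of_comp
      exact ⟨.reset p E₁', E₂', rfl, .reset p h₁, h₂⟩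

theorem ExpSim.val_inv {n : ℕ} {v : Val Prompt n} {e' : Exp Prompt n} (h : ExpSim (.val v) e')
    (E₀ : Ectx Prompt n) :
    ∃ v', ValSim v v' ∧ RedStar (E₀.plug e') (E₀.plug (.val v')) := by
  cases h with
  | val h => exact ⟨_, h, .refl⟩
  | reify h => exact ⟨_, .cont h, Ectx.reify_redStar _ _⟩

theorem ExpSim.plug_inv {n : ℕ} {r : Exp Prompt n} (hr : IsActive r) {E : Ectx Prompt n}
    {e' : Exp Prompt n} (h : ExpSim (E.plug r) e') (E₀ : Ectx Prompt n) :
    ∃ E' r', EctxSim E E' ∧ ExpSim r r' ∧ RedStar (E₀.plug e') (E₀.plug (E'.plug r')) := by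
  match E with
  | .hole => exact ⟨.hole, e', .hole, h, .refl⟩
  | .appL E e =>
    simp only [Ectx.plug] at h
    generalize ht : E.plug r = t at h
    cases h with
    | app h₁ h₂ =>
      subst ht
      obtain ⟨E', r', hE, hr', hs⟩ := h₁.plug_inv hr (E₀.comp (.appL .hole _))
      simp only [Ectx.comp_plug, Ectx.plug] at hs
      exact ⟨.appL E' _, r', .appL hE h₂, hr', hs⟩
    | appHead => exact absurd ht (hr.plug_ne_val _ _)
  | .appR v E =>
    cases h with
    | app h₁ h₂ =>
      obtain ⟨v', hv, hs₁⟩ := h₁.val_inv (E₀.comp (.appL .hole _))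
      obtain ⟨E', r', hE, hr', hs₂⟩ := h₂.plug_inv hr (E₀.comp (.appR v' .hole))
      simp only [Ectx.comp_plug, Ectx.plug] at hs₁ hs₂
      exact ⟨.appR v' E', r', .appR (.of hv) hE, hr', hs₁.trans hs₂⟩
    | appHead h₁ h₂ =>
      obtain ⟨E', r', hE, hr', hs⟩ := h₂.plug_inv hr (E₀.comp (.appR _ .hole))
      simp only [Ectx.comp_plug, Ectx.plug] at hs
      exact ⟨.appR _ E', r', .appR h₁ hE, hr', hs⟩
  | .reset p E =>
    cases h with
    | reset h₁ h₂ =>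
      obtain h₁ | _ := h₁
      cases h₁
      obtain ⟨E', r', hE, hr', hs⟩ := h₂.plug_inv hr (E₀.comp (.reset p .hole))
      simp only [Ectx.comp_plug, Ectx.plug] at hs
      exact ⟨.reset p E', r', .reset p hE, hr', hs⟩

/-- The relation `ExpSim` on active expressions of the same form. -/
inductive ActiveSim {n : ℕ} : Exp Prompt n → Exp Prompt n → Prop
  | app {v v' w w' : Val Prompt n} : HeadSim v v' → ValSim w w' →
      ActiveSim (.app (.val v) (.val w)) (.app (.val v') (.val w'))
  | fresh {e e' : Exp Prompt (n + 1)} : ExpSim e e' → ActiveSim (.fresh e) (.fresh e')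
  | resetVal {v v' w w' : Val Prompt n} : HeadSim v v' → ValSim w w' →
      ActiveSim (.reset v (.val w)) (.reset v' (.val w'))
  | resetBad {v v' : Val Prompt n} (e e' : Exp Prompt n) : (∀ p, v ≠ .const p) →
      (∀ p, v' ≠ .const p) → ActiveSim (.reset v e) (.reset v' e')
  | grab {v v' : Val Prompt n} {e e' : Exp Prompt (n + 1)} : HeadSim v v' → ExpSim e e' →
      ActiveSim (.grab v e) (.grab v' e')
  | push {v v' : Val Prompt n} {e e' : Exp Prompt n} : ValSim v v' → ExpSim e e' →
      ActiveSim (.push v e) (.push v' e')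
  | pushCont {E E' : Ectx Prompt n} {e e' : Exp Prompt n} : EctxSim E E' → ExpSim e e' →
      ActiveSim (.push (.cont E) e) (.push (.cont .hole) (E'.plug e'))

theorem ActiveSim.isActive_right {n : ℕ} {r r' : Exp Prompt n} (h : ActiveSim r r') :
    IsActive r' := by
  cases h with
  | resetBad e e' _ h => exact .resetBad _ _ fun p hp => absurd hp (h p)
  | _ => constructor

theorem HeadSim.ne_const {n : ℕ} {v v' : Val Prompt n} (h : HeadSim v v')
    (hv : ∀ p, v ≠ .const p) (p : Prompt) : v' ≠ .const p := by
  obtain h | _ := h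
  · cases h with
    | const q => exact absurd rfl (hv q)
    | _ => simp
  · simp

theorem ExpSim.active_inv {n : ℕ} {r e' : Exp Prompt n} (hr : IsActive r) (h : ExpSim r e')
    (E₀ : Ectx Prompt n) :
    ∃ r', ActiveSim r r' ∧ RedStar (E₀.plug e') (E₀.plug r') := by
  cases hr with
  | app v w =>
    cases h with
    | app h₁ h₂ =>
      obtain ⟨v', hv, hs₁⟩ := h₁.val_inv (E₀.comp (.appL .hole _))
      obtain ⟨w', hw, hs₂⟩ := h₂.val_inv (E₀.comp (.appR v' .hole))
      simp only [Ectx.comp_plug, Ectx.plug] at hs₁ hs₂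
      exact ⟨_, .app (.of hv) hw, hs₁.trans hs₂⟩
    | appHead h₁ h₂ =>
      obtain ⟨w', hw, hs₂⟩ := h₂.val_inv (E₀.comp (.appR _ .hole))
      simp only [Ectx.comp_plug, Ectx.plug] at hs₂
      exact ⟨_, .app h₁ hw, hs₂⟩
  | fresh e =>
    cases h with
    | fresh h => exact ⟨_, .fresh h, .refl⟩
  | resetVal v w =>
    cases h with
    | @reset _ _ v' _ _ h₁ h₂ =>
      by_cases hv : ∃ p, v = .const p
      · obtain ⟨p, rfl⟩ := hv
        obtain h₁ | _ := h₁
        cases h₁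
        obtain ⟨w', hw, hs₂⟩ := h₂.val_inv (E₀.comp (.reset p .hole))
        simp only [Ectx.comp_plug, Ectx.plug] at hs₂
        exact ⟨_, .resetVal (.of (.const p)) hw, hs₂⟩
      · push Not at hv
        exact ⟨_, .resetBad _ _ hv (h₁.ne_const hv), .refl⟩
  | resetBad v e hv =>
    cases h with
    | reset h₁ h₂ =>
      have hv : ∀ p, v ≠ .const p := fun p hp => hv p hp trivial
      exact ⟨_, .resetBad _ _ hv (h₁.ne_const hv), .refl⟩
  | grab v e =>
    cases h with
    | grab h₁ h₂ => exact ⟨_, .grab h₁ h₂, .refl⟩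
  | push v e =>
    cases h with
    | push h₁ h₂ => exact ⟨_, .push h₁ h₂, .refl⟩
    | pushCont h₁ h₂ => exact ⟨_, .pushCont h₁ h₂, .refl⟩

/-- Related active expressions in related contexts either both reduce, to related expressions, or
neither does. -/
theorem ActiveSim.fire {n : ℕ} {E E' : Ectx Prompt n} {r r' : Exp Prompt n} (h : ActiveSim r r')
    (hE : EctxSim E E') :
    (∃ u u', Fire E r u ∧ Fire E' r' u' ∧ ExpSim u u') ∨
    ((∀ u, ¬ Fire E r u) ∧ (∀ u, ¬ Fire E' r' u) ∧
      (IsStuck (E.plug r) → IsStuck (E'.plug r')) ∧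
      (IsStuck (E'.plug r') → IsStuck (E.plug r))) := by
  have neither : ∀ {r r' : Exp Prompt n}, IsActive r → IsActive r' → (∀ u, ¬ Fire E r u) →
      (∀ u, ¬ Fire E' r' u) → (∀ v e, r ≠ .grab v e) → (∀ v e, r' ≠ .grab v e) →
      (∃ u u', Fire E r u ∧ Fire E' r' u' ∧ ExpSim u u') ∨
      ((∀ u, ¬ Fire E r u) ∧ (∀ u, ¬ Fire E' r' u) ∧
        (IsStuck (E.plug r) → IsStuck (E'.plug r')) ∧
        (IsStuck (E'.plug r') → IsStuck (E.plug r))) := by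
    intro r r' hr hr' h₁ h₂ h₃ h₄
    rw [isStuck_plug_iff hr, isStuck_plug_iff hr']
    exact .inr ⟨h₁, h₂, fun ⟨p, e, _, he⟩ => absurd he (h₃ _ _),
      fun ⟨p, e, _, he⟩ => absurd he (h₄ _ _)⟩
  cases h with
  | app hv hw =>
    obtain hv | _ := hv
    · cases hv with
      | lam h => exact .inl ⟨_, _, .beta _ _, .beta _ _, hE.plug (h.inst hw)⟩
      | _ => exact neither (.app _ _) (.app _ _) nofun nofun nofun nofun
    · exact neither (.app _ _) (.app _ _) nofun nofun nofun nofun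
  | @fresh e e' h =>
    obtain ⟨p, hp⟩ := exists_fresh_prompt
      ((e.prompts_finite.union E.prompts_finite).union
        (e'.prompts_finite.union E'.prompts_finite))
    simp only [Set.mem_union, not_or] at hp
    exact .inl ⟨_, _, .fresh p _ hp.1.1 hp.1.2, .fresh p _ hp.2.1 hp.2.2,
      hE.plug (h.inst (.const p))⟩
  | resetVal hv hw =>
    obtain hv | _ := hv
    · cases hv with
      | const p => exact .inl ⟨_, _, .reset _ _, .reset _ _, hE.plug (.val hw)⟩
      | _ => exact neither (.resetVal _ _) (.resetVal _ _) nofun nofun nofun nofun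
    · exact neither (.resetVal _ _) (.resetVal _ _) nofun nofun nofun nofun
  | resetBad e e' hv hv' =>
    refine neither (.resetBad _ _ fun p hp => absurd hp (hv p))
      (.resetBad _ _ fun p hp => absurd hp (hv' p)) ?_ ?_ nofun nofun
    · intro u hu
      cases hu
      exact hv _ rfl
    · intro u hu
      cases hu
      exact hv' _ rfl
  | @grab _ _ e e' hv he =>
    have bad : ∀ {E : Ectx Prompt n} {v : Val Prompt n} {e : Exp Prompt (n + 1)},
        (∀ p, v ≠ .const p) → ¬ IsStuck (E.plug (.grab v e)) := by
      intro E v e hv h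
      obtain ⟨p, e', -, h⟩ := (isStuck_plug_iff (.grab _ _)).1 h
      simp only [Exp.grab.injEq] at h
      exact hv p h.1
    obtain hv | _ := hv
    · cases hv with
      | const p =>
        by_cases hp : p ∈ E.surrounding
        · obtain ⟨E₁, E₂, rfl, hp'⟩ := E.exists_innermost p hp
          obtain ⟨E₁', E₂', rfl, h₁, h₂⟩ := hE.of_comp
          cases h₂ with
          | reset _ h₂ =>
            exact .inl ⟨_, _, .grab p _ _ _ rfl hp',
              .grab p _ _ _ rfl (h₂.surrounding_eq ▸ hp'), h₁.plug (he.inst (.cont h₂))⟩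
        · have hs : IsStuck (E.plug (.grab (.const p) e)) := ⟨E, p, e, hp, rfl⟩
          have hs' : IsStuck (E'.plug (.grab (.const p) e')) :=
            ⟨E', p, e', hE.surrounding_eq ▸ hp, rfl⟩
          exact .inr ⟨fun u hu => hs.normalForm u hu.red, fun u hu => hs'.normalForm u hu.red,
            fun _ => hs', fun _ => hs⟩
      | _ => exact .inr ⟨nofun, nofun, fun h => absurd h (bad (by simp)),
          fun h => absurd h (bad (by simp))⟩
    · exact .inr ⟨nofun, nofun, fun h => absurd h (bad (by simp)),
          fun h => absurd h (bad (by simp))⟩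
  | push hv he =>
    cases hv with
    | cont h => exact .inl ⟨_, _, .push _ _, .push _ _, hE.plug (h.plug he)⟩
    | _ => exact neither (.push _ _) (.push _ _) nofun nofun nofun nofun
  | pushCont h he => exact .inl ⟨_, _, .push _ _, .push _ _, hE.plug (h.plug he)⟩

theorem conv_iff_of_normalForm {O : Exp Prompt 0 → Prop} {e : Exp Prompt 0}
    (he : NormalForm e) : Conv O e ↔ O e := by
  constructor
  · rintro ⟨k | k, h⟩
    · exact h
    · exact absurd h.choose_spec.1 (he _)
  · exact fun h => ⟨0, h⟩

theorem ConvIn.of_redStar {O : Exp Prompt 0 → Prop} (hO : Outcome O) {k : ℕ}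
    {e e' : Exp Prompt 0} (h : ConvIn O k e) (hr : RedStar e e') : ∃ j ≤ k, ConvIn O j e' := by
  induction hr with
  | refl => exact ⟨k, le_rfl, h⟩
  | tail _ hr ih =>
    obtain ⟨j, hj, hj'⟩ := ih
    obtain ⟨i, rfl, hi⟩ := hj'.of_red hO hr
    exact ⟨i, by omega, hi⟩

/-- Related expressions are both values, or both non-values that do not reduce, or both reduce to
related expressions, up to some preliminary steps of the second. -/
theorem ExpSim.step {O : Exp Prompt 0 → Prop} (hO : Outcome O) {e e' : Exp Prompt 0}
    (h : ExpSim e e') : ∃ e'', RedStar e' e'' ∧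
      ((∃ u u', Red e u ∧ Red e'' u' ∧ ExpSim u u') ∨ (Conv O e ↔ Conv O e'')) := by
  rcases e.exists_decomposition (fun _ => True) with ⟨v, rfl⟩ | ⟨E, r, -, hr, rfl⟩
  · obtain ⟨v', -, hs⟩ := h.val_inv .hole
    refine ⟨.val v', hs, .inr ?_⟩
    rw [conv_iff_of_normalForm (IsValue.normalForm ⟨v, rfl⟩),
      conv_iff_of_normalForm (IsValue.normalForm ⟨v', rfl⟩)]
    exact ⟨hO.of_isValue ⟨v, rfl⟩ ⟨v', rfl⟩, hO.of_isValue ⟨v', rfl⟩ ⟨v, rfl⟩⟩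
  · obtain ⟨E', r', hE, h', hs⟩ := h.plug_inv hr .hole
    obtain ⟨r'', hr', hs'⟩ := h'.active_inv hr E'
    refine ⟨_, hs.trans hs', ?_⟩
    rcases hr'.fire hE with ⟨u, u', hu, hu', h⟩ | ⟨h₁, h₂, h₃, h₄⟩
    · exact .inl ⟨u, u', hu.red, hu'.red, h⟩
    · right
      have ha := hr'.isActive_right
      rw [conv_iff_of_normalForm fun u hu => h₁ u ((IsActive.red_iff_fire hr).1 hu),
        conv_iff_of_normalForm fun u hu => h₂ u (ha.red_iff_fire.1 hu)]
      constructor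
      · intro h
        have hs := (hO.isValue_or_isStuck h).resolve_left
          fun ⟨v, hv⟩ => IsActive.plug_ne_val hr _ _ hv
        exact hO.of_isStuck hs (h₃ hs) h
      · intro h
        have hs := (hO.isValue_or_isStuck h).resolve_left
          fun ⟨v, hv⟩ => ha.plug_ne_val _ _ hv
        exact hO.of_isStuck hs (h₄ hs) h

theorem ExpSim.conv_iff {O : Exp Prompt 0 → Prop} (hO : Outcome O) {e e' : Exp Prompt 0}
    (h : ExpSim e e') : Conv O e ↔ Conv O e' := by
  constructor
  · rintro ⟨k, hk⟩
    induction k using Nat.strong_induction_on generalizing e e' with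
    | _ k ih =>
    obtain ⟨e'', hs, ⟨u, u', hu, hu', h'⟩ | h'⟩ := h.step hO
    · obtain ⟨j, rfl, hj⟩ := hk.of_red hO hu
      rw [conv_iff_of_redStar hO hs, conv_iff_of_red hO hu']
      exact ih j (by omega) h' hj
    · rw [conv_iff_of_redStar hO hs, ← h']
      exact ⟨k, hk⟩
  · rintro ⟨k, hk⟩
    induction k using Nat.strong_induction_on generalizing e e' with
    | _ k ih =>
    obtain ⟨e'', hs, ⟨u, u', hu, hu', h'⟩ | h'⟩ := h.step hO
    · obtain ⟨i, hi, hi'⟩ := hk.of_redStar hO hs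
      obtain ⟨j, rfl, hj⟩ := hi'.of_red hO hu'
      rw [conv_iff_of_red hO hu]
      exact ih j (by omega) h' hj
    · rw [h', ← conv_iff_of_redStar hO hs]
      exact ⟨k, hk⟩

/-! ### Abstraction of a hole -/

/-- The hole `k` becomes the last variable; the other variables keep their indices. -/
def Hole.abstr (k n : ℕ) (a : Hole) : Val Hole (n + 1) :=
  if a.idx = k then .var (Fin.last n) else .const a

mutual

/-- The hole `k` of a multi-hole context is replaced by a new variable, the last one. A delimiter of
an evaluation context cannot be a variable, so `⌜E⌝` in expression position becomes an expression
that builds the continuation, `push ⌜E⌝ e` is carried out up to one step, and the continuations in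
the remaining positions, which can only cause errors, become `⌜□⌝`. -/
def Exp.abstr (k : ℕ) : {n : ℕ} → Exp Hole n → Exp Hole (n + 1)
  | _, .val (.cont E) =>
    .fresh (.reset (.var 0) (E.abstrPlug k Fin.succ (.grab (.var 0) (.val (.var 0)))))
  | _, .val (.var x) => .val (.var x.castSucc)
  | _, .val (.lam e) => .val (.lam (e.abstr k))
  | n, .val (.const a) => .val (a.abstr k n)
  | _, .app e₁ e₂ => .app (e₁.abstr k) (e₂.abstr k)
  | _, .fresh e => .fresh (e.abstr k)
  | _, .reset v e => .reset (v.abstr k) (e.abstr k)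
  | _, .grab v e => .grab (v.abstr k) (e.abstr k)
  | _, .push (.cont E) e => .push (.cont .hole) (E.abstrPlug k id (e.abstr k))
  | _, .push (.var x) e => .push (.var x.castSucc) (e.abstr k)
  | _, .push (.lam e') e => .push (.lam (e'.abstr k)) (e.abstr k)
  | n, .push (.const a) e => .push (a.abstr k n) (e.abstr k)

/-- Abstraction of the hole `k` in a value whose evaluation context, if it is a continuation, does
not matter. -/
def Val.abstr (k : ℕ) : {n : ℕ} → Val Hole n → Val Hole (n + 1)
  | _, .var x => .var x.castSucc
  | _, .lam e => .lam (e.abstr k)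
  | n, .const a => a.abstr k n
  | _, .cont _ => .cont .hole

/-- Abstraction of the hole `k` in the evaluation context of `E[e]`; the result is an expression,
with `E` renamed along `r` to the scope of `e`. -/
def Ectx.abstrPlug (k : ℕ) : {n : ℕ} → Ectx Hole n → {m : ℕ} → (Fin (n + 1) → Fin m) →
    Exp Hole m → Exp Hole m
  | _, .hole, _, _, e => e
  | _, .appL E e', _, r, e => .app (E.abstrPlug k r e) ((e'.abstr k).rename r)
  | _, .appR v E, _, r, e => .app (.val ((v.abstr k).rename r)) (E.abstrPlug k r e)
  | n, .reset a E, _, r, e => .reset ((a.abstr k n).rename r) (E.abstrPlug k r e)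

end

theorem Hole.abstr_valid {Γ : List (Val Prompt 0)} {v : Val Prompt 0} {a : Hole}
    (h : a.idx < (Γ ++ [v]).length) (n : ℕ) : (a.abstr Γ.length n).Valid Γ := by
  rw [Hole.abstr]
  split
  · trivial
  · show a.idx < Γ.length
    simp at h
    omega

mutual

theorem Exp.Valid.abstr {Γ : List (Val Prompt 0)} {v : Val Prompt 0} : ∀ {n : ℕ} {e : Exp Hole n},
    e.Valid (Γ ++ [v]) → (e.abstr Γ.length).Valid Γ
  | _, .val (.cont E), h => by
    simpa only [Exp.abstr, Exp.Valid, Val.Valid, true_and] using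
      Ectx.Valid.abstrPlug (E := E) (e := .grab (.var 0) (.val (.var 0))) h
        (by simp [Exp.Valid, Val.Valid])
  | _, .val (.var _), _ => by simp [Exp.abstr, Exp.Valid, Val.Valid]
  | _, .val (.lam e), h => by
    simpa only [Exp.abstr, Exp.Valid, Val.Valid] using Exp.Valid.abstr (e := e) h
  | _, .val (.const a), h => by
    simpa only [Exp.abstr, Exp.Valid] using Hole.abstr_valid h _
  | _, .app e₁ e₂, h => by
    simpa only [Exp.abstr, Exp.Valid] using And.intro h.1.abstr h.2.abstr
  | _, .fresh e, h => by
    simpa only [Exp.abstr, Exp.Valid] using Exp.Valid.abstr (e := e) h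
  | _, .reset v e, h => by
    simpa only [Exp.abstr, Exp.Valid] using And.intro h.1.abstr h.2.abstr
  | _, .grab v e, h => by
    simpa only [Exp.abstr, Exp.Valid] using And.intro h.1.abstr h.2.abstr
  | _, .push (.cont E) e, h => by
    simpa only [Exp.abstr, Exp.Valid, Val.Valid, Ectx.Valid, true_and] using
      Ectx.Valid.abstrPlug (E := E) h.1 h.2.abstr
  | _, .push (.var _) e, h => by
    simpa only [Exp.abstr, Exp.Valid, Val.Valid, true_and] using h.2.abstr
  | _, .push (.lam e') e, h => by
    simpa only [Exp.abstr, Exp.Valid, Val.Valid] using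
      And.intro (Exp.Valid.abstr (e := e') h.1) h.2.abstr
  | _, .push (.const a) e, h => by
    simpa only [Exp.abstr, Exp.Valid] using And.intro (Hole.abstr_valid h.1 _) h.2.abstr

theorem Val.Valid.abstr {Γ : List (Val Prompt 0)} {v : Val Prompt 0} : ∀ {n : ℕ} {w : Val Hole n},
    w.Valid (Γ ++ [v]) → (w.abstr Γ.length).Valid Γ
  | _, .var _, _ => by simp [Val.abstr, Val.Valid]
  | _, .lam e, h => by
    simpa only [Val.abstr, Val.Valid] using Exp.Valid.abstr (e := e) h
  | _, .const a, h => by simpa only [Val.abstr] using Hole.abstr_valid h _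
  | _, .cont _, _ => by simp [Val.abstr, Val.Valid, Ectx.Valid]

theorem Ectx.Valid.abstrPlug {Γ : List (Val Prompt 0)} {v : Val Prompt 0} : ∀ {n : ℕ}
    {E : Ectx Hole n} {m : ℕ} {r : Fin (n + 1) → Fin m} {e : Exp Hole m},
    E.Valid (Γ ++ [v]) → e.Valid Γ → (E.abstrPlug Γ.length r e).Valid Γ
  | _, .hole, _, _, _, _, h => by simpa only [Ectx.abstrPlug] using h
  | _, .appL E e', _, _, _, hE, h => by
    simpa only [Ectx.abstrPlug, Exp.Valid] using And.intro (hE.1.abstrPlug h) hE.2.abstr.rename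
  | _, .appR w E, _, _, _, hE, h => by
    simpa only [Ectx.abstrPlug, Exp.Valid] using And.intro hE.1.abstr.rename (hE.2.abstrPlug h)
  | _, .reset a E, _, _, _, hE, h => by
    simpa only [Ectx.abstrPlug, Exp.Valid] using
      And.intro (Hole.abstr_valid (lt_of_getElem? hE.1.choose_spec) _).rename (hE.2.abstrPlug h)

end

/-- The substitution of a closed value for the last variable. -/
def lastSub (v : Val Prompt 0) (n : ℕ) : Fin (n + 1) → Val Prompt n :=
  Fin.lastCases (v.weaken n) .var

theorem lastSub_last (v : Val Prompt 0) (n : ℕ) : lastSub v n (Fin.last n) = v.weaken n := by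
  simp [lastSub]

theorem lastSub_castSucc (v : Val Prompt 0) {n : ℕ} (i : Fin n) :
    lastSub v n i.castSucc = .var i := by
  simp [lastSub]

theorem liftSub_lastSub (v : Val Prompt 0) (n : ℕ) :
    liftSub (lastSub v n) = lastSub v (n + 1) := by
  funext i
  cases i using Fin.lastCases with
  | last =>
    rw [lastSub_last, ← Fin.succ_last]
    show (lastSub v n (Fin.last n)).rename Fin.succ = _
    rw [lastSub_last, Val.weaken_rename]
  | cast i =>
    rw [lastSub_castSucc]
    cases i using Fin.cases with
    | zero => rfl
    | succ i =>
      rw [← Fin.succ_castSucc]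
      simp [liftSub, lastSub_castSucc, Val.rename]

theorem Hole.abstr_fill {Γ : List (Val Prompt 0)} {v : Val Prompt 0} {a : Hole}
    (h : a.idx < (Γ ++ [v]).length) (n : ℕ) :
    ((a.abstr Γ.length n).fill Γ).subst (lastSub v n) = (look (Γ ++ [v]) a).weaken n := by
  rw [Hole.abstr]
  split
  · next ha =>
    obtain ⟨i⟩ := a
    subst ha
    rw [look_append_length]
    exact lastSub_last v n
  · next ha =>
    have h' : a.idx < Γ.length := by
      simp at h
      omega
    simp [Val.fill, Val.weaken_subst, look_append _ h']

mutual

/-- Substituting the element number `k` for the abstracted hole `k` restores the filled context, up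
to the continuations that have to be rebuilt. -/
theorem Exp.abstr_sim {Γ : List (Val Prompt 0)} {v : Val Prompt 0} : ∀ {n : ℕ} {e : Exp Hole n},
    e.Valid (Γ ++ [v]) →
    ExpSim (e.fill (Γ ++ [v])) (((e.abstr Γ.length).fill Γ).subst (lastSub v n))
  | n, .val (.cont E), h => by
    obtain ⟨E', hE, hE'⟩ := Ectx.abstr_sim (E := E) h
    have := hE' Fin.succ (liftSub (lastSub v n)) Fin.succ (fun _ => rfl)
      (.grab (.var 0) (.val (.var 0)))
    simp only [Exp.abstr, Exp.fill, Val.fill, Exp.subst, this]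
    exact .reify hE
  | _, .val (.var x), _ => by
    simp only [Exp.abstr, Exp.fill, Val.fill, Exp.subst, Val.subst, lastSub_castSucc]
    exact .refl _
  | _, .val (.lam e), h => by
    simp only [Exp.abstr, Exp.fill, Val.fill, Exp.subst, Val.subst, liftSub_lastSub]
    exact .val (.lam (Exp.abstr_sim (e := e) h))
  | _, .val (.const a), h => by
    simp only [Exp.abstr, Exp.fill, Exp.subst, Hole.abstr_fill h]
    exact .refl _
  | _, .app e₁ e₂, h => by
    simp only [Exp.abstr, Exp.fill, Exp.subst]
    exact .app (Exp.abstr_sim h.1) (Exp.abstr_sim h.2)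
  | _, .fresh e, h => by
    simp only [Exp.abstr, Exp.fill, Exp.subst, liftSub_lastSub]
    exact .fresh (Exp.abstr_sim (e := e) h)
  | _, .reset w e, h => by
    simp only [Exp.abstr, Exp.fill, Exp.subst]
    exact .reset (Val.abstr_sim h.1) (Exp.abstr_sim h.2)
  | _, .grab w e, h => by
    simp only [Exp.abstr, Exp.fill, Exp.subst, liftSub_lastSub]
    exact .grab (Val.abstr_sim h.1) (Exp.abstr_sim h.2)
  | n, .push (.cont E) e, h => by
    obtain ⟨E', hE, hE'⟩ := Ectx.abstr_sim (E := E) h.1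
    have := hE' id (lastSub v n) (fun i => i) (fun _ => (Val.rename_id _).symm) (e.abstr Γ.length)
    simp only [Exp.abstr, Exp.fill, Val.fill, Ectx.fill, Exp.subst, Val.subst, Ectx.subst, this,
      Ectx.rename_id]
    exact .pushCont hE (Exp.abstr_sim h.2)
  | _, .push (.var x) e, h => by
    simp only [Exp.abstr, Exp.fill, Val.fill, Exp.subst, Val.subst, lastSub_castSucc]
    exact .push (.var x) (Exp.abstr_sim h.2)
  | _, .push (.lam e') e, h => by
    simp only [Exp.abstr, Exp.fill, Val.fill, Exp.subst, Val.subst, liftSub_lastSub]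
    exact .push (.lam (Exp.abstr_sim (e := e') h.1)) (Exp.abstr_sim h.2)
  | _, .push (.const a) e, h => by
    simp only [Exp.abstr, Exp.fill, Exp.subst, Hole.abstr_fill (a := a) h.1]
    exact .push (.refl _) (Exp.abstr_sim h.2)

theorem Val.abstr_sim {Γ : List (Val Prompt 0)} {v : Val Prompt 0} : ∀ {n : ℕ} {w : Val Hole n},
    w.Valid (Γ ++ [v]) →
    HeadSim (w.fill (Γ ++ [v])) (((w.abstr Γ.length).fill Γ).subst (lastSub v n))
  | _, .var x, _ => by
    simp only [Val.abstr, Val.fill, Val.subst, lastSub_castSucc]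
    exact .of (.refl _)
  | _, .lam e, h => by
    simp only [Val.abstr, Val.fill, Val.subst, liftSub_lastSub]
    exact .of (.lam (Exp.abstr_sim (e := e) h))
  | _, .const a, h => by
    simp only [Val.abstr, Hole.abstr_fill (a := a) h]
    exact .of (.refl _)
  | _, .cont E, _ => by
    simp only [Val.abstr, Val.fill, Val.subst]
    exact .cont _ _

/-- The abstracted context, filled and instantiated, is plugging into an actual evaluation context
`E'`, although its delimiters were variables. The renaming `r` moves the context to the scope of `e`,
where the substitution `s` acts on it as `lastSub` followed by the renaming `ρ`. -/
theorem Ectx.abstr_sim {Γ : List (Val Prompt 0)} {v : Val Prompt 0} : ∀ {n : ℕ} {E : Ectx Hole n},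
    E.Valid (Γ ++ [v]) →
    ∃ E', EctxSim (E.fill (Γ ++ [v])) E' ∧ ∀ {m l : ℕ} (r : Fin (n + 1) → Fin m)
      (s : Fin m → Val Prompt l) (ρ : Fin n → Fin l),
      (∀ i, s (r i) = (lastSub v n i).rename ρ) → ∀ e,
      ((E.abstrPlug Γ.length r e).fill Γ).subst s = (E'.rename ρ).plug ((e.fill Γ).subst s)
  | _, .hole, _ => ⟨.hole, .hole, fun r s ρ _ e => by simp [Ectx.abstrPlug, Ectx.rename, Ectx.plug]⟩
  | n, .appL E e', h => by
    obtain ⟨E', hE, hE'⟩ := Ectx.abstr_sim h.1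
    refine ⟨.appL E' _, .appL hE (Exp.abstr_sim h.2), fun r s ρ hs e => ?_⟩
    simp [Ectx.abstrPlug, Exp.fill, Exp.subst, hE' r s ρ hs, Exp.fill_rename, Exp.rename_subst,
      hs, Ectx.rename, Ectx.plug, Exp.subst_rename]
  | n, .appR w E, h => by
    obtain ⟨E', hE, hE'⟩ := Ectx.abstr_sim h.2
    refine ⟨.appR _ E', .appR (Val.abstr_sim h.1) hE, fun r s ρ hs e => ?_⟩
    simp [Ectx.abstrPlug, Exp.fill, Exp.subst, hE' r s ρ hs, Val.fill_rename, Val.rename_subst,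
      hs, Ectx.rename, Ectx.plug, Val.subst_rename]
  | n, .reset a E, h => by
    obtain ⟨E', hE, hE'⟩ := Ectx.abstr_sim h.2
    obtain ⟨p, hp⟩ := h.1
    have ha := Hole.abstr_fill (lt_of_getElem? hp) n
    simp only [look_of_getElem? hp] at ha
    refine ⟨.reset p E', ?_, fun r s ρ hs e => ?_⟩
    · simp only [Ectx.fill, look_of_getElem? hp, Val.toPrompt]
      exact .reset p hE
    · simp [Ectx.abstrPlug, Exp.fill, Exp.subst, hE' r s ρ hs, Val.fill_rename, Val.rename_subst,
        hs, Ectx.rename, Ectx.plug, ← Val.subst_rename, ha, Val.weaken, Val.rename]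

end

theorem Exp.abstr_conv_iff {O : Exp Prompt 0 → Prop} (hO : Outcome O) {Γ : List (Val Prompt 0)}
    {v : Val Prompt 0} {C : Exp Hole 0} (hC : C.Valid (Γ ++ [v])) :
    Conv O (C.fill (Γ ++ [v])) ↔ Conv O (((C.abstr Γ.length).fill Γ).inst v) := by
  have : (Fin.cases v (fun i => .var i) : Fin 1 → Val Prompt 0) = lastSub v 0 := by
    funext i
    obtain rfl : i = Fin.last 0 := Subsingleton.elim (α := Fin 1) _ _
    rw [lastSub_last, Val.weaken_zero]
    rfl
  rw [Exp.inst, this]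
  exact (Exp.abstr_sim hC).conv_iff hO

/-! ### Testing states and sequences of values -/

/-- Two states have the same outcomes in all evaluation contexts built over their sequences. -/
structure TestEq (s t : State) : Prop where
  length_eq : s.1.length = t.1.length
  isDelim_iff : ∀ a, IsDelim s.1 a ↔ IsDelim t.1 a
  conv_iff : ∀ {F : Ectx Hole 0}, F.Valid s.1 → ∀ {O}, Outcome O →
    (Conv O ((F.fill s.1).plug s.2) ↔ Conv O ((F.fill t.1).plug t.2))

/-- Two sequences of values yield expressions with the same outcomes in all multi-hole contexts. -/
structure SeqTestEq (Γ Δ : List (Val Prompt 0)) : Prop where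
  length_eq : Γ.length = Δ.length
  isDelim_iff : ∀ a, IsDelim Γ a ↔ IsDelim Δ a
  conv_iff : ∀ {C : Exp Hole 0}, C.Valid Γ → ∀ {O}, Outcome O →
    (Conv O (C.fill Γ) ↔ Conv O (C.fill Δ))

theorem TestEq.symm {s t : State} (h : TestEq s t) : TestEq t s where
  length_eq := h.length_eq.symm
  isDelim_iff a := (h.isDelim_iff a).symm
  conv_iff hF _ hO :=
    (h.conv_iff (hF.congr h.length_eq.ge fun a => (h.isDelim_iff a).2) hO).symm

theorem SeqTestEq.symm {Γ Δ : List (Val Prompt 0)} (h : SeqTestEq Γ Δ) : SeqTestEq Δ Γ where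
  length_eq := h.length_eq.symm
  isDelim_iff a := (h.isDelim_iff a).symm
  conv_iff hC _ hO :=
    (h.conv_iff (hC.congr h.length_eq.ge fun a => (h.isDelim_iff a).2) hO).symm

theorem TestEq.valid {s t : State} (h : TestEq s t) {F : Ectx Hole 0} (hF : F.Valid s.1) :
    F.Valid t.1 :=
  hF.congr h.length_eq.le fun a => (h.isDelim_iff a).1

theorem SeqTestEq.valid {Γ Δ : List (Val Prompt 0)} (h : SeqTestEq Γ Δ) {C : Exp Hole 0}
    (hC : C.Valid Γ) : C.Valid Δ :=
  hC.congr h.length_eq.le fun a => (h.isDelim_iff a).1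

theorem SeqTestEq.ectx_valid {Γ Δ : List (Val Prompt 0)} (h : SeqTestEq Γ Δ) {F : Ectx Hole 0}
    (hF : F.Valid Γ) : F.Valid Δ :=
  hF.congr h.length_eq.le fun a => (h.isDelim_iff a).1

theorem TestEq.of_weakTau {s : State} {Δ : List (Val Prompt 0)} {e e' : Exp Prompt 0}
    (h : TestEq s (Δ, e)) (ht : WeakTau (Δ, e) (Δ, e')) : TestEq s (Δ, e') where
  length_eq := h.length_eq
  isDelim_iff := h.isDelim_iff
  conv_iff hF _ hO := (h.conv_iff hF hO).trans
    (conv_iff_of_redStar hO (ht.redStar (h.valid hF)))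

theorem Conv.weakTau {O : Exp Prompt 0 → Prop} {e : Exp Prompt 0} (hO : Outcome O)
    (h : Conv O e) (Γ : List (Val Prompt 0)) : ∃ e', O e' ∧ WeakTau (Γ, e) (Γ, e') := by
  obtain ⟨k, hk⟩ := h
  induction k generalizing e with
  | zero => exact ⟨e, hk, .refl⟩
  | succ k ih =>
    have ⟨u, hu, _⟩ := hk
    obtain ⟨u', hu', hf⟩ := hu.exists_fresh_red (seqPrompts_finite Γ)
    obtain ⟨j, hj, hk'⟩ := hk.of_red hO hu'
    obtain rfl : k = j := by omega
    obtain ⟨e', he, h⟩ := ih hk'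
    exact ⟨e', he, .head (.tau Γ _ _ hu' hf) h⟩

/-- A state that passes the same tests as a state with outcome `O` reaches the outcome `O`, with
prompts that are fresh for the sequence. -/
theorem TestEq.reaches {O : Exp Prompt 0 → Prop} (hO : Outcome O) {Γ Δ : List (Val Prompt 0)}
    {e₁ e₂ : Exp Prompt 0} (h : TestEq (Γ, e₁) (Δ, e₂)) (he : O e₁) :
    ∃ e, O e ∧ WeakTau (Δ, e₂) (Δ, e) ∧ TestEq (Γ, e₁) (Δ, e) := by
  have h₂ : Conv O e₂ := (h.conv_iff (F := .hole) trivial hO).1 ⟨0, he⟩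
  obtain ⟨e, he, ht⟩ := h₂.weakTau hO Δ
  exact ⟨e, he, ht, h.of_weakTau ht⟩

theorem not_conv_isValue {E : Ectx Prompt 0} {r : Exp Prompt 0} (hr : IsActive r)
    (h : ∀ u, ¬ Fire E r u) : ¬ Conv IsValue (E.plug r) := by
  rw [conv_iff_of_normalForm fun u hu => h u (hr.red_iff_fire.1 hu)]
  rintro ⟨v, hv⟩
  exact hr.plug_ne_val _ _ hv

/-- Prompts are the values `v` for which `(λ z. reset z z) v` has a value. -/
theorem conv_reset_iff (v : Val Prompt 0) :
    Conv IsValue (.app (.val (.lam (.reset (.var 0) (.val (.var 0))))) (.val v)) ↔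
      ∃ p, v = .const p := by
  have h₁ : Red (.app (.val (.lam (.reset (.var 0) (.val (.var 0))))) (.val v))
    (.reset v (.val v)) := .beta _ v
  rw [conv_iff_of_red outcome_isValue h₁]
  constructor
  · intro h
    by_contra hv
    refine not_conv_isValue (E := .hole) (.resetVal v v) (fun u hu => ?_) h
    generalize hw : v = w at hu
    cases hu with
    | reset p => exact hv ⟨p, hw⟩
  · rintro ⟨p, rfl⟩
    exact ⟨1, _, .reset p _, _, rfl⟩

/-- Continuations are the values `v` for which `new x. reset x (push v (grab x k. λ z. z))` has a
value. -/
theorem conv_push_iff (v : Val Prompt 0) :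
    Conv IsValue (.fresh (.reset (.var 0) (.push (v.weaken 1)
      (.grab (.var 0) (.val (.lam (.val (.var 0)))))))) ↔ ∃ E, v = .cont E := by
  obtain ⟨q, hq⟩ := exists_fresh_prompt v.prompts_finite
  have h₁ := (Fire.fresh (E := .hole) q (.reset (.var 0) (.push (v.weaken 1)
      (.grab (.var 0) (.val (.lam (.val (.var 0))))))) (by
        simpa [Exp.prompts, Val.prompts, Val.weaken, Val.rename_prompts] using hq)
      (by simp [Ectx.prompts])).red
  have h₂ : (Exp.reset (.var 0) (.push (v.weaken 1)
      (.grab (.var 0) (.val (.lam (.val (.var 0))))))).inst (.const q) =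
      .reset (.const q) (.push v (.grab (.const q) (.val (.lam (.val (.var 0)))))) := by
    simp [Exp.inst, Exp.subst, Val.subst, Val.weaken_subst, Val.weaken_zero, liftSub]
  rw [h₂] at h₁
  simp only [Ectx.plug] at h₁
  rw [conv_iff_of_red outcome_isValue h₁]
  constructor
  · intro h
    by_contra hv
    refine not_conv_isValue (E := .reset q .hole) (.push v _) (fun u hu => ?_) h
    generalize hw : v = w at hu
    cases hu with
    | push E => exact hv ⟨E, hw⟩
  · rintro ⟨E, rfl⟩
    have hs : q ∉ E.surrounding := fun h => hq (E.surrounding_subset_prompts h)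
    have h₃ := (Fire.push (E := .reset q .hole) E
      (.grab (.const q) (.val (.lam (.val (.var 0)))))).red
    have h₄ := (Fire.grab (E := .reset q E) q .hole E (.val (.lam (.val (.var 0)))) rfl hs).red
    exact ⟨2, _, h₃, _, h₄, _, rfl⟩

theorem getElem?_append_length (Γ : List (Val Prompt 0)) (v : Val Prompt 0) :
    (Γ ++ [v])[Γ.length]? = some v := by
  simp

/-- Tests of a value in evaluation contexts amount to tests of the sequence extended by it. -/
theorem TestEq.seqTestEq {Γ Δ : List (Val Prompt 0)} {v w : Val Prompt 0}
    (h : TestEq (Γ, .val v) (Δ, .val w)) : SeqTestEq (Γ ++ [v]) (Δ ++ [w]) := by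
  have hl : Γ.length = Δ.length := h.length_eq
  have hvw : (∃ p, v = .const p) ↔ ∃ q, w = .const q := by
    have := h.conv_iff (F := .appR (.lam (.reset (.var 0) (.val (.var 0)))) .hole)
      (by simp [Ectx.Valid, Val.Valid, Exp.Valid]) outcome_isValue
    simp only [Ectx.fill, Ectx.plug, Val.fill, Exp.fill] at this
    rwa [conv_reset_iff, conv_reset_iff] at this
  have hd : ∀ a, IsDelim (Γ ++ [v]) a ↔ IsDelim (Δ ++ [w]) a := by
    rintro ⟨i⟩
    rcases lt_trichotomy i Γ.length with hi | rfl | hi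
    · have := h.isDelim_iff ⟨i⟩
      simpa only [IsDelim, List.getElem?_append_left hi,
        List.getElem?_append_left (hi.trans_eq hl)] using this
    · unfold IsDelim
      simp only [getElem?_append_length]
      rw [hl, getElem?_append_length]
      simpa using hvw
    · have h₁ : (Γ ++ [v])[i]? = none := by simp; omega
      have h₂ : (Δ ++ [w])[i]? = none := by simp; omega
      simp [IsDelim, h₁, h₂]
  refine ⟨by simp [hl], hd, fun {C} hC O hO => ?_⟩
  have hC' : C.Valid (Δ ++ [w]) := hC.congr (by simp [hl]) fun a => (hd a).1
  have key : ∀ {Γ : List (Val Prompt 0)} {v : Val Prompt 0} {k : ℕ}, Conv O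
      (((Ectx.appR (.lam (C.abstr k)) .hole).fill Γ).plug (.val v)) ↔
      Conv O (((C.abstr k).fill Γ).inst v) := fun {Γ v k} =>
    conv_iff_of_red hO (.beta ((C.abstr k).fill Γ) v)
  have := h.conv_iff (F := .appR (.lam (C.abstr Γ.length)) .hole) ⟨hC.abstr, trivial⟩ hO
  rw [key, key] at this
  rw [Exp.abstr_conv_iff hO hC, Exp.abstr_conv_iff hO hC', this, hl]

theorem SeqTestEq.prompt {Γ Δ : List (Val Prompt 0)} (h : SeqTestEq Γ Δ) {i j : ℕ} {p : Prompt}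
    (hi : Γ[i]? = some (.const p)) (hj : Γ[j]? = some (.const p)) :
    ∃ q, Δ[i]? = some (.const q) ∧ Δ[j]? = some (.const q) := by
  obtain ⟨q, hq⟩ := (h.isDelim_iff ⟨i⟩).1 ⟨p, hi⟩
  obtain ⟨q', hq'⟩ := (h.isDelim_iff ⟨j⟩).1 ⟨p, hj⟩
  refine ⟨q, hq, ?_⟩
  suffices q = q' from this ▸ hq'
  -- `reset □ᵢ (grab □ⱼ k. λ z. z)` has a value if and only if the two prompts are equal.
  have ht := h.conv_iff (C := .reset (.const ⟨i⟩) (.grab (.const ⟨j⟩) (.val (.lam (.val (.var 0))))))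
    ⟨lt_of_getElem? hi, lt_of_getElem? hj, trivial⟩ outcome_isValue
  simp only [Exp.fill, Val.fill_const_zero, look_of_getElem? (a := ⟨i⟩) hi,
    look_of_getElem? (a := ⟨j⟩) hj, look_of_getElem? (a := ⟨i⟩) hq,
    look_of_getElem? (a := ⟨j⟩) hq'] at ht
  have h₁ := ht.1 ⟨1, _, .grab p .hole _ (by simp [Ectx.surrounding]), _, rfl⟩
  by_contra hne
  refine not_conv_isValue (E := .reset q .hole) (.grab (.const q') _) (fun u hu => ?_) h₁
  refine IsStuck.normalForm ⟨.reset q .hole, q', _, ?_, rfl⟩ u hu.red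
  simpa [Ectx.surrounding] using Ne.symm hne

theorem SeqTestEq.cont {Γ Δ : List (Val Prompt 0)} (h : SeqTestEq Γ Δ) {i : ℕ}
    {E : Ectx Prompt 0} (hi : Γ[i]? = some (.cont E)) : ∃ E', Δ[i]? = some (.cont E') := by
  have hlt := lt_of_getElem? hi
  have hi' := getElem?_of_lt (a := ⟨i⟩) (hlt.trans_eq h.length_eq)
  have ht : (∃ E, look Γ ⟨i⟩ = .cont E) ↔ ∃ E, look Δ ⟨i⟩ = .cont E := by
    rw [← conv_push_iff, ← conv_push_iff]
    exact h.conv_iff (C := .fresh (.reset (.var 0) (.push (.const ⟨i⟩)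
      (.grab (.var 0) (.val (.lam (.val (.var 0)))))))) ⟨trivial, hlt, trivial, trivial⟩
      outcome_isValue
  obtain ⟨E', hE'⟩ := ht.1 ⟨E, look_of_getElem? (a := ⟨i⟩) hi⟩
  exact ⟨E', hi'.trans (congrArg some hE')⟩

theorem SeqTestEq.lam {Γ Δ : List (Val Prompt 0)} (h : SeqTestEq Γ Δ) {i : ℕ}
    {e : Exp Prompt 1} (hi : Γ[i]? = some (.lam e)) : ∃ e', Δ[i]? = some (.lam e') := by
  have hi' := getElem?_of_lt (a := ⟨i⟩) ((lt_of_getElem? hi).trans_eq h.length_eq)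
  generalize look Δ ⟨i⟩ = w at hi'
  cases w with
  | var x => exact x.elim0
  | lam e' => exact ⟨e', hi'⟩
  | const p =>
    obtain ⟨q, hq, -⟩ := h.symm.prompt hi' hi'
    simp [hi] at hq
  | cont E =>
    obtain ⟨E', hE'⟩ := h.symm.cont hi'
    simp [hi] at hE'

/-- If two sequences pass the same tests, so do the states obtained by reducing the same context
filled with each of them. -/
theorem SeqTestEq.testEq {Γ Δ : List (Val Prompt 0)} (h : SeqTestEq Γ Δ) {C : Exp Hole 0}
    (hC : C.Valid Γ) {e₁ e₂ : Exp Prompt 0}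
    (h₁ : ∀ E : Ectx Prompt 0, E.prompts ⊆ seqPrompts Γ → Red (E.plug (C.fill Γ)) (E.plug e₁))
    (h₂ : ∀ E : Ectx Prompt 0, E.prompts ⊆ seqPrompts Δ → Red (E.plug (C.fill Δ)) (E.plug e₂)) :
    TestEq (Γ, e₁) (Δ, e₂) where
  length_eq := h.length_eq
  isDelim_iff := h.isDelim_iff
  conv_iff {F} hF O hO := by
    have hFΔ := h.ectx_valid hF
    have := h.conv_iff (hF.plug hC) hO
    rw [F.fill_plug _ _ hF, F.fill_plug _ _ hFΔ] at this
    rwa [conv_iff_of_red hO (h₁ _ (Ectx.fill_prompts_subset hF)),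
      conv_iff_of_red hO (h₂ _ (Ectx.fill_prompts_subset hFΔ))] at this

theorem SeqTestEq.beta {Γ Δ : List (Val Prompt 0)} (h : SeqTestEq Γ Δ) {i : ℕ}
    {e e' : Exp Prompt 1} (hi : Γ[i]? = some (.lam e)) (hi' : Δ[i]? = some (.lam e'))
    {V : Val Hole 0} (hV : V.Valid Γ) :
    TestEq (Γ, e.inst (V.fill Γ)) (Δ, e'.inst (V.fill Δ)) := by
  refine h.testEq (C := .app (.val (.const ⟨i⟩)) (.val V)) ⟨lt_of_getElem? hi, hV⟩
    (fun E _ => ?_) (fun E _ => ?_)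
  · rw [Exp.fill, Exp.fill, Exp.fill, Val.fill_const_zero, look_of_getElem? (a := ⟨i⟩) hi]
    exact (Fire.beta _ _).red
  · rw [Exp.fill, Exp.fill, Exp.fill, Val.fill_const_zero, look_of_getElem? (a := ⟨i⟩) hi']
    exact (Fire.beta _ _).red

theorem SeqTestEq.push {Γ Δ : List (Val Prompt 0)} (h : SeqTestEq Γ Δ) {i : ℕ}
    {E E' : Ectx Prompt 0} (hi : Γ[i]? = some (.cont E)) (hi' : Δ[i]? = some (.cont E'))
    {C : Exp Hole 0} (hC : C.Valid Γ) :
    TestEq (Γ, E.plug (C.fill Γ)) (Δ, E'.plug (C.fill Δ)) := by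
  refine h.testEq (C := .push (.const ⟨i⟩) C) ⟨lt_of_getElem? hi, hC⟩
    (fun E _ => ?_) (fun E _ => ?_)
  · rw [Exp.fill, Val.fill_const_zero, look_of_getElem? (a := ⟨i⟩) hi]
    exact (Fire.push _ _).red
  · rw [Exp.fill, Val.fill_const_zero, look_of_getElem? (a := ⟨i⟩) hi']
    exact (Fire.push _ _).red

theorem SeqTestEq.new {Γ Δ : List (Val Prompt 0)} (h : SeqTestEq Γ Δ) {p q : Prompt}
    (hp : p ∉ seqPrompts Γ) (hq : q ∉ seqPrompts Δ) :
    TestEq (Γ, .val (.const p)) (Δ, .val (.const q)) :=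
  h.testEq (C := .fresh (.val (.var 0))) trivial
    (fun _ hE => (Fire.fresh p (.val (.var 0)) (by simp [Exp.prompts, Val.prompts])
      fun h => hp (hE h)).red)
    (fun _ hE => (Fire.fresh q (.val (.var 0)) (by simp [Exp.prompts, Val.prompts])
      fun h => hq (hE h)).red)

theorem exists_redBis (e : Exp Prompt 0) : ∃ e', RedBis e e' := by
  by_cases h : NormalForm e
  · exact ⟨e, .inr ⟨h, rfl⟩⟩
  · unfold NormalForm at h
    push Not at h
    exact h.imp fun _ => .inl

/-- A control-stuck expression reduces in a context by a capture only, which generates no prompt, so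
that the step is possible in every larger context. -/
theorem IsStuck.redStar_plug {E E₀ : Ectx Prompt 0} {e e' : Exp Prompt 0} (he : IsStuck e)
    (h : RedBis (E.plug e) e') : RedStar (E₀.plug (E.plug e)) (E₀.plug e') := by
  rcases h with h | ⟨-, rfl⟩
  · obtain ⟨E', p, e, -, rfl⟩ := he
    rw [← Ectx.comp_plug] at h
    rw [← Ectx.comp_plug E]
    have hf := (IsActive.red_iff_fire (.grab _ _)).1 h
    exact .single (.compat E₀ _ _ h (.of_subset (hf.prompts_subset (by simp))))
  · exact .refl

theorem TestEq.step {s t s' : State} {a : Label} (h : TestEq s t) (hs : Step s a s') :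
    ∃ t', WeakStep t a t' ∧ TestEq s' t' := by
  obtain ⟨Δ, e₂⟩ := t
  have single : ∀ {a e t'}, a ≠ Label.tau → WeakTau (Δ, e₂) (Δ, e) → Step (Δ, e) a t' →
      WeakStep (Δ, e₂) a t' :=
    fun ha hw hs => .inr ⟨ha, _, _, hw, hs, .refl⟩
  have value : ∀ {Γ v}, TestEq (Γ, .val v) (Δ, e₂) → ∃ w, WeakTau (Δ, e₂) (Δ, .val w) ∧
      TestEq (Γ, .val v) (Δ, .val w) := by
    intro Γ v h
    obtain ⟨_, ⟨w, rfl⟩, hw, h⟩ := h.reaches outcome_isValue ⟨v, rfl⟩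
    exact ⟨w, hw, h⟩
  cases hs with
  | tau Γ e e' hr hf =>
    exact ⟨_, .inl ⟨rfl, .refl⟩, h.length_eq, h.isDelim_iff, fun hF _ hO =>
      (conv_iff_of_red hO (hr.plug_fill hF hf)).symm.trans (h.conv_iff hF hO)⟩
  | lam Γ v i V e hi hV =>
    obtain ⟨w, hw, h⟩ := value h
    have hΓ := h.seqTestEq
    obtain ⟨e', hi'⟩ := hΓ.lam hi
    exact ⟨_, single (by simp) hw (.lam Δ w i V e' hi'
      (hV.congr hΓ.length_eq.le fun a => (hΓ.isDelim_iff a).1)), hΓ.beta hi hi' hV⟩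
  | val Γ v =>
    obtain ⟨w, hw, h⟩ := value h
    exact ⟨_, single (by simp) hw (.val Δ w), h⟩
  | ctx Γ v i C E hi hC =>
    obtain ⟨w, hw, h⟩ := value h
    have hΓ := h.seqTestEq
    obtain ⟨E', hi'⟩ := hΓ.cont hi
    exact ⟨_, single (by simp) hw (.ctx Δ w i C E' hi' (hΓ.valid hC)), hΓ.push hi hi' hC⟩
  | prompt Γ v i j p hi hj =>
    obtain ⟨w, hw, h⟩ := value h
    obtain ⟨q, hi', hj'⟩ := h.seqTestEq.prompt hi hj
    exact ⟨_, single (by simp) hw (.prompt Δ w i j q hi' hj'), h⟩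
  | new Γ v p hp =>
    obtain ⟨w, hw, h⟩ := value h
    obtain ⟨q, hq⟩ := exists_fresh_prompt (seqPrompts_finite (Δ ++ [w]))
    exact ⟨_, single (by simp) hw (.new Δ w q hq), h.seqTestEq.new hp hq⟩
  | stuck Γ F E p e e' hp hF hr =>
    have hst : IsStuck (E.plug (.grab (.const p) e)) := ⟨E, p, e, hp, rfl⟩
    obtain ⟨u, hu, hw, h⟩ := h.reaches outcome_isStuck hst
    obtain ⟨u', hu'⟩ := exists_redBis ((F.fill Δ).plug u)
    have hFΔ : F.Valid Δ := h.valid hF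
    have ⟨E', q, e₁, hq, he₁⟩ := hu
    refine ⟨(Δ, u'), single (by simp) hw ?_, h.length_eq, h.isDelim_iff, fun {F'} hF' O hO => ?_⟩
    · rw [he₁] at hu' ⊢
      exact .stuck Δ F E' q e₁ u' hq hFΔ hu'
    · have := h.conv_iff (F := F'.comp F) (hF'.comp hF) hO
      simp only [Ectx.fill_comp, Ectx.comp_plug] at this
      rwa [conv_iff_of_redStar hO (hst.redStar_plug hr),
        conv_iff_of_redStar hO (hu.redStar_plug hu')] at this

theorem isBisimulation_testEq : IsBisimulation TestEq := by
  refine ⟨fun _ _ h => h, fun s t h => ⟨fun a s' hs => h.step hs, fun a t' ht => ?_⟩⟩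
  obtain ⟨s', hs, h'⟩ := h.symm.step ht
  exact ⟨s', hs, h'.symm⟩

theorem CtxEq.testEq {e₁ e₂ : Exp Prompt 0} (h : CtxEq e₁ e₂) : TestEq ([], e₁) ([], e₂) where
  length_eq := rfl
  isDelim_iff _ := Iff.rfl
  conv_iff hF _ hO := by
    refine obsEq_iff.1 (h _ (Set.eq_empty_of_subset_empty ?_)) _ hO
    refine (Ectx.fill_prompts_subset hF).trans fun p hp => ?_
    simp [seqPrompts] at hp

end LamPrompt

theorem theoremt (e₁ e₂ : LamPrompt.Exp LamPrompt.Prompt 0) :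
    LamPrompt.CtxEq e₁ e₂ ↔ LamPrompt.Bisimilar ([], e₁) ([], e₂) :=
  ⟨fun h => ⟨_, LamPrompt.isBisimulation_testEq, h.testEq⟩, fun h => h.ctxEq⟩
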